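/- Let $\mathsf{B}$ be a category with (chosen) finite products, and let $\mathsf{p}\colon\mathsf{E}\to\mathsf{B}$ be a cloven and split fibration with simple products; that is, for every projection $\pi_I\colon I\times X\to I$ the weakening functor $\pi_I^*\colon \mathsf{E}_I\to\mathsf{E}_{I\times X}$ has a right adjoint $\prod_{\pi_I}$, and these adjoints satisfy the Beck--Chevalley condition for the pullback squares formed by $f\times \mathrm{id}_X\colon I\times X\to J\times X$, $f\colon I\to J$ and the projections. Then the following are equivalent. (1) $\mathsf{p}$ is an instance of the simple product completion: there is a cloven and split fibration $\mathsf{p}'\colon\mathsf{E}'\to\mathsf{B}$ such that $\mathsf{p}$ is equivalent, as a fibration over $\mathsf{B}$, to $\mathrm{Prod}(\mathsf{p}')$. (2) $\mathsf{p}$ has enough $\prod$-quantifier-free objects: for every object $I$ of $\mathsf{B}$ and every $\alpha\in\mathsf{E}_I$ there are an object $A$ of $\mathsf{B}$ and a $\prod$-quantifier-free object $\beta\in\mathsf{E}_{I\times A}$ with $\alpha\cong\prod_{\pi_I}\beta$ in $\mathsf{E}_I$. Here $\mathrm{Prod}(\mathsf{p}')$ is the category whose objects are triples $(I,X,\alpha)$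 with $I,X$ objects of $\mathsf{B}$ and $\alpha\in\mathsf{E}'_{I\times X}$, and whose arrows $(I,X,\alpha)\to(J,Y,\beta)$ are triples $(f_0,f_1,\phi)$ with $f_0\colon I\to J$ and $f_1\colon I\times Y\to X$ in $\mathsf{B}$ and $\phi\colon\langle\pi_I,f_1\rangle^*\alpha\to\langle f_0\pi_I,\pi_Y\rangle^*\beta$ in $\mathsf{E}'_{I\times Y}$; it is fibred over $\mathsf{B}$ by $(I,X,\alpha)\mapsto I$. An equivalence of fibrations over $\mathsf{B}$ is a pair of functors commuting with the projections to $\mathsf{B}$ and preserving Cartesian arrows that are mutually inverse up to vertical natural isomorphisms. An object $\alpha\in\mathsf{E}_I$ is $\prod$-quantifier-free if for all objects $A,X$ of $\mathsf{B}$, every arrow $f\colon A\to I$, every $\beta\in\mathsf{E}_{A\times X}$ and every vertical arrow $h\colon\prod_{\pi_A}\beta\to f^*\alpha$ there is a unique pair $(g,\overline{h})$, consisting of an arrow $g\colon A\to X$ of $\mathsf{B}$ and a vertical arrow $\overline{h}\colon\langle 1_A,g\rangle^*\beta\to f^*\alpha$, such that $h$ is the composite $$\prod_{\pi_A}\beta=\langle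 1_A,g\rangle^*\pi_A^*\prod_{\pi_A}\beta\xrightarrow{\ \langle 1_A,g\rangle^*\varepsilon_\beta\ }\langle 1_A,g\rangle^*\beta\xrightarrow{\ \overline{h}\ }f^*\alpha,$$ where $\varepsilon_\beta$ is the counit of $\pi_A^*\dashv\prod_{\pi_A}$ at $\beta$. -/

import Mathlib

open CategoryTheory MonoidalCategory CartesianMonoidalCategory

universe u₁ v₁ u₂ v₂ u₃ v₃

noncomputable section

namespace SplitFib

variable {B : Type u₁} [Category.{v₁} B]

/-- A split cleavage on a functor `p : E ⥤ B`. For every arrow `u : I ⟶ J` of the base and every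
object `Y` of the fibre over `J`, a chosen (strongly) Cartesian arrow `cart u Y : u^* Y ⟶ Y` over
`u`, where `u^* Y` is written `pull u Y`. The choice is strictly functorial in `u`.
A functor together with a split cleavage is a cloven and split fibration. -/
structure SplitCleavage {E : Type u₂} [Category.{v₂} E] (p : E ⥤ B) where
  /-- the reindexed object -/
  pull {I J : B} (u : I ⟶ J) (Y : p.Fiber J) : p.Fiber I
  /-- the chosen Cartesian lift -/
  cart {I J : B} (u : I ⟶ J) (Y : p.Fiber J) : (pull u Y).1 ⟶ Y.1
  cart_isStronglyCartesian {I J : B} (u : I ⟶ J) (Y : p.Fiber J) :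
    p.IsStronglyCartesian u (cart u Y)
  pull_id {J : B} (Y : p.Fiber J) : pull (𝟙 J) Y = Y
  pull_comp {I J K : B} (u : I ⟶ J) (v : J ⟶ K) (Y : p.Fiber K) :
    pull (u ≫ v) Y = pull u (pull v Y)
  cart_id {J : B} (Y : p.Fiber J) :
    cart (𝟙 J) Y = eqToHom (congrArg Subtype.val (pull_id Y))
  cart_comp {I J K : B} (u : I ⟶ J) (v : J ⟶ K) (Y : p.Fiber K) :
    cart (u ≫ v) Y =
      eqToHom (congrArg Subtype.val (pull_comp u v Y)) ≫ cart u (pull v Y) ≫ cart v Y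

section Fibrewise

variable {E : Type u₂} [Category.{v₂} E] {p : E ⥤ B}

theorem fiber_hom_ext {I : B} {X Y : p.Fiber I} {f g : X ⟶ Y} (h : f.1 = g.1) : f = g :=
  Subtype.ext h

theorem fiber_comp_val {I : B} {X Y Z : p.Fiber I} (f : X ⟶ Y) (g : Y ⟶ Z) :
    (f ≫ g).1 = f.1 ≫ g.1 := rfl

theorem fiber_id_val {I : B} (X : p.Fiber I) : (𝟙 X : X ⟶ X).1 = 𝟙 X.1 := rfl

theorem fiber_eqToHom_val {I : B} {X Y : p.Fiber I} (h : X = Y) :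
    (eqToHom h).1 = eqToHom (congrArg Subtype.val h) := by
  subst h; rfl

namespace SplitCleavage

variable (c : SplitCleavage p)

theorem vertical_ext {I J : B} (u : I ⟶ J) (Y : p.Fiber J) {X : p.Fiber I}
    {f g : X ⟶ c.pull u Y} (h : f.1 ≫ c.cart u Y = g.1 ≫ c.cart u Y) : f = g := by
  have := c.cart_isStronglyCartesian u Y
  have := f.2
  have := g.2
  exact fiber_hom_ext (Functor.IsCartesian.ext p u (c.cart u Y) f.1 g.1 h)

theorem isHomLift_cart_comp {I J : B} (u : I ⟶ J) {Y Z : p.Fiber J} (φ : Y ⟶ Z) :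
    p.IsHomLift u (c.cart u Y ≫ φ.1) := by
  have := c.cart_isStronglyCartesian u Y
  have := φ.2
  have h : p.IsHomLift (u ≫ 𝟙 J) (c.cart u Y ≫ φ.1) := inferInstance
  rwa [Category.comp_id] at h

/-- The action `u^* φ` of reindexing on a vertical arrow: the unique vertical arrow with
`u^* φ ≫ cart u Z = cart u Y ≫ φ`. -/
def pullMap {I J : B} (u : I ⟶ J) {Y Z : p.Fiber J} (φ : Y ⟶ Z) : c.pull u Y ⟶ c.pull u Z :=
  haveI := c.cart_isStronglyCartesian u Z
  haveI := c.isHomLift_cart_comp u φ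
  ⟨Functor.IsCartesian.map p u (c.cart u Z) (c.cart u Y ≫ φ.1), inferInstance⟩

theorem pullMap_cart {I J : B} (u : I ⟶ J) {Y Z : p.Fiber J} (φ : Y ⟶ Z) :
    (c.pullMap u φ).1 ≫ c.cart u Z = c.cart u Y ≫ φ.1 := by
  have := c.cart_isStronglyCartesian u Z
  have := c.isHomLift_cart_comp u φ
  exact Functor.IsCartesian.fac p u (c.cart u Z) (c.cart u Y ≫ φ.1)

theorem pullMap_id {I J : B} (u : I ⟶ J) (Y : p.Fiber J) : c.pullMap u (𝟙 Y) = 𝟙 _ := by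
  apply c.vertical_ext
  rw [pullMap_cart, fiber_id_val, fiber_id_val, Category.comp_id, Category.id_comp]

theorem pullMap_comp {I J : B} (u : I ⟶ J) {X Y Z : p.Fiber J} (φ : X ⟶ Y) (ψ : Y ⟶ Z) :
    c.pullMap u (φ ≫ ψ) = c.pullMap u φ ≫ c.pullMap u ψ := by
  apply c.vertical_ext
  rw [pullMap_cart, fiber_comp_val, fiber_comp_val, Category.assoc, pullMap_cart,
    ← Category.assoc, ← Category.assoc, pullMap_cart]

/-- The substitution functor `u^* : E_J ⥤ E_I`. -/
def reindex {I J : B} (u : I ⟶ J) : p.Fiber J ⥤ p.Fiber I where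
  obj Y := c.pull u Y
  map φ := c.pullMap u φ
  map_id Y := c.pullMap_id u Y
  map_comp φ ψ := c.pullMap_comp u φ ψ

theorem pull_pull {I J J' K : B} {u : I ⟶ J} {v : J ⟶ K} {u' : I ⟶ J'} {v' : J' ⟶ K}
    (h : u ≫ v = u' ≫ v') (Y : p.Fiber K) :
    c.pull u (c.pull v Y) = c.pull u' (c.pull v' Y) := by
  rw [← c.pull_comp, h, c.pull_comp]

theorem pull_of_comp_eq {I J K : B} {w : I ⟶ J} {u : J ⟶ K} {u' : I ⟶ K} (h : w ≫ u = u')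
    (Y : p.Fiber K) : c.pull u' Y = c.pull w (c.pull u Y) := by
  rw [← h, c.pull_comp]

/-- For a vertical `φ : u^* X ⟶ v^* Y`, the arrow `w^* φ`, seen as an arrow
`(w ≫ u)^* X ⟶ (w ≫ v)^* Y` through the splitting. The composites `u' = w ≫ u`, `v' = w ≫ v`
may be presented in any form. -/
def sub {I J K L : B} (w : I ⟶ J) {u : J ⟶ K} {v : J ⟶ L} {u' : I ⟶ K} {v' : I ⟶ L}
    (hu : w ≫ u = u') (hv : w ≫ v = v') {X : p.Fiber K} {Y : p.Fiber L}
    (φ : c.pull u X ⟶ c.pull v Y) : c.pull u' X ⟶ c.pull v' Y :=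
  eqToHom (c.pull_of_comp_eq hu X) ≫ c.pullMap w φ ≫
    eqToHom (c.pull_of_comp_eq hv Y).symm

theorem sub_cart {I J K L : B} (w : I ⟶ J) {u : J ⟶ K} {v : J ⟶ L} {u' : I ⟶ K} {v' : I ⟶ L}
    (hu : w ≫ u = u') (hv : w ≫ v = v') {X : p.Fiber K} {Y : p.Fiber L}
    (φ : c.pull u X ⟶ c.pull v Y) :
    (c.sub w hu hv φ).1 ≫ c.cart v' Y =
      eqToHom (congrArg Subtype.val (c.pull_of_comp_eq hu X)) ≫
        c.cart w (c.pull u X) ≫ φ.1 ≫ c.cart v Y := by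
  subst hu hv
  simp only [sub, fiber_comp_val, fiber_eqToHom_val, c.cart_comp, Category.assoc,
    eqToHom_trans_assoc, eqToHom_refl, Category.id_comp]
  congr 1
  rw [← Category.assoc, c.pullMap_cart, Category.assoc]

theorem sub_id {J K L : B} {u : J ⟶ K} {v : J ⟶ L} (hu : 𝟙 J ≫ u = u) (hv : 𝟙 J ≫ v = v)
    {X : p.Fiber K} {Y : p.Fiber L} (φ : c.pull u X ⟶ c.pull v Y) : c.sub (𝟙 J) hu hv φ = φ := by
  apply c.vertical_ext
  rw [sub_cart, c.cart_id, eqToHom_trans_assoc, eqToHom_refl, Category.id_comp]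

theorem sub_comp {I J K L M : B} (w : I ⟶ J) {u : J ⟶ K} {v : J ⟶ L} {t : J ⟶ M}
    {u' : I ⟶ K} {v' : I ⟶ L} {t' : I ⟶ M}
    (hu : w ≫ u = u') (hv : w ≫ v = v') (ht : w ≫ t = t')
    {X : p.Fiber K} {Y : p.Fiber L} {Z : p.Fiber M}
    (φ : c.pull u X ⟶ c.pull v Y) (ψ : c.pull v Y ⟶ c.pull t Z) :
    c.sub w hu ht (φ ≫ ψ) = c.sub w hu hv φ ≫ c.sub w hv ht ψ := by
  simp [sub, pullMap_comp]

theorem sub_sub {H I J K L : B} (z : H ⟶ I) (w : I ⟶ J) (zw : H ⟶ J) (hz : z ≫ w = zw)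
    {u : J ⟶ K} {v : J ⟶ L} {u' : I ⟶ K} {v' : I ⟶ L} {u'' : H ⟶ K} {v'' : H ⟶ L}
    (hu : w ≫ u = u') (hv : w ≫ v = v') (hu' : z ≫ u' = u'') (hv' : z ≫ v' = v'')
    (hu'' : zw ≫ u = u'') (hv'' : zw ≫ v = v'')
    {X : p.Fiber K} {Y : p.Fiber L} (φ : c.pull u X ⟶ c.pull v Y) :
    c.sub z hu' hv' (c.sub w hu hv φ) = c.sub zw hu'' hv'' φ := by
  subst hz
  subst hu hv hu' hv'
  apply c.vertical_ext
  rw [sub_cart, sub_cart, sub_cart, c.cart_comp]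
  have key : ∀ {S T : p.Fiber I} (h : S = T),
      c.cart z S ≫ eqToHom (congrArg Subtype.val h) =
        eqToHom (congrArg (fun R => (c.pull z R).1) h) ≫ c.cart z T := by
    intro S T h
    subst h
    simp
  rw [← Category.assoc (c.cart z _) (eqToHom _), key (c.pull_comp w u X)]
  simp only [Category.assoc, eqToHom_trans_assoc]

theorem eqToHom_cart {I J : B} {u v : I ⟶ J} (h : u = v) (X : p.Fiber J) :
    (eqToHom (congrArg (fun t => c.pull t X) h)).1 ≫ c.cart v X = c.cart u X := by
  subst h
  simp [fiber_id_val]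

theorem sub_eqToHom {I J K : B} (w : I ⟶ J) {u v : J ⟶ K} {u' v' : I ⟶ K}
    (hu : w ≫ u = u') (hv : w ≫ v = v') {X : p.Fiber K} (h : u = v) (h' : u' = v') :
    c.sub w hu hv (eqToHom (congrArg (fun t => c.pull t X) h)) =
      eqToHom (congrArg (fun t => c.pull t X) h') := by
  subst h hu hv
  simp [sub, pullMap_id]

theorem sub_eqToHom_comp {I J J' K L : B} {w : I ⟶ J'} {s t : J' ⟶ K} (hst : s = t)
    {k k' : I ⟶ J} (hkk : k = k') {u : J ⟶ K} {v : J ⟶ L} {u₁ u₂ : I ⟶ K} {v' : I ⟶ L}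
    (hs : w ≫ s = u₁) (ht : w ≫ t = u₂) (hk : k ≫ u = u₂) (hv : k ≫ v = v')
    (hk' : k' ≫ u = u₁) (hv' : k' ≫ v = v') {X : p.Fiber K} {Y : p.Fiber L}
    (ψ : c.pull u X ⟶ c.pull v Y) :
    c.sub w hs ht (eqToHom (congrArg (fun t => c.pull t X) hst)) ≫ c.sub k hk hv ψ =
      c.sub k' hk' hv' ψ := by
  obtain rfl : u₁ = u₂ := by rw [← hs, ← ht, hst]
  subst hkk
  have e := c.sub_eqToHom w hs ht (X := X) hst rfl
  rw [eqToHom_refl] at e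
  exact (congrArg (fun r => r ≫ c.sub k hk hv ψ) e).trans (Category.id_comp _)

theorem sub_comp_eqToHom {I J J' K L : B} {w : I ⟶ J'} {s t : J' ⟶ L} (hst : s = t)
    {k k' : I ⟶ J} (hkk : k = k') {u : J ⟶ K} {v : J ⟶ L} {u' : I ⟶ K} {v₁ v₂ : I ⟶ L}
    (hs : w ≫ s = v₁) (ht : w ≫ t = v₂) (hu : k ≫ u = u') (hv : k ≫ v = v₁)
    (hu' : k' ≫ u = u') (hv' : k' ≫ v = v₂) {X : p.Fiber K} {Y : p.Fiber L}
    (ψ : c.pull u X ⟶ c.pull v Y) :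
    c.sub k hu hv ψ ≫ c.sub w hs ht (eqToHom (congrArg (fun t => c.pull t Y) hst)) =
      c.sub k' hu' hv' ψ := by
  obtain rfl : v₁ = v₂ := by rw [← hs, ← ht, hst]
  subst hkk
  have e := c.sub_eqToHom w hs ht (X := Y) hst rfl
  rw [eqToHom_refl] at e
  exact (congrArg (fun r => c.sub k hu hv ψ ≫ r) e).trans (Category.comp_id _)

theorem sub_assoc {A A₁ A₂ A₃ A₄ A₅ K L M N : B}
    {w₁ : A ⟶ A₁} {h : A₁ ⟶ A₂} {k : A₁ ⟶ A₃} {k₁ : A ⟶ A₄}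
    {w₂ : A ⟶ A₂} {k₂ : A ⟶ A₅} {h' : A₅ ⟶ A₃} {k' : A₅ ⟶ A₄}
    (e₁ : w₁ ≫ h = w₂) (e₂ : w₁ ≫ k = k₂ ≫ h') (e₃ : k₂ ≫ k' = k₁)
    {u : A₂ ⟶ K} {v : A₂ ⟶ L} {s : A₃ ⟶ L} {t : A₃ ⟶ M} {x : A₄ ⟶ M} {y : A₄ ⟶ N}
    {hu : A₁ ⟶ K} {hv : A₁ ⟶ L} {kt : A₁ ⟶ M} {a a' : A ⟶ K} {b : A ⟶ M} {z z' : A ⟶ N}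
    {l : A ⟶ L} {hs : A₅ ⟶ L} {ht : A₅ ⟶ M} {hy : A₅ ⟶ N}
    (p₁ : h ≫ u = hu) (p₂ : h ≫ v = hv) (p₃ : k ≫ s = hv) (p₄ : k ≫ t = kt)
    (p₅ : w₁ ≫ hu = a) (p₆ : w₁ ≫ kt = b) (p₇ : k₁ ≫ x = b) (p₈ : k₁ ≫ y = z)
    (q₁ : w₂ ≫ u = a') (q₂ : w₂ ≫ v = l) (q₃ : h' ≫ s = hs) (q₄ : h' ≫ t = ht)
    (q₅ : k' ≫ x = ht) (q₆ : k' ≫ y = hy) (q₇ : k₂ ≫ hs = l) (q₈ : k₂ ≫ hy = z')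
    (r₁ : 𝟙 A ≫ a' = a) (r₂ : 𝟙 A ≫ z' = z)
    {W : p.Fiber K} {X : p.Fiber L} {Y : p.Fiber M} {Z : p.Fiber N}
    (α : c.pull u W ⟶ c.pull v X) (β : c.pull s X ⟶ c.pull t Y) (γ : c.pull x Y ⟶ c.pull y Z) :
    c.sub w₁ p₅ p₆ (c.sub h p₁ p₂ α ≫ c.sub k p₃ p₄ β) ≫ c.sub k₁ p₇ p₈ γ =
      c.sub (𝟙 A) r₁ r₂
        (c.sub w₂ q₁ q₂ α ≫ c.sub k₂ q₇ q₈ (c.sub h' q₃ q₄ β ≫ c.sub k' q₅ q₆ γ)) := by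
  obtain rfl : a' = a := by rw [← r₁, Category.id_comp]
  obtain rfl : z' = z := by rw [← r₂, Category.id_comp]
  have m₁ : w₁ ≫ hv = l := by rw [← p₂, ← Category.assoc, e₁, q₂]
  have m₂ : k₂ ≫ ht = b := by rw [← q₅, ← Category.assoc, e₃, p₇]
  rw [c.sub_id, c.sub_comp w₁ p₅ m₁ p₆, c.sub_comp k₂ q₇ m₂ q₈,
    c.sub_sub w₁ h w₂ e₁ p₁ p₂ p₅ m₁ q₁ q₂,
    c.sub_sub w₁ k (w₁ ≫ k) rfl p₃ p₄ m₁ p₆ (by rw [Category.assoc, p₃, m₁])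
      (by rw [Category.assoc, p₄, p₆]),
    c.sub_sub k₂ k' k₁ e₃ q₅ q₆ m₂ q₈ p₇ p₈,
    c.sub_sub k₂ h' (w₁ ≫ k) e₂.symm q₃ q₄ q₇ m₂ (by rw [Category.assoc, p₃, m₁])
      (by rw [Category.assoc, p₄, p₆]), Category.assoc]

end SplitCleavage

end Fibrewise

section SimpleProducts

variable [CartesianMonoidalCategory B] {E : Type u₂} [Category.{v₂} E] {p : E ⥤ B}

/-- The canonical Beck-Chevalley comparison `f^* (∏ β) ⟶ ∏ ((f × id)^* β)` for the pullback square
with sides `f × id : I × X ⟶ J × X`, `f : I ⟶ J` and the two projections: the transpose of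
`π^* f^* ∏ β = (f × id)^* π^* ∏ β ⟶ (f × id)^* β`, given by the counit. -/
def bccMap (c : SplitCleavage p) {I J X : B}
    {P : p.Fiber (I ⊗ X) ⥤ p.Fiber I} (adjP : c.reindex (fst I X) ⊣ P)
    {Q : p.Fiber (J ⊗ X) ⥤ p.Fiber J} (adjQ : c.reindex (fst J X) ⊣ Q)
    (f : I ⟶ J) (β : p.Fiber (J ⊗ X)) :
    (c.reindex f).obj (Q.obj β) ⟶ P.obj ((c.reindex (f ▷ X)).obj β) :=
  adjP.homEquiv _ _
    ((eqToHom (c.pull_pull (whiskerRight_fst f X).symm (Q.obj β)) :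
        (c.reindex (fst I X)).obj ((c.reindex f).obj (Q.obj β)) ⟶
          (c.reindex (f ▷ X)).obj ((c.reindex (fst J X)).obj (Q.obj β))) ≫
      (c.reindex (f ▷ X)).map (adjQ.counit.app β))

/-- Simple products: right adjoints `prodFunctor I X` to all weakening functors along the
projections `I × X ⟶ I`, subject to the Beck-Chevalley condition. -/
structure SimpleProducts (c : SplitCleavage p) where
  /-- the functor `∏ : E_{I × X} ⥤ E_I` -/
  prodFunctor (I X : B) : p.Fiber (I ⊗ X) ⥤ p.Fiber I
  /-- it is right adjoint to weakening -/
  adj (I X : B) : c.reindex (fst I X) ⊣ prodFunctor I X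
  bcc {I J : B} (f : I ⟶ J) (X : B) (β : p.Fiber (J ⊗ X)) :
    IsIso (bccMap c (adj I X) (adj J X) f β)

namespace SimpleProducts

variable {c : SplitCleavage p} (S : SimpleProducts c)

/-- The arrow `∏ β = ⟨1, g⟩^* (π^* ∏ β) ⟶ ⟨1, g⟩^* β` given by the counit at `β`: instantiation of
a universally quantified formula at the term `g`. -/
def inst {A X : B} (β : p.Fiber (A ⊗ X)) (g : A ⟶ X) :
    (S.prodFunctor A X).obj β ⟶ (c.reindex (lift (𝟙 A) g)).obj β :=
  (eqToHom ((c.pull_id _).symm.trans (c.pull_of_comp_eq (lift_fst (𝟙 A) g) _)) :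
      (S.prodFunctor A X).obj β ⟶ (c.reindex (lift (𝟙 A) g)).obj
        ((c.reindex (fst A X)).obj ((S.prodFunctor A X).obj β))) ≫
    (c.reindex (lift (𝟙 A) g)).map ((S.adj A X).counit.app β)

/-- `∏`-quantifier-free objects: every vertical arrow `h : ∏ β ⟶ f^* α` factors, for a unique pair
`(g, h')`, as `∏ β ⟶ ⟨1, g⟩^* β` followed by `h' : ⟨1, g⟩^* β ⟶ f^* α`. -/
def IsQuantifierFree {I : B} (α : p.Fiber I) : Prop :=
  ∀ (A X : B) (f : A ⟶ I) (β : p.Fiber (A ⊗ X))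
    (h : (S.prodFunctor A X).obj β ⟶ (c.reindex f).obj α),
    ∃! gh : (Σ g : A ⟶ X, ((c.reindex (lift (𝟙 A) g)).obj β ⟶ (c.reindex f).obj α)),
      h = S.inst β gh.1 ≫ gh.2

/-- Enough `∏`-quantifier-free objects: every object of every fibre is, up to vertical
isomorphism, a simple product of a `∏`-quantifier-free object. -/
def HasEnoughQuantifierFree : Prop :=
  ∀ (I : B) (α : p.Fiber I), ∃ (X : B) (β : p.Fiber (I ⊗ X)),
    S.IsQuantifierFree β ∧ Nonempty (α ≅ (S.prodFunctor I X).obj β)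

end SimpleProducts

/-- Objects `(I, X, α)`, with `α` in the fibre over `I × X`, of the simple product completion. -/
structure ProdCompletion (c : SplitCleavage p) where
  base : B
  bound : B
  form : p.Fiber (base ⊗ bound)

namespace ProdCompletion

variable {c : SplitCleavage p}

/-- Arrows `(I, X, α) ⟶ (J, Y, β)` of the simple product completion: triples of
`f₀ : I ⟶ J`, `f₁ : I × Y ⟶ X` and a vertical arrow
`φ : ⟨π_I, f₁⟩^* α ⟶ ⟨f₀ π_I, π_Y⟩^* β` over `I × Y`. -/
structure Hom (P Q : ProdCompletion c) where
  f₀ : P.base ⟶ Q.base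
  f₁ : P.base ⊗ Q.bound ⟶ P.bound
  φ : c.pull (lift (fst P.base Q.bound) f₁) P.form ⟶
    c.pull (lift (fst P.base Q.bound ≫ f₀) (snd P.base Q.bound)) Q.form

theorem Hom.ext' {P Q : ProdCompletion c} {F G : Hom P Q} (h₀ : F.f₀ = G.f₀) (h₁ : F.f₁ = G.f₁)
    (h : F.φ = c.sub (𝟙 _) (by simp [h₁]) (by simp [h₀]) G.φ) : F = G := by
  obtain ⟨f₀, f₁, φ⟩ := F
  obtain ⟨g₀, g₁, ψ⟩ := G
  dsimp only at h₀ h₁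
  subst h₀ h₁
  rw [SplitCleavage.sub_id] at h
  dsimp only at h
  rw [h]

/-- The identity `(1, π_X, 1)`. -/
def Hom.id (P : ProdCompletion c) : Hom P P where
  f₀ := 𝟙 _
  f₁ := snd _ _
  φ := eqToHom (by rw [Category.comp_id])

/-- Composition: for `(f₀, f₁, φ) : (I, X, α) ⟶ (J, Y, β)` and
`(g₀, g₁, ψ) : (J, Y, β) ⟶ (K, Z, γ)` put `k = ⟨f₀ π_I, π_Z⟩ : I × Z ⟶ J × Z` and
`h = ⟨π_I, g₁ k⟩ : I × Z ⟶ I × Y`; the composite is `(g₀ f₀, f₁ h, k^* ψ ∘ h^* φ)`. -/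
def Hom.comp {P Q R : ProdCompletion c} (F : Hom P Q) (G : Hom Q R) : Hom P R where
  f₀ := F.f₀ ≫ G.f₀
  f₁ := lift (fst _ _) (lift (fst _ _ ≫ F.f₀) (snd _ _) ≫ G.f₁) ≫ F.f₁
  φ := c.sub (v' := lift (fst P.base R.bound ≫ F.f₀)
          (lift (fst P.base R.bound ≫ F.f₀) (snd P.base R.bound) ≫ G.f₁))
        (lift (fst P.base R.bound)
          (lift (fst P.base R.bound ≫ F.f₀) (snd P.base R.bound) ≫ G.f₁))
        (by simp) (by simp) F.φ ≫
      c.sub (lift (fst P.base R.bound ≫ F.f₀) (snd P.base R.bound))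
        (by simp) (by simp) G.φ

instance instCategory : Category (ProdCompletion c) where
  Hom := Hom
  id := Hom.id
  comp := Hom.comp
  id_comp := by
    intro P Q G
    refine Hom.ext' ?_ ?_ ?_
    · simp [Hom.comp, Hom.id]
    · simp [Hom.comp, Hom.id]
    · refine c.sub_eqToHom_comp ?_ ?_ ?_ ?_ ?_ ?_ ?_ ?_ G.φ <;> simp [Hom.id]
  comp_id := by
    intro P Q F
    refine Hom.ext' ?_ ?_ ?_
    · simp [Hom.comp, Hom.id]
    · simp [Hom.comp, Hom.id]
    · refine c.sub_comp_eqToHom ?_ ?_ ?_ ?_ ?_ ?_ ?_ ?_ F.φ <;> simp [Hom.id]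
  assoc := by
    intro P Q R T F G H
    refine Hom.ext' ?_ ?_ ?_
    · simp [Hom.comp]
    · simp [Hom.comp, ← Category.assoc, comp_lift]
    · dsimp only [Hom.comp]
      refine c.sub_assoc ?_ ?_ ?_ ?_ ?_ ?_ ?_ ?_ ?_ ?_ ?_ ?_ ?_ ?_ ?_ ?_ ?_ ?_ ?_ ?_ ?_
        F.φ G.φ H.φ <;> simp [← Category.assoc, comp_lift]

/-- The projection `(I, X, α) ↦ I`: the simple product completion as a category over the base. -/
def proj (c : SplitCleavage p) : ProdCompletion c ⥤ B where
  obj P := P.base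
  map F := F.f₀
  map_id _ := rfl
  map_comp _ _ := rfl

end ProdCompletion

end SimpleProducts

/-- Equivalences of fibrations over `B`: two functors that strictly commute with the projections
and preserve Cartesian arrows, and that are mutually inverse up to vertical natural isomorphisms. -/
structure FibredEquivalence {E : Type u₂} [Category.{v₂} E] {D : Type u₃} [Category.{v₃} D]
    (p : E ⥤ B) (q : D ⥤ B) where
  functor : E ⥤ D
  inverse : D ⥤ E
  functor_comp : functor ⋙ q = p
  inverse_comp : inverse ⋙ p = q
  functor_cartesian {I J : B} (u : I ⟶ J) {X Y : E} (φ : X ⟶ Y) :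
    p.IsStronglyCartesian u φ → q.IsStronglyCartesian u (functor.map φ)
  inverse_cartesian {I J : B} (u : I ⟶ J) {X Y : D} (φ : X ⟶ Y) :
    q.IsStronglyCartesian u φ → p.IsStronglyCartesian u (inverse.map φ)
  unitIso : 𝟭 E ≅ functor ⋙ inverse
  counitIso : inverse ⋙ functor ≅ 𝟭 D
  unit_vertical (X : E) : p.IsHomLift (𝟙 (p.obj X)) (unitIso.hom.app X)
  counit_vertical (Y : D) : q.IsHomLift (𝟙 (q.obj Y)) (counitIso.hom.app Y)

end SplitFib

end

/-!
The equivalence compares two descriptions of `∏ α`. In the completion `Prod(p')` the formal product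
`(I, X, α)` is the simple product along `X` of the object `(I × X, 1, α)`, and an arrow
`f = (f₀, f₁, φ) : (I, X, α) ⟶ (J, Y, β)` is an operation: an element of `α` at `(a, f₁(a, y))` is
sent to an element of `β` at `(f₀ a, y)` (`ProdCompletion.act`). Equations between arrows of the
completion are proved by evaluating them on such elements, which are arrows of the total category.

Simple products are handled in the same way. A span `∏ b ⟵ π^* ∏ b ⟶ b` (`IsProdSpan`) carries the
universal property together with the Beck-Chevalley condition, and an arrow into `∏ b` is determined
by its instances at terms (`IsProdSpan.ev`). Phrased through such spans, quantifier-freeness (`IsQF`)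
and the existence of enough quantifier-free objects (`HasEnoughQF`) mention no cleavage, agree with
the given notions (`SimpleProducts.hasEnoughQuantifierFree_iff`), and are invariant under
equivalences over the base (`HasEnoughQF.of_fibredEquivalence`).

From left to right, the completion has enough quantifier-free objects: the objects `(I, 1, α)` are
quantifier-free (`ProdCompletion.isQF_unit`), since the second component of an arrow
`(A, X × Z, γ) ⟶ (I, 1, α)` amounts to a term of type `X` and a term of type `Z`. The former is the
witness through which the arrow factors, and the latter belongs to the factored arrow.

From right to left, the quantifier-free objects are closed under reindexing and so form a split
fibration `p'`. The functor `Prod(p') ⥤ E` sending `(I, X, α)` to `∏ α` is fully faithful: an arrow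
`∏ α ⟶ ∏ β` is the same as an arrow `π^* ∏ α ⟶ β`, and as `β` is quantifier-free, the latter factors
uniquely through the instance of `∏ α` at some term `f₁ : I × Y ⟶ X`
(`ProdCompletion.eval_map_bijective`). This functor is essentially surjective, through vertical
isomorphisms, when there are enough quantifier-free objects. A fully faithful functor over the base
with that property is an equivalence of fibrations (`VertEssSurj.fibredEquivalence`).
-/

noncomputable section

namespace SplitFib

/-! ### Lifting through Cartesian arrows -/

section Lifting

variable {B : Type u₁} [Category.{v₁} B] {E : Type u₂} [Category.{v₂} E] {p : E ⥤ B}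

theorem isHomLift_congr {I J : B} {u v : I ⟶ J} {X Y : E} {φ : X ⟶ Y} (e : u = v)
    (h : p.IsHomLift u φ) : p.IsHomLift v φ := e ▸ h

theorem isHomLift_comp {I J K : B} {u : I ⟶ J} {v : J ⟶ K} {w : I ⟶ K} {X Y Z : E}
    {φ : X ⟶ Y} {ψ : Y ⟶ Z} (hφ : p.IsHomLift u φ) (hψ : p.IsHomLift v ψ) (e : u ≫ v = w) :
    p.IsHomLift w (φ ≫ ψ) := by
  subst e; infer_instance

theorem isHomLift_comp_id {I J : B} {u : I ⟶ J} {X Y Z : E}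
    {φ : X ⟶ Y} {ψ : Y ⟶ Z} (hφ : p.IsHomLift u φ) (hψ : p.IsHomLift (𝟙 J) ψ) :
    p.IsHomLift u (φ ≫ ψ) := isHomLift_comp hφ hψ (Category.comp_id u)

theorem isHomLift_id_comp {I J : B} {u : I ⟶ J} {X Y Z : E}
    {φ : X ⟶ Y} {ψ : Y ⟶ Z} (hφ : p.IsHomLift (𝟙 I) φ) (hψ : p.IsHomLift u ψ) :
    p.IsHomLift u (φ ≫ ψ) := isHomLift_comp hφ hψ (Category.id_comp u)

theorem isHomLift_id {I : B} {X : E} (h : p.obj X = I) : p.IsHomLift (𝟙 I) (𝟙 X) :=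
  IsHomLift.id h

theorem isHomLift_iso_inv {I : B} {X Y : E} (e : X ≅ Y) (h : p.IsHomLift (𝟙 I) e.hom) :
    p.IsHomLift (𝟙 I) e.inv := inferInstance

variable {I J : B} {u : I ⟶ J} {X Y : E} {φ : X ⟶ Y}

/-- The arrow over `w` induced by the Cartesian arrow `φ` over `u` from an arrow `s` over
`w ≫ u`. -/
def cartLift (hφ : p.IsStronglyCartesian u φ) {K : B} (w : K ⟶ I) {t : K ⟶ J} (e : w ≫ u = t)
    {W : E} (s : W ⟶ Y) (hs : p.IsHomLift t s) : W ⟶ X :=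
  Functor.IsStronglyCartesian.map p u φ e.symm s

variable (hφ : p.IsStronglyCartesian u φ) {K : B} (w : K ⟶ I) {t : K ⟶ J} (e : w ≫ u = t)
    {W : E} (s : W ⟶ Y) (hs : p.IsHomLift t s)

theorem cartLift_isHomLift : p.IsHomLift w (cartLift hφ w e s hs) :=
  Functor.IsStronglyCartesian.map_isHomLift p u φ e.symm s

theorem cartLift_fac : cartLift hφ w e s hs ≫ φ = s :=
  Functor.IsStronglyCartesian.fac p u φ e.symm s

theorem cartLift_fac_assoc {Z : E} (r : Y ⟶ Z) : cartLift hφ w e s hs ≫ φ ≫ r = s ≫ r := by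
  rw [← Category.assoc, cartLift_fac]

include hφ in
theorem cart_ext {s s' : W ⟶ X} (hs : p.IsHomLift w s) (hs' : p.IsHomLift w s')
    (h : s ≫ φ = s' ≫ φ) : s = s' :=
  Functor.IsStronglyCartesian.ext p u φ w h

/-- Two Cartesian arrows over the same arrow and with the same codomain differ by a vertical
isomorphism. -/
theorem exists_cart_iso {X' : E} {φ' : X' ⟶ Y} (hφ : p.IsStronglyCartesian u φ)
    (hφ' : p.IsStronglyCartesian u φ') :
    ∃ θ : X' ≅ X, p.IsHomLift (𝟙 I) θ.hom ∧ θ.hom ≫ φ = φ' :=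
  ⟨Functor.IsCartesian.domainUniqueUpToIso p u φ φ', inferInstance, by simp⟩

theorem isStronglyCartesian_congr {v : I ⟶ J} (e : u = v) (h : p.IsStronglyCartesian u φ) :
    p.IsStronglyCartesian v φ := e ▸ h

theorem isStronglyCartesian_iso_comp {X' : E} (θ : X' ≅ X) (hθ : p.IsHomLift (𝟙 I) θ.hom)
    (h : p.IsStronglyCartesian u φ) : p.IsStronglyCartesian u (θ.hom ≫ φ) :=
  isStronglyCartesian_congr (Category.id_comp u) inferInstance

theorem isStronglyCartesian_comp_iso {Y' : E} (θ : Y ≅ Y') (hθ : p.IsHomLift (𝟙 J) θ.hom)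
    (h : p.IsStronglyCartesian u φ) : p.IsStronglyCartesian u (φ ≫ θ.hom) :=
  isStronglyCartesian_congr (Category.comp_id u) inferInstance

end Lifting

/-! ### Product spans -/

section Spans

variable {B : Type u₁} [Category.{v₁} B] [CartesianMonoidalCategory B]
  {E : Type u₂} [Category.{v₂} E]

/-- A span `P ⟵k— V —ε⟶ b`, with `k` Cartesian over the projection `I × X ⟶ I` and `ε` vertical,
that exhibits `P` as a simple product of `b` along `X`. Here `V` plays the role of `π^* P` and `ε`
that of the counit. The universal property is required with respect to arrows into `P` over an
arbitrary `f : K ⟶ I`, so that it incorporates the Beck-Chevalley condition; all data live in the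
total category, so that no reindexed objects need to be compared. -/
structure IsProdSpan (p : E ⥤ B) (I X : B) {V P b : E} (k : V ⟶ P) (ε : V ⟶ b) : Prop where
  cart : p.IsStronglyCartesian (fst I X) k
  vert : p.IsHomLift (𝟙 (I ⊗ X)) ε
  exists_transpose {K : B} (f : K ⟶ I) {Γ Γ' : E} (k' : Γ' ⟶ Γ)
    (hk' : p.IsStronglyCartesian (fst K X) k') (m : Γ' ⟶ b) (hm : p.IsHomLift (f ▷ X) m) :
    ∃ (n : Γ ⟶ P) (n' : Γ' ⟶ V), p.IsHomLift f n ∧ p.IsHomLift (f ▷ X) n' ∧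
      n' ≫ k = k' ≫ n ∧ n' ≫ ε = m
  transpose_unique {K : B} (f : K ⟶ I) {Γ Γ' : E} (k' : Γ' ⟶ Γ)
    (hk' : p.IsStronglyCartesian (fst K X) k') (n₁ n₂ : Γ ⟶ P) (n₁' n₂' : Γ' ⟶ V)
    (h₁ : p.IsHomLift f n₁) (h₂ : p.IsHomLift f n₂)
    (h₁' : p.IsHomLift (f ▷ X) n₁') (h₂' : p.IsHomLift (f ▷ X) n₂')
    (e₁ : n₁' ≫ k = k' ≫ n₁) (e₂ : n₂' ≫ k = k' ≫ n₂) (e : n₁' ≫ ε = n₂' ≫ ε) : n₁ = n₂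

namespace IsProdSpan

variable {p : E ⥤ B} {I X : B} {V P b : E} {k : V ⟶ P} {ε : V ⟶ b}

/-- It suffices to test the universal property of a product span on one Cartesian arrow `Γ' ⟶ Γ`
over the projection for each `Γ`. -/
theorem of_chosen (hk : p.IsStronglyCartesian (fst I X) k) (hε : p.IsHomLift (𝟙 (I ⊗ X)) ε)
    (H : ∀ {K : B} (f : K ⟶ I) (Γ : E), p.obj Γ = K → ∃ (Γ' : E) (k' : Γ' ⟶ Γ),
      p.IsStronglyCartesian (fst K X) k' ∧
      (∀ m : Γ' ⟶ b, p.IsHomLift (f ▷ X) m →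
        ∃ (n : Γ ⟶ P) (n' : Γ' ⟶ V), p.IsHomLift f n ∧ p.IsHomLift (f ▷ X) n' ∧
          n' ≫ k = k' ≫ n ∧ n' ≫ ε = m) ∧
      (∀ (n₁ n₂ : Γ ⟶ P) (n₁' n₂' : Γ' ⟶ V), p.IsHomLift f n₁ → p.IsHomLift f n₂ →
        p.IsHomLift (f ▷ X) n₁' → p.IsHomLift (f ▷ X) n₂' →
        n₁' ≫ k = k' ≫ n₁ → n₂' ≫ k = k' ≫ n₂ → n₁' ≫ ε = n₂' ≫ ε → n₁ = n₂)) :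
    IsProdSpan p I X k ε where
  cart := hk
  vert := hε
  exists_transpose {K} f {Γ Γ'} k' hk' m hm := by
    obtain ⟨Γ'', k'', hk'', H₁, -⟩ := H f Γ (IsHomLift.codomain_eq p (fst K X) k')
    obtain ⟨θ, hθ, e⟩ := exists_cart_iso hk' hk''
    obtain ⟨n, n', hn, hn', e₁, e₂⟩ := H₁ (θ.hom ≫ m) (isHomLift_id_comp hθ hm)
    refine ⟨n, θ.inv ≫ n', hn, isHomLift_id_comp (isHomLift_iso_inv θ hθ) hn', ?_, ?_⟩
    · rw [Category.assoc, e₁, ← e, Category.assoc, Iso.inv_hom_id_assoc]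
    · rw [Category.assoc, e₂, Iso.inv_hom_id_assoc]
  transpose_unique {K} f {Γ Γ'} k' hk' n₁ n₂ n₁' n₂' h₁ h₂ h₁' h₂' e₁ e₂ e := by
    obtain ⟨Γ'', k'', hk'', -, H₂⟩ := H f Γ (IsHomLift.codomain_eq p (fst K X) k')
    obtain ⟨θ, hθ, e'⟩ := exists_cart_iso hk' hk''
    refine H₂ n₁ n₂ (θ.hom ≫ n₁') (θ.hom ≫ n₂') h₁ h₂ (isHomLift_id_comp hθ h₁')
      (isHomLift_id_comp hθ h₂') ?_ ?_ ?_
    · rw [Category.assoc, e₁, ← e', Category.assoc]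
    · rw [Category.assoc, e₂, ← e', Category.assoc]
    · rw [Category.assoc, e, Category.assoc]

section Ev

variable (h : IsProdSpan p I X k ε)

/-- Instantiation: an arrow `s` into the simple product `P` of `b`, lying over `a : K ⟶ I`, yields
for each `x : K ⟶ X` an arrow into `b` over `⟨a, x⟩`. -/
def ev {K : B} (a : K ⟶ I) (x : K ⟶ X) {W : E} (s : W ⟶ P) (hs : p.IsHomLift a s) : W ⟶ b :=
  cartLift h.cart (lift a x) (lift_fst a x) s hs ≫ ε

theorem ev_isHomLift {K : B} (a : K ⟶ I) (x : K ⟶ X) {W : E} (s : W ⟶ P)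
    (hs : p.IsHomLift a s) : p.IsHomLift (lift a x) (h.ev a x s hs) :=
  isHomLift_comp_id (cartLift_isHomLift ..) h.vert

theorem ev_eq {K : B} (a : K ⟶ I) (x : K ⟶ X) {W : E} (s : W ⟶ P)
    (hs : p.IsHomLift a s) (v : W ⟶ V) (hv : p.IsHomLift (lift a x) v) (e : v ≫ k = s) :
    h.ev a x s hs = v ≫ ε := by
  rw [ev]
  congr 1
  refine cart_ext h.cart (lift a x) (cartLift_isHomLift ..) hv ?_
  rw [cartLift_fac, e]

theorem comp_ev {K L : B} {w : L ⟶ K} {a : K ⟶ I} {x : K ⟶ X} {a' : L ⟶ I} {x' : L ⟶ X}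
    (ea : w ≫ a = a') (ex : w ≫ x = x')
    {W U : E} (r : U ⟶ W) (hr : p.IsHomLift w r) (s : W ⟶ P) (hs : p.IsHomLift a s)
    (hrs : p.IsHomLift a' (r ≫ s)) :
    h.ev a' x' (r ≫ s) hrs = r ≫ h.ev a x s hs := by
  rw [h.ev_eq a' x' (r ≫ s) hrs (r ≫ cartLift h.cart (lift a x) (lift_fst a x) s hs)
    (isHomLift_comp hr (cartLift_isHomLift ..) (by rw [comp_lift, ea, ex])),
    Category.assoc, ev]
  rw [Category.assoc, cartLift_fac]

theorem ev_congr {K : B} {a a' : K ⟶ I} {x x' : K ⟶ X} {W : E} {s s' : W ⟶ P}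
    (hs : p.IsHomLift a s) (hs' : p.IsHomLift a' s') (ea : a = a') (ex : x = x') (es : s = s') :
    h.ev a x s hs = h.ev a' x' s' hs' := by
  subst ea ex es; rfl

/-- Arrows into a simple product are determined by their generic instance. -/
theorem hom_ext {K : B} {f : K ⟶ I} {Γ Γ' : E} {k' : Γ' ⟶ Γ}
    (hk' : p.IsStronglyCartesian (fst K X) k') {n₁ n₂ : Γ ⟶ P} (h₁ : p.IsHomLift f n₁)
    (h₂ : p.IsHomLift f n₂)
    (e : h.ev (fst K X ≫ f) (snd K X) (k' ≫ n₁) (isHomLift_comp hk'.toIsHomLift h₁ rfl) =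
      h.ev (fst K X ≫ f) (snd K X) (k' ≫ n₂) (isHomLift_comp hk'.toIsHomLift h₂ rfl)) :
    n₁ = n₂ := by
  have hf : lift (fst K X ≫ f) (snd K X) = f ▷ X := by ext <;> simp
  refine h.transpose_unique f k' hk' n₁ n₂ _ _ h₁ h₂
    (isHomLift_congr hf (cartLift_isHomLift ..)) (isHomLift_congr hf (cartLift_isHomLift ..))
    ?_ ?_ e
  · exact cartLift_fac ..
  · exact cartLift_fac ..

/-- Every arrow `m` into `b` over `f × X` is the generic instance of some arrow `n` into `P`. The
instances of `n` at arbitrary terms are then determined by `m`. -/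
theorem exists_of_generic {K : B} (f : K ⟶ I) {Γ Γ' : E} {k' : Γ' ⟶ Γ}
    (hk' : p.IsStronglyCartesian (fst K X) k') (m : Γ' ⟶ b) (hm : p.IsHomLift (f ▷ X) m) :
    ∃ (n : Γ ⟶ P) (_ : p.IsHomLift f n),
      ∀ {L : B} (a : L ⟶ K) {a' : L ⟶ I} (_ : a ≫ f = a') (x : L ⟶ X) {W : E} (s : W ⟶ Γ)
        (hs : p.IsHomLift a s) (hsn : p.IsHomLift a' (s ≫ n)),
        h.ev a' x (s ≫ n) hsn = cartLift hk' (lift a x) (lift_fst a x) s hs ≫ m := by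
  obtain ⟨n, n', hn, hn', e₁, e₂⟩ := h.exists_transpose f k' hk' m hm
  refine ⟨n, hn, ?_⟩
  intro L a a' ea x W s hs hsn
  rw [h.ev_eq a' x _ _ (cartLift hk' (lift a x) (lift_fst a x) s hs ≫ n')
    (isHomLift_comp (cartLift_isHomLift ..) hn' (by ext <;> simp [ea])) ?_, Category.assoc, e₂]
  rw [Category.assoc, e₁, cartLift_fac_assoc]

end Ev

/-- Simple products of the same object are isomorphic, compatibly with instantiation. -/
theorem exists_iso {V' P' : E} {k' : V' ⟶ P'} {ε' : V' ⟶ b} (h : IsProdSpan p I X k ε)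
    (h' : IsProdSpan p I X k' ε') :
    ∃ (ψ : P ≅ P') (_ : p.IsHomLift (𝟙 I) ψ.hom),
      ∀ {K : B} (a : K ⟶ I) (x : K ⟶ X) {W : E} (s : W ⟶ P) (hs : p.IsHomLift a s)
        (hs' : p.IsHomLift a (s ≫ ψ.hom)),
        h'.ev a x (s ≫ ψ.hom) hs' = h.ev a x s hs := by
  have key : ∀ {V P V' P' : E} {k : V ⟶ P} {ε : V ⟶ b} {k' : V' ⟶ P'} {ε' : V' ⟶ b}
      (h : IsProdSpan p I X k ε) (h' : IsProdSpan p I X k' ε'),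
      ∃ (n : P ⟶ P') (_ : p.IsHomLift (𝟙 I) n),
      ∀ {K : B} (a : K ⟶ I) (x : K ⟶ X) {W : E} (s : W ⟶ P) (hs : p.IsHomLift a s)
        (hs' : p.IsHomLift a (s ≫ n)), h'.ev a x (s ≫ n) hs' = h.ev a x s hs := by
    intro V P V' P' k ε k' ε' h h'
    obtain ⟨n, hn, H⟩ := h'.exists_of_generic (𝟙 I) h.cart ε
      (isHomLift_congr (id_whiskerRight I X).symm h.vert)
    exact ⟨n, hn, fun a x W s hs hs' => by rw [H a (Category.comp_id a) x s hs hs']; rfl⟩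
  have key' : ∀ {V P : E} {k : V ⟶ P} {ε : V ⟶ b} (h : IsProdSpan p I X k ε) (n : P ⟶ P)
      (_ : p.IsHomLift (𝟙 I) n),
      (∀ {K : B} (a : K ⟶ I) (x : K ⟶ X) {W : E} (s : W ⟶ P) (hs : p.IsHomLift a s)
        (hs' : p.IsHomLift a (s ≫ n)), h.ev a x (s ≫ n) hs' = h.ev a x s hs) → n = 𝟙 P := by
    intro V P k ε h n hn H
    refine h.hom_ext h.cart hn
      (isHomLift_id (have := h.cart; IsHomLift.codomain_eq p (fst I X) k)) ?_
    rw [h.ev_congr _ _ (Category.comp_id _) rfl rfl, H _ _ k h.cart.toIsHomLift]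
    · exact h.ev_congr _ _ (Category.comp_id _).symm rfl (Category.comp_id k).symm
    · exact isHomLift_comp_id h.cart.toIsHomLift hn
  obtain ⟨n, hn, H⟩ := key h h'
  obtain ⟨n', hn', H'⟩ := key h' h
  refine ⟨⟨n, n', ?_, ?_⟩, hn, H⟩
  · refine key' h (n ≫ n') inferInstance ?_
    intro K a x W s hs hs'
    have := isHomLift_comp_id hs hn
    rw [h.ev_congr hs' (isHomLift_comp_id this hn') rfl rfl (Category.assoc s n n').symm,
      H' _ _ _ this, H _ _ _ hs]
  · refine key' h' (n' ≫ n) inferInstance ?_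
    intro K a x W s hs hs'
    have := isHomLift_comp_id hs hn'
    rw [h'.ev_congr hs' (isHomLift_comp_id this hn) rfl rfl (Category.assoc s n' n).symm,
      H _ _ _ this, H' _ _ _ hs]

/-- Product spans are stable under vertical isomorphism. -/
theorem of_iso (h : IsProdSpan p I X k ε) {V₁ P₁ b₁ : E} {k₁ : V₁ ⟶ P₁} {ε₁ : V₁ ⟶ b₁}
    (eV : V ≅ V₁) (eP : P ≅ P₁) (eb : b ≅ b₁) (hV : p.IsHomLift (𝟙 (I ⊗ X)) eV.hom)
    (hP : p.IsHomLift (𝟙 I) eP.hom) (hb : p.IsHomLift (𝟙 (I ⊗ X)) eb.hom)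
    (ek : eV.hom ≫ k₁ = k ≫ eP.hom) (eε : eV.hom ≫ ε₁ = ε ≫ eb.hom) :
    IsProdSpan p I X k₁ ε₁ := by
  have ek' : k₁ = eV.symm.hom ≫ k ≫ eP.hom := by rw [← ek]; simp
  have eε' : ε₁ = eV.inv ≫ ε ≫ eb.hom := by rw [← eε]; simp
  have hV' := isHomLift_iso_inv eV hV
  have hP' := isHomLift_iso_inv eP hP
  have hb' := isHomLift_iso_inv eb hb
  refine ⟨?_, ?_, ?_, ?_⟩
  · rw [ek']
    exact isStronglyCartesian_iso_comp _ hV' (isStronglyCartesian_comp_iso _ hP h.cart)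
  · have := h.vert
    rw [eε']; infer_instance
  · intro K f Γ Γ' k' hk' m hm
    obtain ⟨n, n', hn, hn', e₁, e₂⟩ := h.exists_transpose f k' hk' (m ≫ eb.inv)
      (isHomLift_comp_id hm hb')
    refine ⟨n ≫ eP.hom, n' ≫ eV.hom, isHomLift_comp_id hn hP, isHomLift_comp_id hn' hV, ?_, ?_⟩
    · rw [Category.assoc, ek, ← Category.assoc, e₁, Category.assoc]
    · rw [Category.assoc, eε, ← Category.assoc, e₂, Category.assoc, Iso.inv_hom_id,
        Category.comp_id]
  · intro K f Γ Γ' k' hk' n₁ n₂ n₁' n₂' h₁ h₂ h₁' h₂' e₁ e₂ e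
    rw [← cancel_mono eP.inv]
    refine h.transpose_unique f k' hk' _ _ (n₁' ≫ eV.inv) (n₂' ≫ eV.inv)
      (isHomLift_comp_id h₁ hP') (isHomLift_comp_id h₂ hP')
      (isHomLift_comp_id h₁' hV') (isHomLift_comp_id h₂' hV') ?_ ?_ ?_
    · rw [← Category.assoc k', ← e₁, ek']; simp
    · rw [← Category.assoc k', ← e₂, ek']; simp
    · rw [← cancel_mono eb.hom]
      simpa [eε'] using e

/-- Product spans are stable under base change `u : A ⟶ I`. -/
theorem base_change (h : IsProdSpan p I X k ε) {A : B} {u : A ⟶ I} {V' P' b' : E}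
    {k' : V' ⟶ P'} {ε' : V' ⟶ b'} {cV : V' ⟶ V} {cP : P' ⟶ P} {cb : b' ⟶ b}
    (hV : p.IsStronglyCartesian (u ▷ X) cV) (hP : p.IsStronglyCartesian u cP)
    (hb : p.IsStronglyCartesian (u ▷ X) cb) (hk' : p.IsHomLift (fst A X) k')
    (hε' : p.IsHomLift (𝟙 (A ⊗ X)) ε') (ek : k' ≫ cP = cV ≫ k) (eε : ε' ≫ cb = cV ≫ ε) :
    IsProdSpan p A X k' ε' := by
  have hkc := h.cart
  refine ⟨?_, hε', ?_, ?_⟩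
  · have : p.IsStronglyCartesian (fst A X ≫ u) (k' ≫ cP) := by
      rw [ek]; exact isStronglyCartesian_congr (whiskerRight_fst u X) inferInstance
    exact Functor.IsStronglyCartesian.of_comp p (g := u) (ψ := cP)
  · intro K f Γ Γ' k'' hk'' m hm
    obtain ⟨n, n', hn, hn', e₁, e₂⟩ := h.exists_transpose (f ≫ u) k'' hk'' (m ≫ cb)
      (isHomLift_comp hm hb.toIsHomLift (comp_whiskerRight f u X).symm)
    refine ⟨cartLift hP f rfl n hn,
      cartLift hV (f ▷ X) (comp_whiskerRight f u X).symm n' hn',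
      cartLift_isHomLift .., cartLift_isHomLift .., ?_, ?_⟩
    · refine cart_ext hP (f ▷ X ≫ fst A X) (isHomLift_comp (cartLift_isHomLift ..) hk' rfl)
        (isHomLift_comp hk''.toIsHomLift (cartLift_isHomLift ..) (by simp)) ?_
      rw [Category.assoc, ek, cartLift_fac_assoc, e₁, Category.assoc, cartLift_fac]
    · refine cart_ext hb (f ▷ X) (isHomLift_comp_id (cartLift_isHomLift ..) hε') hm ?_
      rw [Category.assoc, eε, cartLift_fac_assoc, e₂]
  · intro K f Γ Γ' k'' hk'' n₁ n₂ n₁' n₂' h₁ h₂ h₁' h₂' e₁ e₂ e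
    refine cart_ext hP f h₁ h₂ ?_
    have hV' := hV.toIsHomLift
    refine h.transpose_unique (f ≫ u) k'' hk'' _ _ (n₁' ≫ cV) (n₂' ≫ cV)
      (isHomLift_comp h₁ hP.toIsHomLift rfl) (isHomLift_comp h₂ hP.toIsHomLift rfl)
      (isHomLift_comp h₁' hV' (comp_whiskerRight f u X).symm)
      (isHomLift_comp h₂' hV' (comp_whiskerRight f u X).symm) ?_ ?_ ?_
    · rw [Category.assoc, ← ek, ← Category.assoc, e₁, Category.assoc]
    · rw [Category.assoc, ← ek, ← Category.assoc, e₂, Category.assoc]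
    · rw [Category.assoc, ← eε, ← Category.assoc, e, Category.assoc, eε, Category.assoc]

theorem base_change_ev (h : IsProdSpan p I X k ε) {A : B} {u : A ⟶ I} {V' P' b' : E}
    {k' : V' ⟶ P'} {ε' : V' ⟶ b'} {cV : V' ⟶ V} {cP : P' ⟶ P} {cb : b' ⟶ b}
    (h' : IsProdSpan p A X k' ε') (hV : p.IsHomLift (u ▷ X) cV)
    (ek : k' ≫ cP = cV ≫ k) (eε : ε' ≫ cb = cV ≫ ε)
    {K : B} (a : K ⟶ A) {a' : K ⟶ I} (ea : a ≫ u = a') (x : K ⟶ X) {W : E} (s : W ⟶ P')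
    (hs : p.IsHomLift a s) (hs' : p.IsHomLift a' (s ≫ cP)) :
    h'.ev a x s hs ≫ cb = h.ev a' x (s ≫ cP) hs' := by
  rw [h.ev_eq a' x (s ≫ cP) hs' (cartLift h'.cart (lift a x) (lift_fst a x) s hs ≫ cV)
    (isHomLift_comp (cartLift_isHomLift ..) hV (by ext <;> simp [ea])), ev, Category.assoc, eε,
    Category.assoc]
  rw [Category.assoc, ← ek, cartLift_fac_assoc]

end IsProdSpan

end Spans

/-! ### Quantifier-free objects in terms of product spans -/

section QuantifierFree

variable {B : Type u₁} [Category.{v₁} B] [CartesianMonoidalCategory B]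
  {E : Type u₂} [Category.{v₂} E] {p : E ⥤ B}

section Factorisation

variable {I X : B} {V P b a : E} {k : V ⟶ P} {ε : V ⟶ b}

/-- For a simple product `P` of `b`, an arrow `r : P' ⟶ P` over `u : A ⟶ I` and `h : P' ⟶ a` over
`f : A ⟶ J`: the arrow `h` is the instance of `r` at the term `g : A ⟶ X`, taken in the reindexed
object `b' = ⟨u, g⟩^* b`, followed by `h' : b' ⟶ a`. -/
structure IsProdSpan.FactorsAt (hs : IsProdSpan p I X k ε) {A : B} (u : A ⟶ I) {P' : E}
    (r : P' ⟶ P) (hr : p.IsHomLift u r) {J : B} (f : A ⟶ J) (h : P' ⟶ a) (g : A ⟶ X) {b' : E}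
    (c : b' ⟶ b) (h' : b' ⟶ a) : Prop where
  cart : p.IsStronglyCartesian (lift u g) c
  isHomLift : p.IsHomLift f h'
  fac : ∃ σ : P' ⟶ b', p.IsHomLift (𝟙 A) σ ∧ σ ≫ c = hs.ev u g r hr ∧ σ ≫ h' = h

/-- Every presentation of `h` as in `IsProdSpan.FactorsAt` uses the same term and, for a fixed
choice of reindexed object, the same arrow; and there is one for every choice of reindexed
object. -/
structure IsProdSpan.HasUniqueFactor (hs : IsProdSpan p I X k ε) {A : B} (u : A ⟶ I) {P' : E}
    (r : P' ⟶ P) (hr : p.IsHomLift u r) {J : B} (f : A ⟶ J) (h : P' ⟶ a) : Prop where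
  exists_factor : ∃ g : A ⟶ X, ∀ (b' : E) (c : b' ⟶ b), p.IsStronglyCartesian (lift u g) c →
    ∃ h' : b' ⟶ a, hs.FactorsAt u r hr f h g c h'
  unique_term (g₁ g₂ : A ⟶ X) (b₁ b₂ : E) (c₁ : b₁ ⟶ b) (c₂ : b₂ ⟶ b) (h₁ : b₁ ⟶ a)
    (h₂ : b₂ ⟶ a) (H₁ : hs.FactorsAt u r hr f h g₁ c₁ h₁)
    (H₂ : hs.FactorsAt u r hr f h g₂ c₂ h₂) : g₁ = g₂
  unique_arrow (g : A ⟶ X) (b' : E) (c : b' ⟶ b) (h₁ h₂ : b' ⟶ a)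
    (H₁ : hs.FactorsAt u r hr f h g c h₁) (H₂ : hs.FactorsAt u r hr f h g c h₂) : h₁ = h₂

namespace IsProdSpan

theorem FactorsAt.of_iso {hs : IsProdSpan p I X k ε} {A : B} {u : A ⟶ I} {P' : E}
    {r : P' ⟶ P} {hr : p.IsHomLift u r} {J : B} {f : A ⟶ J} {h : P' ⟶ a} {g : A ⟶ X} {b' b'' : E}
    {c : b' ⟶ b} {h' : b' ⟶ a} (H : hs.FactorsAt u r hr f h g c h') (θ : b'' ≅ b')
    (hθ : p.IsHomLift (𝟙 A) θ.hom) : hs.FactorsAt u r hr f h g (θ.hom ≫ c) (θ.hom ≫ h') := by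
  obtain ⟨hc, hh', σ, hσ, e₁, e₂⟩ := H
  exact ⟨isStronglyCartesian_iso_comp θ hθ hc, isHomLift_id_comp hθ hh', σ ≫ θ.inv,
    isHomLift_comp_id hσ (isHomLift_iso_inv θ hθ), by simpa using e₁, by simpa using e₂⟩

/-- Unique factorisation may be tested on one chosen reindexed object for each term. -/
theorem HasUniqueFactor.of_chosen (hs : IsProdSpan p I X k ε) {A : B} {u : A ⟶ I} {P' : E}
    {r : P' ⟶ P} (hr : p.IsHomLift u r) {J : B} {f : A ⟶ J} {h : P' ⟶ a}
    (d : (A ⟶ X) → E) (c : ∀ g, d g ⟶ b) (hc : ∀ g, p.IsStronglyCartesian (lift u g) (c g))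
    (H : ∃ (g : A ⟶ X) (h' : d g ⟶ a), hs.FactorsAt u r hr f h g (c g) h')
    (H₁ : ∀ (g₁ g₂ : A ⟶ X) (h₁ : d g₁ ⟶ a) (h₂ : d g₂ ⟶ a),
      hs.FactorsAt u r hr f h g₁ (c g₁) h₁ → hs.FactorsAt u r hr f h g₂ (c g₂) h₂ → g₁ = g₂)
    (H₂ : ∀ (g : A ⟶ X) (h₁ h₂ : d g ⟶ a),
      hs.FactorsAt u r hr f h g (c g) h₁ → hs.FactorsAt u r hr f h g (c g) h₂ → h₁ = h₂) :
    hs.HasUniqueFactor u r hr f h where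
  exists_factor := by
    obtain ⟨g, h', Hg⟩ := H
    refine ⟨g, fun b' c' hc' => ?_⟩
    obtain ⟨θ, hθ, e⟩ := exists_cart_iso (hc g) hc'
    exact ⟨θ.hom ≫ h', e ▸ Hg.of_iso θ hθ⟩
  unique_term g₁ g₂ b₁ b₂ c₁ c₂ h₁ h₂ F₁ F₂ := by
    obtain ⟨θ₁, hθ₁, e₁⟩ := exists_cart_iso F₁.cart (hc g₁)
    obtain ⟨θ₂, hθ₂, e₂⟩ := exists_cart_iso F₂.cart (hc g₂)
    exact H₁ g₁ g₂ _ _ (e₁ ▸ F₁.of_iso θ₁ hθ₁) (e₂ ▸ F₂.of_iso θ₂ hθ₂)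
  unique_arrow g b' c' h₁ h₂ F₁ F₂ := by
    obtain ⟨θ, hθ, e⟩ := exists_cart_iso F₁.cart (hc g)
    exact (cancel_epi θ.hom).1 (H₂ g _ _ (e ▸ F₁.of_iso θ hθ) (e ▸ F₂.of_iso θ hθ))

theorem id_isHomLift (hs : IsProdSpan p I X k ε) : p.IsHomLift (𝟙 I) (𝟙 P) :=
  isHomLift_id (have := hs.cart; IsHomLift.codomain_eq p (fst I X) k)

/-- Unique factorisation of the arrows out of `P` does not depend on the choice of the simple
product `P` of `b`. -/
theorem HasUniqueFactor.of_span (hs : IsProdSpan p I X k ε) {V' P' : E} {k' : V' ⟶ P'}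
    {ε' : V' ⟶ b} (hs' : IsProdSpan p I X k' ε') {J : B} {f : I ⟶ J} (h : P' ⟶ a)
    (hh : p.IsHomLift f h)
    (H : ∀ h : P ⟶ a, p.IsHomLift f h → hs.HasUniqueFactor (𝟙 I) (𝟙 P) hs.id_isHomLift f h) :
    hs'.HasUniqueFactor (𝟙 I) (𝟙 P') hs'.id_isHomLift f h := by
  obtain ⟨ψ, hψ, e⟩ := exists_iso hs hs'
  have ev_eq : ∀ g, ψ.hom ≫ hs'.ev (𝟙 I) g (𝟙 P') hs'.id_isHomLift =
      hs.ev (𝟙 I) g (𝟙 P) hs.id_isHomLift := by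
    intro g
    rw [← hs'.comp_ev (Category.id_comp _) (Category.id_comp g) ψ.hom hψ (𝟙 P') _
      (by rwa [Category.comp_id])]
    rw [← e (𝟙 I) g (𝟙 P) hs.id_isHomLift (by rwa [Category.id_comp])]
    exact hs'.ev_congr _ _ rfl rfl (by simp)
  have key : ∀ (g : I ⟶ X) (b' : E) (c : b' ⟶ b) (h' : b' ⟶ a),
      hs'.FactorsAt (𝟙 I) (𝟙 P') hs'.id_isHomLift f h g c h' ↔
        hs.FactorsAt (𝟙 I) (𝟙 P) hs.id_isHomLift f (ψ.hom ≫ h) g c h' := by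
    intro g b' c h'
    constructor
    · rintro ⟨hc, hh', σ, hσ, e₁, e₂⟩
      exact ⟨hc, hh', ψ.hom ≫ σ, inferInstance, by rw [Category.assoc, e₁, ev_eq],
        by rw [Category.assoc, e₂]⟩
    · rintro ⟨hc, hh', σ, hσ, e₁, e₂⟩
      exact ⟨hc, hh', ψ.inv ≫ σ, inferInstance,
        by rw [Category.assoc, e₁, ← ev_eq, Iso.inv_hom_id_assoc],
        by rw [Category.assoc, e₂, Iso.inv_hom_id_assoc]⟩
  obtain ⟨⟨g, H₀⟩, H₁, H₂⟩ := H (ψ.hom ≫ h) (isHomLift_id_comp hψ hh)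
  refine ⟨⟨g, fun b' c hc => ?_⟩, ?_, ?_⟩
  · obtain ⟨h', F⟩ := H₀ b' c hc
    exact ⟨h', (key ..).2 F⟩
  · intro g₁ g₂ b₁ b₂ c₁ c₂ h₁ h₂ F₁ F₂
    exact H₁ g₁ g₂ b₁ b₂ c₁ c₂ h₁ h₂ ((key ..).1 F₁) ((key ..).1 F₂)
  · intro g b' c h₁ h₂ F₁ F₂
    exact H₂ g b' c h₁ h₂ ((key ..).1 F₁) ((key ..).1 F₂)

end IsProdSpan

end Factorisation

/-- Quantifier-freeness, expressed in the total category: every arrow into `a` out of a simple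
product factors uniquely through an instantiation. -/
def IsQF (p : E ⥤ B) (a : E) : Prop :=
  ∀ ⦃A X : B⦄ ⦃V P b : E⦄ (k : V ⟶ P) (ε : V ⟶ b) (hs : IsProdSpan p A X k ε) ⦃J : B⦄ (f : A ⟶ J)
    (h : P ⟶ a), p.IsHomLift f h → hs.HasUniqueFactor (𝟙 A) (𝟙 P) hs.id_isHomLift f h

/-- The analogue of `SimpleProducts.HasEnoughQuantifierFree` in terms of product spans. -/
def HasEnoughQF (p : E ⥤ B) : Prop :=
  ∀ P : E, ∃ (X : B) (V b : E) (k : V ⟶ P) (ε : V ⟶ b),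
    IsProdSpan p (p.obj P) X k ε ∧ IsQF p b

/-- For quantifier-free `a`, arrows into `a` out of a reindexed simple product factor uniquely
through an instantiation as well: reindexed simple products are simple products. -/
theorem IsQF.hasUniqueFactor (cl : SplitCleavage p) {a : E} (ha : IsQF p a) {I X : B} {V P b : E}
    {k : V ⟶ P} {ε : V ⟶ b} (hs : IsProdSpan p I X k ε) {A : B} {u : A ⟶ I} {P' : E} {r : P' ⟶ P}
    (hr : p.IsStronglyCartesian u r) {J : B} {f : A ⟶ J} {h : P' ⟶ a} (hh : p.IsHomLift f h) :
    hs.HasUniqueFactor u r hr.toIsHomLift f h := by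
  have hε := hs.vert
  have hk := hs.cart
  let Vf : p.Fiber (I ⊗ X) := ⟨V, IsHomLift.domain_eq p (𝟙 (I ⊗ X)) ε⟩
  let bf : p.Fiber (I ⊗ X) := ⟨b, IsHomLift.codomain_eq p (𝟙 (I ⊗ X)) ε⟩
  have hV : p.IsStronglyCartesian (u ▷ X) (cl.cart (u ▷ X) Vf) :=
    cl.cart_isStronglyCartesian (u ▷ X) Vf
  have hb : p.IsStronglyCartesian (u ▷ X) (cl.cart (u ▷ X) bf) :=
    cl.cart_isStronglyCartesian (u ▷ X) bf
  have hk'' : p.IsHomLift (fst A X ≫ u) (cl.cart (u ▷ X) Vf ≫ k) :=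
    isHomLift_comp hV.toIsHomLift hk.toIsHomLift (whiskerRight_fst u X)
  have hε'' : p.IsHomLift (u ▷ X) (cl.cart (u ▷ X) Vf ≫ ε) :=
    isHomLift_comp_id hV.toIsHomLift hε
  have hk' := cartLift_isHomLift hr (fst A X) rfl _ hk''
  have ek := cartLift_fac hr (fst A X) rfl _ hk''
  have hε' := cartLift_isHomLift hb (𝟙 _) (Category.id_comp _) _ hε''
  have eε := cartLift_fac hb (𝟙 _) (Category.id_comp _) _ hε''
  have hs' := hs.base_change hV hr hb hk' hε' ek eε
  have ev_eq : ∀ g, hs'.ev (𝟙 A) g (𝟙 P') hs'.id_isHomLift ≫ cl.cart (u ▷ X) bf =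
      hs.ev u g r hr.toIsHomLift := by
    intro g
    rw [hs.base_change_ev hs' hV.toIsHomLift ek eε (𝟙 A) (Category.id_comp u) g _ _
      (by rw [Category.id_comp]; exact hr.toIsHomLift)]
    exact hs.ev_congr _ _ rfl rfl (Category.id_comp r)
  have hcomp : ∀ g : A ⟶ X, lift (𝟙 A) g ≫ u ▷ X = lift u g := by intro g; ext <;> simp
  -- A Cartesian arrow over `⟨u, g⟩` factors through the chosen one over `u × X`.
  have hfac : ∀ (g : A ⟶ X) (b' : E) (c : b' ⟶ b), p.IsStronglyCartesian (lift u g) c →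
      ∃ c' : b' ⟶ (cl.pull (u ▷ X) bf).1, p.IsStronglyCartesian (lift (𝟙 A) g) c' ∧
        c' ≫ cl.cart (u ▷ X) bf = c := by
    intro g b' c hc
    have hl := cartLift_isHomLift hb _ (hcomp g) c hc.toIsHomLift
    have e := cartLift_fac hb _ (hcomp g) c hc.toIsHomLift
    refine ⟨_, ?_, e⟩
    have : p.IsStronglyCartesian (lift (𝟙 A) g ≫ u ▷ X)
        (cartLift hb _ (hcomp g) c hc.toIsHomLift ≫ cl.cart (u ▷ X) bf) := by
      rw [hcomp, e]; exact hc
    exact Functor.IsStronglyCartesian.of_comp p (g := u ▷ X) (ψ := cl.cart (u ▷ X) bf)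
  have key : ∀ (g : A ⟶ X) (b' : E) (c' : b' ⟶ (cl.pull (u ▷ X) bf).1) (h' : b' ⟶ a),
      p.IsStronglyCartesian (lift (𝟙 A) g) c' →
      (hs'.FactorsAt (𝟙 A) (𝟙 P') hs'.id_isHomLift f h g c' h' ↔
        hs.FactorsAt u r hr.toIsHomLift f h g (c' ≫ cl.cart (u ▷ X) bf) h') := by
    intro g b' c' h' hc'
    constructor
    · rintro ⟨-, hh', σ, hσ, e₁, e₂⟩
      refine ⟨isStronglyCartesian_congr (hcomp g) inferInstance, hh', σ, hσ, ?_, e₂⟩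
      rw [← ev_eq, ← e₁, Category.assoc]
    · rintro ⟨-, hh', σ, hσ, e₁, e₂⟩
      refine ⟨hc', hh', σ, hσ, ?_, e₂⟩
      refine cart_ext hb (lift (𝟙 A) g) (isHomLift_id_comp hσ hc'.toIsHomLift)
        (hs'.ev_isHomLift ..) ?_
      rw [ev_eq, ← e₁, Category.assoc]
  obtain ⟨⟨g, H₀⟩, H₁, H₂⟩ := ha _ _ hs' f h hh
  refine ⟨⟨g, fun b' c hc => ?_⟩, ?_, ?_⟩
  · obtain ⟨c', hc', rfl⟩ := hfac g b' c hc
    obtain ⟨h', F⟩ := H₀ b' c' hc'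
    exact ⟨h', (key _ _ _ _ hc').1 F⟩
  · intro g₁ g₂ b₁ b₂ c₁ c₂ h₁ h₂ F₁ F₂
    obtain ⟨c₁', hc₁', rfl⟩ := hfac g₁ b₁ c₁ F₁.cart
    obtain ⟨c₂', hc₂', rfl⟩ := hfac g₂ b₂ c₂ F₂.cart
    exact H₁ _ _ _ _ _ _ _ _ ((key _ _ _ _ hc₁').2 F₁) ((key _ _ _ _ hc₂').2 F₂)
  · intro g b' c h₁ h₂ F₁ F₂
    obtain ⟨c', hc', rfl⟩ := hfac g b' c F₁.cart
    exact H₂ _ _ _ _ _ ((key _ _ _ _ hc').2 F₁) ((key _ _ _ _ hc').2 F₂)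

end QuantifierFree

/-! ### Comparison with simple products -/

section Cleavage

variable {B : Type u₁} [Category.{v₁} B] {E : Type u₂} [Category.{v₂} E] {p : E ⥤ B}

theorem SplitCleavage.cart_of_comp_eq (c : SplitCleavage p) {I J K : B} {w : I ⟶ J} {u : J ⟶ K}
    {u' : I ⟶ K} (h : w ≫ u = u') (Y : p.Fiber K) :
    c.cart u' Y = eqToHom (congrArg Subtype.val (c.pull_of_comp_eq h Y)) ≫
      c.cart w (c.pull u Y) ≫ c.cart u Y := by
  subst h; exact c.cart_comp w u Y

theorem SplitCleavage.cart_pull_pull (c : SplitCleavage p) {I J J' K : B} {u : I ⟶ J} {v : J ⟶ K}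
    {u' : I ⟶ J'} {v' : J' ⟶ K} (h : u ≫ v = u' ≫ v') (Y : p.Fiber K) :
    eqToHom (congrArg Subtype.val (c.pull_pull h Y)) ≫ c.cart u' (c.pull v' Y) ≫ c.cart v' Y =
      c.cart u (c.pull v Y) ≫ c.cart v Y := by
  have h₁ := c.cart_of_comp_eq (h := h) Y
  rw [c.cart_comp u' v' Y, ← cancel_epi (eqToHom (congrArg Subtype.val
    (c.pull_of_comp_eq h Y)).symm)] at h₁
  simpa using h₁

theorem SplitCleavage.exists_vertical (c : SplitCleavage p) {I J : B} (f : I ⟶ J) {α : p.Fiber J}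
    {β : p.Fiber I} (h : β.1 ⟶ α.1) (hh : p.IsHomLift f h) :
    ∃ h₁ : β ⟶ c.pull f α, h₁.1 ≫ c.cart f α = h :=
  ⟨⟨cartLift (c.cart_isStronglyCartesian f α) (𝟙 _) (Category.id_comp _) h hh,
    cartLift_isHomLift ..⟩,
    cartLift_fac (c.cart_isStronglyCartesian f α) (𝟙 _) (Category.id_comp _) h hh⟩

end Cleavage

section Bridge

variable {B : Type u₁} [Category.{v₁} B] [CartesianMonoidalCategory B]
  {E : Type u₂} [Category.{v₂} E] {p : E ⥤ B}

theorem homEquiv_symm_comp_bccMap (c : SplitCleavage p) {I J X : B}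
    {P : p.Fiber (I ⊗ X) ⥤ p.Fiber I} (adjP : c.reindex (fst I X) ⊣ P)
    {Q : p.Fiber (J ⊗ X) ⥤ p.Fiber J} (adjQ : c.reindex (fst J X) ⊣ Q)
    (f : I ⟶ J) (β : p.Fiber (J ⊗ X)) {Γ : p.Fiber I} (n : Γ ⟶ (c.reindex f).obj (Q.obj β)) :
    (adjP.homEquiv _ _).symm (n ≫ bccMap c adjP adjQ f β) = (c.reindex (fst I X)).map n ≫
      (eqToHom (c.pull_pull (whiskerRight_fst f X).symm (Q.obj β)) :
        (c.reindex (fst I X)).obj ((c.reindex f).obj (Q.obj β)) ⟶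
          (c.reindex (f ▷ X)).obj ((c.reindex (fst J X)).obj (Q.obj β))) ≫
      (c.reindex (f ▷ X)).map (adjQ.counit.app β) := by
  rw [bccMap, Adjunction.homEquiv_naturality_left_symm, Equiv.symm_apply_apply]

namespace SimpleProducts

variable {c : SplitCleavage p} (S : SimpleProducts c)

/-- The projection lift and the counit of a simple product form a product span; the universal
property over an arbitrary `f` is the adjunction combined with the Beck-Chevalley isomorphism. -/
theorem isProdSpan {I X : B} (β : p.Fiber (I ⊗ X)) :
    IsProdSpan p I X (c.cart (fst I X) ((S.prodFunctor I X).obj β))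
      ((S.adj I X).counit.app β).1 := by
  set Q := (S.prodFunctor I X).obj β
  have hk : p.IsStronglyCartesian (fst I X) (c.cart (fst I X) Q) :=
    c.cart_isStronglyCartesian _ _
  refine .of_chosen hk ((S.adj I X).counit.app β).2 ?_
  intro K f Γ₀ hΓ
  set Γ : p.Fiber K := ⟨Γ₀, hΓ⟩
  have hf : p.IsStronglyCartesian f (c.cart f Q) := c.cart_isStronglyCartesian _ _
  have hfV : p.IsStronglyCartesian (f ▷ X) (c.cart (f ▷ X) (c.pull (fst I X) Q)) :=
    c.cart_isStronglyCartesian _ _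
  let T (n : Γ ⟶ (c.reindex f).obj Q) : c.pull (fst K X) Γ ⟶ c.pull (f ▷ X) β :=
    ((S.adj K X).homEquiv _ _).symm (n ≫ bccMap c (S.adj K X) (S.adj I X) f β)
  -- The adjunction and the Beck-Chevalley isomorphism make the transposition `T` bijective.
  have hT : Function.Bijective T := by
    have := S.bcc f X β
    obtain ⟨j, -, hj⟩ := (S.bcc f X β).out
    exact ((S.adj K X).homEquiv _ _).symm.bijective.comp
      ⟨fun n₁ n₂ h => (cancel_mono (bccMap c (S.adj K X) (S.adj I X) f β)).1 h,
        fun m => ⟨m ≫ j, (Category.assoc _ _ _).trans ((congrArg _ hj).trans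
          (Category.comp_id m))⟩⟩
  have key : ∀ n : Γ ⟶ c.pull f Q, ∃ n' : (c.pull (fst K X) Γ).1 ⟶ (c.pull (fst I X) Q).1,
      p.IsHomLift (f ▷ X) n' ∧ n' ≫ c.cart (fst I X) Q = c.cart (fst K X) Γ ≫ n.1 ≫ c.cart f Q ∧
      n' ≫ ((S.adj I X).counit.app β).1 = (T n).1 ≫ c.cart (f ▷ X) β := by
    intro n
    have hn := c.pullMap_cart (fst K X) n
    refine ⟨(c.pullMap (fst K X) n).1 ≫
      eqToHom (congrArg Subtype.val (c.pull_pull (whiskerRight_fst f X).symm Q)) ≫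
        c.cart (f ▷ X) (c.pull (fst I X) Q), ?_, ?_, ?_⟩
    · have := (c.pullMap (fst K X) n).2
      exact isHomLift_id_comp this inferInstance
    · rw [Category.assoc, Category.assoc, c.cart_pull_pull (whiskerRight_fst f X).symm Q,
        ← Category.assoc, hn, Category.assoc]
    · have e : T n = c.pullMap (fst K X) n ≫
          eqToHom (c.pull_pull (whiskerRight_fst f X).symm Q) ≫
            c.pullMap (f ▷ X) ((S.adj I X).counit.app β) :=
        homEquiv_symm_comp_bccMap c (S.adj K X) (S.adj I X) f β n
      have e' := c.pullMap_cart (f ▷ X) ((S.adj I X).counit.app β)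
      rw [e, fiber_comp_val, fiber_comp_val, fiber_eqToHom_val]
      refine (Category.assoc _ _ _).trans ((congrArg _ (Category.assoc _ _ _)).trans ?_)
      rw [Category.assoc, Category.assoc]
      exact congrArg (fun t => _ ≫ _ ≫ t) e'.symm
  refine ⟨(c.pull (fst K X) Γ).1, c.cart (fst K X) Γ, c.cart_isStronglyCartesian _ _, ?_, ?_⟩
  · intro m hm
    obtain ⟨m₀, rfl⟩ := c.exists_vertical (f ▷ X) (α := β) (β := c.pull (fst K X) Γ) m hm
    obtain ⟨n, rfl⟩ := hT.2 m₀
    obtain ⟨n', h₁, h₂, h₃⟩ := key n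
    exact ⟨n.1 ≫ c.cart f Q, n', isHomLift_id_comp n.2 hf.toIsHomLift, h₁, h₂, h₃⟩
  · intro n₁ n₂ n₁' n₂' h₁ h₂ h₁' h₂' e₁ e₂ e
    have aux : ∀ (n : Γ₀ ⟶ Q.1) (n' : (c.pull (fst K X) Γ).1 ⟶ (c.pull (fst I X) Q).1)
        (_ : p.IsHomLift f n) (_ : p.IsHomLift (f ▷ X) n')
        (_ : n' ≫ c.cart (fst I X) Q = c.cart (fst K X) Γ ≫ n),
        ∃ n₀ : Γ ⟶ c.pull f Q, n = n₀.1 ≫ c.cart f Q ∧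
          n' ≫ ((S.adj I X).counit.app β).1 = (T n₀).1 ≫ c.cart (f ▷ X) β := by
      intro n n' hn hn' e
      obtain ⟨n₀, en⟩ := c.exists_vertical f (β := Γ) n hn
      obtain ⟨n'', h₁, h₂, h₃⟩ := key n₀
      obtain rfl : n' = n'' := cart_ext hk (f ▷ X) hn' h₁ (by rw [e, h₂, en])
      exact ⟨n₀, en.symm, h₃⟩
    obtain ⟨m₁, rfl, d₁⟩ := aux n₁ n₁' h₁ h₁' e₁
    obtain ⟨m₂, rfl, d₂⟩ := aux n₂ n₂' h₂ h₂' e₂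
    rw [d₁, d₂] at e
    rw [hT.1 (c.vertical_ext _ _ e)]

theorem inst_cart {A X : B} (β : p.Fiber (A ⊗ X)) (g : A ⟶ X) :
    (S.inst β g).1 ≫ c.cart (lift (𝟙 A) g) β =
      (S.isProdSpan β).ev (𝟙 A) g (𝟙 _) (S.isProdSpan β).id_isHomLift := by
  set Q := (S.prodFunctor A X).obj β
  have hw : p.IsStronglyCartesian (lift (𝟙 A) g) (c.cart (lift (𝟙 A) g) (c.pull (fst A X) Q)) :=
    c.cart_isStronglyCartesian _ _
  rw [(S.isProdSpan β).ev_eq (𝟙 A) g (𝟙 _) _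
    (eqToHom (congrArg Subtype.val
      ((c.pull_id _).symm.trans (c.pull_of_comp_eq (lift_fst (𝟙 A) g) Q))) ≫
      c.cart (lift (𝟙 A) g) (c.pull (fst A X) Q)) inferInstance]
  · have e : (S.inst β g).1 = eqToHom (congrArg Subtype.val
        ((c.pull_id _).symm.trans (c.pull_of_comp_eq (lift_fst (𝟙 A) g) Q))) ≫
        (c.pullMap (lift (𝟙 A) g) ((S.adj A X).counit.app β)).1 := by
      rw [← fiber_eqToHom_val]; rfl
    have e' := c.pullMap_cart (lift (𝟙 A) g) ((S.adj A X).counit.app β)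
    rw [e]
    refine (Category.assoc _ _ _).trans ?_
    exact (congrArg (fun t => _ ≫ t) e').trans (Category.assoc _ _ _).symm
  · have := c.cart_of_comp_eq (lift_fst (𝟙 A) g) Q
    rw [c.cart_id, ← cancel_epi (eqToHom (congrArg Subtype.val (c.pull_id Q)).symm)] at this
    simpa using this.symm

/-- The two notions of quantifier-freeness agree. -/
theorem isQuantifierFree_iff {I : B} (α : p.Fiber I) : S.IsQuantifierFree α ↔ IsQF p α.1 := by
  have key : ∀ {A X : B} (f : A ⟶ I) (β : p.Fiber (A ⊗ X))
      (h : (S.prodFunctor A X).obj β ⟶ c.pull f α) (g : A ⟶ X)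
      (h' : c.pull (lift (𝟙 A) g) β ⟶ c.pull f α),
      h = S.inst β g ≫ h' ↔ (S.isProdSpan β).FactorsAt (𝟙 A) (𝟙 _) (S.isProdSpan β).id_isHomLift
        f (h.1 ≫ c.cart f α) g (c.cart (lift (𝟙 A) g) β) (h'.1 ≫ c.cart f α) := by
    intro A X f β h g h'
    have hf : p.IsStronglyCartesian f (c.cart f α) := c.cart_isStronglyCartesian _ _
    have hg : p.IsStronglyCartesian (lift (𝟙 A) g) (c.cart (lift (𝟙 A) g) β) :=
      c.cart_isStronglyCartesian _ _
    constructor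
    · rintro rfl
      exact ⟨hg, isHomLift_id_comp h'.2 hf.toIsHomLift, (S.inst β g).1, (S.inst β g).2,
        S.inst_cart β g, (Category.assoc _ _ _).symm⟩
    · rintro ⟨-, -, σ, hσ, e₁, e₂⟩
      obtain rfl : σ = (S.inst β g).1 := cart_ext hg (𝟙 A) hσ (S.inst β g).2
        (e₁.trans (S.inst_cart β g).symm)
      apply c.vertical_ext
      exact e₂.symm.trans (Category.assoc _ _ _).symm
  constructor
  · intro hα A X V P b k ε hs J f h hh
    have := hs.vert
    let β : p.Fiber (A ⊗ X) := ⟨b, IsHomLift.codomain_eq p (𝟙 (A ⊗ X)) ε⟩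
    obtain rfl : J = I := (IsHomLift.codomain_eq p f h).symm.trans α.2
    have hf : p.IsStronglyCartesian f (c.cart f α) := c.cart_isStronglyCartesian _ _
    refine .of_span (S.isProdSpan β) hs h hh fun h₀ hh₀ => ?_
    obtain ⟨h₁, rfl⟩ := c.exists_vertical f (β := (S.prodFunctor A X).obj β) h₀ hh₀
    obtain ⟨⟨g, h'⟩, hgh, uniq⟩ := hα A X f β h₁
    have down : ∀ (g : A ⟶ X) (h' : (c.pull (lift (𝟙 A) g) β).1 ⟶ α.1),
        (S.isProdSpan β).FactorsAt (𝟙 A) (𝟙 _) (S.isProdSpan β).id_isHomLift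
          f (h₁.1 ≫ c.cart f α) g (c.cart (lift (𝟙 A) g) β) h' →
        ∃ h₂ : c.pull (lift (𝟙 A) g) β ⟶ c.pull f α, h' = h₂.1 ≫ c.cart f α ∧
          h₁ = S.inst β g ≫ h₂ := by
      intro g h' F
      obtain ⟨h₂, e⟩ := c.exists_vertical f (β := c.pull (lift (𝟙 A) g) β) h' F.isHomLift
      exact ⟨h₂, e.symm, (key ..).2 (e ▸ F)⟩
    refine .of_chosen (S.isProdSpan β) _ (fun g => (c.pull (lift (𝟙 A) g) β).1)
      (fun g => c.cart (lift (𝟙 A) g) β) (fun g => c.cart_isStronglyCartesian _ _)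
      ⟨g, _, (key ..).1 hgh⟩ ?_ ?_
    · intro g₁ g₂ k₁ k₂ F₁ F₂
      obtain ⟨m₁, -, e₁⟩ := down g₁ k₁ F₁
      obtain ⟨m₂, -, e₂⟩ := down g₂ k₂ F₂
      exact congrArg Sigma.fst ((uniq ⟨g₁, m₁⟩ e₁).trans (uniq ⟨g₂, m₂⟩ e₂).symm)
    · intro g k₁ k₂ F₁ F₂
      obtain ⟨m₁, rfl, e₁⟩ := down g k₁ F₁
      obtain ⟨m₂, rfl, e₂⟩ := down g k₂ F₂
      have := (uniq ⟨g, m₁⟩ e₁).trans (uniq ⟨g, m₂⟩ e₂).symm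
      rw [eq_of_heq (Sigma.mk.inj this).2]
  · intro hα A X f β h
    have hf : p.IsStronglyCartesian f (c.cart f α) := c.cart_isStronglyCartesian _ _
    obtain ⟨⟨g, H₀⟩, H₁, H₂⟩ := hα _ _ (S.isProdSpan β) f (h.1 ≫ c.cart f α)
      (isHomLift_id_comp h.2 hf.toIsHomLift)
    obtain ⟨h', F⟩ := H₀ _ (c.cart (lift (𝟙 A) g) β) (c.cart_isStronglyCartesian _ _)
    obtain ⟨h₂, rfl⟩ := c.exists_vertical f (β := c.pull (lift (𝟙 A) g) β) h' F.isHomLift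
    refine ⟨⟨g, h₂⟩, (key ..).2 F, ?_⟩
    rintro ⟨g₁, m₁⟩ e₁
    have F₁ := (key ..).1 e₁
    obtain rfl := H₁ _ _ _ _ _ _ _ _ F₁ F
    obtain rfl : m₁ = h₂ := c.vertical_ext _ _ (H₂ _ _ _ _ _ F₁ F)
    rfl

theorem hasEnoughQuantifierFree_iff : S.HasEnoughQuantifierFree ↔ HasEnoughQF p := by
  constructor
  · intro H P
    obtain ⟨X, β, hβ, ⟨i⟩⟩ := H (p.obj P) ⟨P, rfl⟩
    let j : P ≅ ((S.prodFunctor (p.obj P) X).obj β).1 := Functor.Fiber.fiberInclusion.mapIso i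
    have hj : p.IsHomLift (𝟙 (p.obj P)) j.hom := i.hom.2
    have hs := S.isProdSpan β
    have hV : p.IsHomLift (𝟙 (p.obj P ⊗ X))
        (𝟙 (c.pull (fst (p.obj P) X) ((S.prodFunctor (p.obj P) X).obj β)).1) :=
      isHomLift_id (c.pull (fst (p.obj P) X) _).2
    exact ⟨X, _, β.1, _, _, hs.of_iso (Iso.refl _) j.symm (Iso.refl _) hV
      (isHomLift_iso_inv j hj) (isHomLift_id β.2) (Category.id_comp _)
      ((Category.id_comp _).trans (Category.comp_id _).symm),
      (S.isQuantifierFree_iff β).1 hβ⟩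
  · intro H I α
    obtain ⟨α, rfl⟩ := α
    obtain ⟨X, V, b, k, ε, hs, hb⟩ := H α
    have := hs.vert
    let β : p.Fiber (p.obj α ⊗ X) := ⟨b, IsHomLift.codomain_eq p (𝟙 (p.obj α ⊗ X)) ε⟩
    refine ⟨X, β, (S.isQuantifierFree_iff β).2 hb, ?_⟩
    obtain ⟨ψ, hψ, -⟩ := hs.exists_iso (S.isProdSpan β)
    exact ⟨⟨⟨ψ.hom, hψ⟩, ⟨ψ.inv, isHomLift_iso_inv ψ hψ⟩, fiber_hom_ext ψ.hom_inv_id,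
      fiber_hom_ext ψ.inv_hom_id⟩⟩

end SimpleProducts

end Bridge

/-! ### Arrows of the simple product completion as operations -/

namespace ProdCompletion

variable {B : Type u₁} [Category.{v₁} B] [CartesianMonoidalCategory B]
  {E : Type u₂} [Category.{v₂} E] {p : E ⥤ B} {c : SplitCleavage p}

section Act

variable {P Q R : ProdCompletion c}

@[simp] theorem id_f₁ : Hom.f₁ (𝟙 P) = snd _ _ := rfl

@[simp] theorem comp_f₀ (F : P ⟶ Q) (G : Q ⟶ R) : Hom.f₀ (F ≫ G) = F.f₀ ≫ G.f₀ := rfl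

@[simp] theorem comp_f₁ (F : P ⟶ Q) (G : Q ⟶ R) : Hom.f₁ (F ≫ G) =
    lift (fst _ _) (lift (fst _ _ ≫ F.f₀) (snd _ _) ≫ G.f₁) ≫ F.f₁ := rfl

/-- The vertical component of an arrow, as an arrow `⟨π, f₁⟩^* α ⟶ β` over `f₀ × Y` of the total
category. -/
def tot (F : P ⟶ Q) : (c.pull (lift (fst P.base Q.bound) F.f₁) P.form).1 ⟶ Q.form.1 :=
  F.φ.1 ≫ c.cart _ Q.form

theorem tot_isHomLift (F : P ⟶ Q) :
    p.IsHomLift (lift (fst P.base Q.bound ≫ F.f₀) (snd P.base Q.bound)) (tot F) :=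
  isHomLift_id_comp F.φ.2 (c.cart_isStronglyCartesian _ Q.form).toIsHomLift

/-- An arrow `F : (I, X, α) ⟶ (J, Y, β)` sends an element `s` of `α` at `(a, f₁(a, y))` to an
element of `β` at `(f₀(a), y)`; here an element of `α` at `t : K ⟶ I × X` is an arrow into `α` over
`t`. The term `x = f₁(a, y)` may be presented in any form. -/
def act (F : P ⟶ Q) {K : B} (a : K ⟶ P.base) (y : K ⟶ Q.bound) (x : K ⟶ P.bound)
    (hx : lift a y ≫ F.f₁ = x) {W : E} (s : W ⟶ P.form.1) (hs : p.IsHomLift (lift a x) s) :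
    W ⟶ Q.form.1 :=
  cartLift (c.cart_isStronglyCartesian (lift (fst P.base Q.bound) F.f₁) P.form) (lift a y)
    (by rw [comp_lift, lift_fst, hx]) s hs ≫ tot F

theorem act_isHomLift (F : P ⟶ Q) {K : B} {a : K ⟶ P.base} {a' : K ⟶ Q.base}
    (ha : a ≫ F.f₀ = a') (y : K ⟶ Q.bound) (x : K ⟶ P.bound)
    (hx : lift a y ≫ F.f₁ = x) {W : E} (s : W ⟶ P.form.1) (hs : p.IsHomLift (lift a x) s) :
    p.IsHomLift (lift a' y) (act F a y x hx s hs) :=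
  isHomLift_comp (cartLift_isHomLift ..) (tot_isHomLift F) (by ext <;> simp [ha])

theorem act_congr {F F' : P ⟶ Q} {K : B} {a a' : K ⟶ P.base} {y y' : K ⟶ Q.bound}
    {x x' : K ⟶ P.bound} {hx : lift a y ≫ F.f₁ = x} (hx' : lift a' y' ≫ F'.f₁ = x') {W : E}
    {s s' : W ⟶ P.form.1} {hs : p.IsHomLift (lift a x) s} (hs' : p.IsHomLift (lift a' x') s')
    (eF : F = F') (ea : a = a') (ey : y = y') (es : s = s') :
    act F a y x hx s hs = act F' a' y' x' hx' s' hs' := by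
  subst eF ea ey es hx hx'; rfl

theorem comp_act (F : P ⟶ Q) {K L : B} {w : L ⟶ K} {a : K ⟶ P.base} {y : K ⟶ Q.bound}
    {x : K ⟶ P.bound} {a' : L ⟶ P.base} {y' : L ⟶ Q.bound} {x' : L ⟶ P.bound}
    (hx : lift a y ≫ F.f₁ = x) (hx' : lift a' y' ≫ F.f₁ = x') (ea : w ≫ a = a')
    (ey : w ≫ y = y') {W U : E} (r : U ⟶ W) (hr : p.IsHomLift w r) (s : W ⟶ P.form.1)
    (hs : p.IsHomLift (lift a x) s) (hrs : p.IsHomLift (lift a' x') (r ≫ s)) :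
    act F a' y' x' hx' (r ≫ s) hrs = r ≫ act F a y x hx s hs := by
  rw [act, act, ← Category.assoc r]
  congr 1
  refine cart_ext (c.cart_isStronglyCartesian (lift (fst P.base Q.bound) F.f₁) P.form)
    (lift a' y') (cartLift_isHomLift ..)
    (isHomLift_comp hr (cartLift_isHomLift ..) (by rw [comp_lift, ea, ey])) ?_
  rw [cartLift_fac, Category.assoc, cartLift_fac]

theorem act_generic (F : P ⟶ Q) (hx : lift (fst P.base Q.bound) (snd P.base Q.bound) ≫ F.f₁ = F.f₁)
    (hs : p.IsHomLift (lift (fst P.base Q.bound) F.f₁)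
      (c.cart (lift (fst P.base Q.bound) F.f₁) P.form)) :
    act F (fst _ _) (snd _ _) F.f₁ hx _ hs = tot F := by
  have hc := c.cart_isStronglyCartesian (lift (fst P.base Q.bound) F.f₁) P.form
  have key : cartLift hc (lift (fst P.base Q.bound) (snd P.base Q.bound))
      (by simp) _ hs = 𝟙 _ :=
    cart_ext hc (𝟙 _) (isHomLift_congr (by simp) (cartLift_isHomLift ..))
      (isHomLift_id (c.pull _ P.form).2) (by rw [cartLift_fac, Category.id_comp])
  exact (congrArg (fun t => t ≫ tot F) key).trans (Category.id_comp _)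

theorem hom_ext {F G : P ⟶ Q} (h₀ : F.f₀ = G.f₀) (h₁ : F.f₁ = G.f₁)
    (h : ∀ {K : B} (a : K ⟶ P.base) (y : K ⟶ Q.bound) (x : K ⟶ P.bound)
      (hF : lift a y ≫ F.f₁ = x) (hG : lift a y ≫ G.f₁ = x) {W : E} (s : W ⟶ P.form.1)
      (hs : p.IsHomLift (lift a x) s), act F a y x hF s hs = act G a y x hG s hs) : F = G := by
  obtain ⟨f₀, f₁, φ⟩ := F
  obtain ⟨g₀, g₁, ψ⟩ := G
  dsimp only at h₀ h₁
  subst h₀ h₁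
  have hc := c.cart_isStronglyCartesian (lift (fst P.base Q.bound) f₁) P.form
  have h1 : lift (fst P.base Q.bound) (snd P.base Q.bound) ≫ f₁ = f₁ := by simp
  have e := h (fst _ _) (snd _ _) f₁ h1 h1 _ hc.toIsHomLift
  have := c.vertical_ext _ _ ((act_generic _ h1 hc.toIsHomLift).symm.trans
    (e.trans (act_generic _ h1 hc.toIsHomLift)))
  dsimp only at this
  rw [this]

/-- The arrow with given first components and given vertical component, the latter presented as
an arrow of the total category. -/
def mkHom (f₀ : P.base ⟶ Q.base) (f₁ : P.base ⊗ Q.bound ⟶ P.bound)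
    (τ : (c.pull (lift (fst P.base Q.bound) f₁) P.form).1 ⟶ Q.form.1)
    (hτ : p.IsHomLift (lift (fst P.base Q.bound ≫ f₀) (snd P.base Q.bound)) τ) : P ⟶ Q where
  f₀ := f₀
  f₁ := f₁
  φ := ⟨cartLift (c.cart_isStronglyCartesian _ Q.form) (𝟙 _) (Category.id_comp _) τ hτ,
    cartLift_isHomLift ..⟩

section

variable (f₀ : P.base ⟶ Q.base) (f₁ : P.base ⊗ Q.bound ⟶ P.bound)
    (τ : (c.pull (lift (fst P.base Q.bound) f₁) P.form).1 ⟶ Q.form.1)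
    (hτ : p.IsHomLift (lift (fst P.base Q.bound ≫ f₀) (snd P.base Q.bound)) τ)

theorem act_mkHom {K : B} (a : K ⟶ P.base) (y : K ⟶ Q.bound) (x : K ⟶ P.bound)
    (hx : lift a y ≫ f₁ = x) {W : E} (s : W ⟶ P.form.1) (hs : p.IsHomLift (lift a x) s) :
    act (mkHom f₀ f₁ τ hτ) a y x hx s hs =
      cartLift (c.cart_isStronglyCartesian (lift (fst P.base Q.bound) f₁) P.form) (lift a y)
        (by rw [comp_lift, lift_fst, hx]) s hs ≫ τ :=
  congrArg (fun t => _ ≫ t)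
    (cartLift_fac (c.cart_isStronglyCartesian _ Q.form) (𝟙 _) (Category.id_comp _) τ hτ)

end

theorem act_id {K : B} (a : K ⟶ P.base) (y x : K ⟶ P.bound) (hx : lift a y ≫ Hom.f₁ (𝟙 P) = x)
    {W : E} (s : W ⟶ P.form.1) (hs : p.IsHomLift (lift a x) s) : act (𝟙 P) a y x hx s hs = s := by
  have e : tot (𝟙 P) = c.cart (lift (fst P.base P.bound) (snd P.base P.bound)) P.form := by
    have := c.eqToHom_cart (show lift (fst P.base P.bound) (snd P.base P.bound) =
      lift (fst P.base P.bound ≫ 𝟙 _) (snd P.base P.bound) by simp) P.form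
    exact this
  rw [act, e]
  exact cartLift_fac ..

theorem act_comp (F : P ⟶ Q) (G : Q ⟶ R) {K : B} (a : K ⟶ P.base) (z : K ⟶ R.bound)
    (y : K ⟶ Q.bound) (x : K ⟶ P.bound) (a' : K ⟶ Q.base) (ha : a ≫ F.f₀ = a')
    (hy : lift a' z ≫ G.f₁ = y) (hx : lift a y ≫ F.f₁ = x)
    (hxz : lift a z ≫ Hom.f₁ (F ≫ G) = x) {W : E} (s : W ⟶ P.form.1)
    (hs : p.IsHomLift (lift a x) s) :
    act (F ≫ G) a z x hxz s hs =
      act G a' z y hy (act F a y x hx s hs) (act_isHomLift F ha y x hx s hs) := by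
  have e : tot (F ≫ G) = (c.sub (v' := lift (fst P.base R.bound ≫ F.f₀)
          (lift (fst P.base R.bound ≫ F.f₀) (snd P.base R.bound) ≫ G.f₁))
        (lift (fst P.base R.bound)
          (lift (fst P.base R.bound ≫ F.f₀) (snd P.base R.bound) ≫ G.f₁))
        (u' := lift (fst P.base R.bound) (Hom.f₁ (F ≫ G)))
        (by simp) (by simp) F.φ).1 ≫ eqToHom (congrArg Subtype.val (c.pull_of_comp_eq
          (by simp) Q.form)) ≫
      c.cart (lift (fst P.base R.bound ≫ F.f₀) (snd P.base R.bound))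
        (c.pull (lift (fst Q.base R.bound) G.f₁) Q.form) ≫ tot G := by
    refine (Category.assoc _ _ _).trans (congrArg _ ?_)
    exact c.sub_cart (lift (fst P.base R.bound ≫ F.f₀) (snd P.base R.bound)) _ _ G.φ
  have hF := c.cart_isStronglyCartesian (lift (fst P.base Q.bound) F.f₁) P.form
  have hG := c.cart_isStronglyCartesian (lift (fst Q.base R.bound) G.f₁) Q.form
  rw [act, e, act]
  simp only [← Category.assoc]
  congr 1
  simp only [Category.assoc]
  refine cart_ext hG (lift a' z) ?_ (cartLift_isHomLift ..) ?_
  · refine isHomLift_comp (cartLift_isHomLift ..) (isHomLift_id_comp (c.sub _ _ _ F.φ).2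
      (isHomLift_id_comp ?_ (c.cart_isStronglyCartesian _ _).toIsHomLift)) ?_
    · exact IsHomLift.eqToHom_domain_lift_id _ (c.pull _ Q.form).2
    · ext <;> simp [ha]
  · rw [cartLift_fac, act]
    simp only [Category.assoc]
    rw [← c.cart_of_comp_eq]
    refine (congrArg (fun t => _ ≫ t) (c.sub_cart _ _ _ F.φ)).trans ?_
    have e₂ : tot F = F.φ.1 ≫ c.cart _ Q.form := rfl
    rw [e₂]
    simp only [← Category.assoc]
    congr 2
    simp only [Category.assoc]
    refine cart_ext hF (lift a y) ?_ (cartLift_isHomLift ..) ?_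
    · refine isHomLift_comp (cartLift_isHomLift ..)
        (isHomLift_id_comp ?_ (c.cart_isStronglyCartesian _ _).toIsHomLift) ?_
      · exact IsHomLift.eqToHom_domain_lift_id _ (c.pull _ P.form).2
      · ext
        · simp
        · simp [← hy, ← ha, comp_lift_assoc]
    · rw [cartLift_fac]
      simp only [Category.assoc]
      rw [← c.cart_of_comp_eq, cartLift_fac]
      simp
    · simp

end Act

end ProdCompletion

namespace ProdCompletion

variable {B : Type u₁} [Category.{v₁} B] [CartesianMonoidalCategory B]
  {E : Type u₂} [Category.{v₂} E] {p : E ⥤ B} {c : SplitCleavage p}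

/-! ### Cartesian arrows and simple products in the completion -/

theorem isHomLift_proj_iff {P Q : ProdCompletion c} {f : P.base ⟶ Q.base} {F : P ⟶ Q} :
    (proj c).IsHomLift f F ↔ F.f₀ = f := by
  constructor
  · intro h
    exact (@IsHomLift.eq_of_isHomLift _ _ _ _ (proj c) P Q f F h).symm
  · rintro rfl
    exact IsHomLift.map (proj c) F

/-- Reindexing in the completion: the Cartesian arrow `(K, Y, (f × Y)^* β) ⟶ (J, Y, β)` over
`f : K ⟶ J`. -/
def cartHom (Q : ProdCompletion c) {K : B} (f : K ⟶ Q.base) :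
    (⟨K, Q.bound, c.pull (f ▷ Q.bound) Q.form⟩ : ProdCompletion c) ⟶ Q :=
  mkHom f (snd K Q.bound) (c.cart (lift (fst K Q.bound) (snd K Q.bound))
      (c.pull (f ▷ Q.bound) Q.form) ≫ c.cart (f ▷ Q.bound) Q.form)
    (isHomLift_comp (c.cart_isStronglyCartesian _ _).toIsHomLift
      (c.cart_isStronglyCartesian _ _).toIsHomLift (by ext <;> simp))

theorem act_cartHom (Q : ProdCompletion c) {K : B} (f : K ⟶ Q.base) {L : B} (a : L ⟶ K)
    (y x : L ⟶ Q.bound) (hx : lift a y ≫ (cartHom Q f).f₁ = x) {W : E}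
    (s : W ⟶ (c.pull (f ▷ Q.bound) Q.form).1) (hs : p.IsHomLift (lift a x) s) :
    act (cartHom Q f) a y x hx s hs = s ≫ c.cart (f ▷ Q.bound) Q.form :=
  (act_mkHom (P := ⟨K, Q.bound, c.pull (f ▷ Q.bound) Q.form⟩) f (snd K Q.bound) _ _ a y x hx s
    hs).trans (cartLift_fac_assoc ..)

theorem comp_cartHom_f₁ (Q : ProdCompletion c) {K : B} (f : K ⟶ Q.base) {P : ProdCompletion c}
    (G : P ⟶ ⟨K, Q.bound, c.pull (f ▷ Q.bound) Q.form⟩) : Hom.f₁ (G ≫ cartHom Q f) = G.f₁ := by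
  change lift _ (lift _ _ ≫ snd _ _) ≫ Hom.f₁ G = Hom.f₁ G
  rw [lift_snd, lift_fst_snd, Category.id_comp]

theorem act_comp_cartHom (Q : ProdCompletion c) {K : B} (f : K ⟶ Q.base) {P : ProdCompletion c}
    (G : P ⟶ ⟨K, Q.bound, c.pull (f ▷ Q.bound) Q.form⟩) {L : B} (a : L ⟶ P.base)
    (y : L ⟶ Q.bound) (x : L ⟶ P.bound) (hx : lift a y ≫ Hom.f₁ (G ≫ cartHom Q f) = x)
    (hx' : lift a y ≫ G.f₁ = x) {W : E} (s : W ⟶ P.form.1) (hs : p.IsHomLift (lift a x) s) :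
    act (G ≫ cartHom Q f) a y x hx s hs = act G a y x hx' s hs ≫ c.cart (f ▷ Q.bound) Q.form :=
  (act_comp G (cartHom Q f) a y y x _ rfl (lift_snd _ _) hx' hx s hs).trans (act_cartHom ..)

theorem cartHom_comp_f₁ (Q : ProdCompletion c) {K : B} (f : K ⟶ Q.base) {R : ProdCompletion c}
    (G : Q ⟶ R) : Hom.f₁ (cartHom Q f ≫ G) = lift (fst K R.bound ≫ f) (snd K R.bound) ≫ G.f₁ := by
  change lift _ (lift _ _ ≫ Hom.f₁ G) ≫ snd _ _ = _
  rw [lift_snd]; rfl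

theorem act_cartHom_comp (Q : ProdCompletion c) {K : B} (f : K ⟶ Q.base) {R : ProdCompletion c}
    (G : Q ⟶ R) {L : B} (a : L ⟶ K) (a' : L ⟶ Q.base) (ha : a ≫ f = a') (y : L ⟶ R.bound)
    (x : L ⟶ Q.bound) (hx : lift a y ≫ Hom.f₁ (cartHom Q f ≫ G) = x) (hx' : lift a' y ≫ G.f₁ = x)
    {W : E} (s : W ⟶ (c.pull (f ▷ Q.bound) Q.form).1) (hs : p.IsHomLift (lift a x) s)
    (hs' : p.IsHomLift (lift a' x) (s ≫ c.cart (f ▷ Q.bound) Q.form)) :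
    act (cartHom Q f ≫ G) a y x hx s hs = act G a' y x hx' (s ≫ c.cart (f ▷ Q.bound) Q.form) hs' :=
  (act_comp (cartHom Q f) G a y x x a' ha hx' (lift_snd _ _) hx s hs).trans
    (act_congr _ _ rfl rfl rfl (act_cartHom ..))

theorem cartHom_isStronglyCartesian (Q : ProdCompletion c) {K : B} (f : K ⟶ Q.base) :
    (proj c).IsStronglyCartesian f (cartHom Q f) where
  toIsHomLift := isHomLift_proj_iff.2 rfl
  universal_property' := by
    intro Z (g : Z.base ⟶ K) F hF
    have hF₀ : F.f₀ = g ≫ f := isHomLift_proj_iff.1 hF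
    have hc := c.cart_isStronglyCartesian (f ▷ Q.bound) Q.form
    let R : ProdCompletion c := ⟨K, Q.bound, c.pull (f ▷ Q.bound) Q.form⟩
    have hw : lift (fst Z.base Q.bound ≫ g) (snd Z.base Q.bound) ≫ f ▷ Q.bound =
        lift (fst Z.base Q.bound ≫ F.f₀) (snd Z.base Q.bound) := by
      rw [hF₀]; ext <;> simp
    have ht := tot_isHomLift F
    let G : Z ⟶ R := mkHom g F.f₁ (cartLift hc _ hw (tot F) ht) (cartLift_isHomLift ..)
    have hG : G ≫ cartHom Q f = F := by
      refine hom_ext hF₀.symm ?_ ?_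
      · exact comp_cartHom_f₁ Q f G
      · intro L a y x h₁ h₂ W s hs
        rw [act_comp_cartHom Q f G a y x h₁ h₂]
        refine (congrArg (fun t => t ≫ c.cart (f ▷ Q.bound) Q.form)
          (act_mkHom (Q := R) g F.f₁ _ (cartLift_isHomLift hc _ hw (tot F) ht)
            a y x h₂ s hs)).trans ?_
        rw [Category.assoc]
        exact congrArg (fun t => _ ≫ t) (cartLift_fac ..)
    refine ⟨G, ⟨isHomLift_proj_iff.2 rfl, hG⟩, ?_⟩
    rintro G' ⟨hG', e⟩
    have hG'₀ : Hom.f₀ G' = g := isHomLift_proj_iff.1 hG'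
    have e₁ : Hom.f₁ G' = F.f₁ := by
      rw [← e, comp_cartHom_f₁]
    refine hom_ext hG'₀ e₁ ?_
    intro L a y x h₁ h₂ W s hs
    refine cart_ext hc (lift (a ≫ g) y) (act_isHomLift G' (by rw [hG'₀]) y x h₁ s hs)
      (act_isHomLift G rfl y x h₂ s hs) ?_
    have k₁ := act_comp_cartHom Q f G' a y x (by rw [e]; exact h₂) h₁ s hs
    have k₂ := act_comp_cartHom Q f G a y x (by rw [hG]; exact h₂) h₂ s hs
    rw [← k₁, ← k₂]
    exact act_congr _ _ (e.trans hG.symm) rfl rfl rfl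

section Product

variable {A X Z T : B} (θ : X ⊗ Z ≅ T) (γ : p.Fiber ((A ⊗ X) ⊗ Z)) (δ : p.Fiber (A ⊗ T))
  (ι : γ.1 ≅ δ.1)
  (hι : p.IsHomLift (lift (fst (A ⊗ X) Z ≫ fst A X)
    (lift (fst (A ⊗ X) Z ≫ snd A X) (snd (A ⊗ X) Z) ≫ θ.hom)) ι.hom)

include hι in
theorem inv_isHomLift_of_product : p.IsHomLift (lift (lift (fst A T) (snd A T ≫ θ.inv ≫ fst X Z))
    (snd A T ≫ θ.inv ≫ snd X Z)) ι.inv := by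
  let e : (A ⊗ X) ⊗ Z ≅ A ⊗ T :=
    { hom := lift (fst (A ⊗ X) Z ≫ fst A X)
        (lift (fst (A ⊗ X) Z ≫ snd A X) (snd (A ⊗ X) Z) ≫ θ.hom)
      inv := lift (lift (fst A T) (snd A T ≫ θ.inv ≫ fst X Z)) (snd A T ≫ θ.inv ≫ snd X Z)
      hom_inv_id := by ext <;> simp
      inv_hom_id := by
        ext
        · simp
        · have : lift (snd A T ≫ θ.inv ≫ fst X Z) (snd A T ≫ θ.inv ≫ snd X Z) =
            snd A T ≫ θ.inv := by ext <;> simp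
          simp [comp_lift_assoc, this] }
  exact IsHomLift.inv_lift_inv p e ι

/-- The object `(A, T, δ)` of the completion, pulled back along `A × X ⟶ A`. -/
abbrev weak (X : B) (δ : p.Fiber (A ⊗ T)) : ProdCompletion c :=
  ⟨A ⊗ X, T, c.pull (fst A X ▷ T) δ⟩

/-- The counit `(A × X, T, π^* δ) ⟶ (A × X, Z, γ)` exhibiting `(A, T, δ)`, with `T ≅ X × Z` and
`δ ≅ γ` along the induced `A × T ≅ (A × X) × Z`, as the simple product of `(A × X, Z, γ)`. Its
second component sends `((a, x), z)` to `θ (x, z)`. -/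
def counitHom : (weak X δ : ProdCompletion c) ⟶ ⟨A ⊗ X, Z, γ⟩ :=
  mkHom (P := weak X δ) (Q := ⟨A ⊗ X, Z, γ⟩) (𝟙 _)
    (lift (fst (A ⊗ X) Z ≫ snd A X) (snd (A ⊗ X) Z) ≫ θ.hom)
    (c.cart (lift (fst (A ⊗ X) Z) (lift (fst (A ⊗ X) Z ≫ snd A X) (snd (A ⊗ X) Z) ≫ θ.hom))
      (c.pull (fst A X ▷ T) δ) ≫ c.cart (fst A X ▷ T) δ ≫ ι.inv)
    (isHomLift_comp (c.cart_isStronglyCartesian _ _).toIsHomLift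
      (isHomLift_comp (c.cart_isStronglyCartesian _ _).toIsHomLift
        (inv_isHomLift_of_product θ γ δ ι hι) rfl) (by
          ext <;> simp))

theorem act_counitHom {L : B} (a : L ⟶ A ⊗ X) (z : L ⟶ Z) (x : L ⟶ T)
    (hx : lift a z ≫ (counitHom (c := c) θ γ δ ι hι).f₁ = x) {W : E}
    (s : W ⟶ (c.pull (fst A X ▷ T) δ).1) (hs : p.IsHomLift (lift a x) s) :
    act (counitHom (c := c) θ γ δ ι hι) a z x hx s hs = s ≫ c.cart (fst A X ▷ T) δ ≫ ι.inv :=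
  (act_mkHom (P := weak X δ) (Q := ⟨A ⊗ X, Z, γ⟩) (𝟙 _) _ _ _ a z x hx s hs).trans
    (cartLift_fac_assoc ..)

/-- The second component of an instantiation in the completion: the bound variable of the product is
supplied as the pair of the instantiating term and the remaining variable. -/
theorem comp_counitHom_f₁ {Γ : ProdCompletion c} (v : Γ ⟶ weak X δ) (s : Γ ⟶ ⟨A, T, δ⟩)
    (e : v ≫ cartHom ⟨A, T, δ⟩ (fst A X) = s) :
    Hom.f₁ (v ≫ counitHom θ γ δ ι hι) =
      lift (fst Γ.base Z) (lift (fst Γ.base Z ≫ v.f₀ ≫ snd A X) (snd Γ.base Z) ≫ θ.hom) ≫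
        s.f₁ := by
  have e₁ : Hom.f₁ s = v.f₁ := by
    rw [← e]; exact comp_cartHom_f₁ ⟨A, T, δ⟩ (fst A X) v
  rw [e₁, comp_f₁]
  congr 1
  change lift _ (lift _ _ ≫ lift (fst (A ⊗ X) Z ≫ snd A X) (snd (A ⊗ X) Z) ≫ θ.hom) = _
  simp [comp_lift_assoc]

theorem act_comp_counitHom {Γ : ProdCompletion c} (v : Γ ⟶ weak X δ) (s : Γ ⟶ ⟨A, T, δ⟩)
    (e : v ≫ cartHom ⟨A, T, δ⟩ (fst A X) = s) {L : B} (w : L ⟶ Γ.base) (z : L ⟶ Z)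
    (x : L ⟶ Γ.bound) (hx : lift w z ≫ Hom.f₁ (v ≫ counitHom θ γ δ ι hι) = x) (t : L ⟶ T)
    (ht : lift (w ≫ v.f₀ ≫ snd A X) z ≫ θ.hom = t)
    (hx' : lift w t ≫ s.f₁ = x) {W : E} (r : W ⟶ Γ.form.1) (hr : p.IsHomLift (lift w x) r) :
    act (v ≫ counitHom θ γ δ ι hι) w z x hx r hr ≫ ι.hom = act s w t x hx' r hr := by
  have e₁ : Hom.f₁ s = v.f₁ := by
    rw [← e]; exact comp_cartHom_f₁ ⟨A, T, δ⟩ (fst A X) v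
  have ht' : lift (w ≫ v.f₀) z ≫ (counitHom (c := c) θ γ δ ι hι).f₁ = t := by
    change _ ≫ lift (fst (A ⊗ X) Z ≫ snd A X) (snd (A ⊗ X) Z) ≫ θ.hom = t
    rw [← ht]
    simp [comp_lift_assoc]
  have h₁ := act_comp v (counitHom θ γ δ ι hι) w z t x (w ≫ v.f₀) rfl ht' (by rw [← e₁, hx']) hx
    r hr
  rw [act_counitHom] at h₁
  refine (congrArg (fun t => t ≫ ι.hom) h₁).trans ?_
  simp only [Category.assoc, Iso.inv_hom_id, Category.comp_id]
  have := act_comp_cartHom ⟨A, T, δ⟩ (fst A X) v w t x (by rw [e, hx']) (by rw [← e₁, hx']) r hr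
  rw [← this]
  exact act_congr _ _ e rfl rfl rfl

/-- Simple products in the completion: the simple product of `(A × X, Z, γ)` along `X` is
`(A, X × Z, γ)`, up to the associativity of products. -/
theorem isProdSpan_counitHom : IsProdSpan (proj c) A X
    (cartHom (⟨A, T, δ⟩ : ProdCompletion c) (fst A X)) (counitHom θ γ δ ι hι) := by
  refine .of_chosen (cartHom_isStronglyCartesian _ _) (isHomLift_proj_iff.2 rfl) ?_
  intro K f Γ hΓ
  obtain ⟨K', Wb, η⟩ := Γ
  obtain rfl : K' = K := hΓ
  let Γ : ProdCompletion c := ⟨K', Wb, η⟩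
  have hV := cartHom_isStronglyCartesian (⟨A, T, δ⟩ : ProdCompletion c) (fst A X)
  have hη := c.cart_isStronglyCartesian (fst K' X ▷ Wb) η
  refine ⟨_, cartHom Γ (fst K' X), cartHom_isStronglyCartesian _ _, ?_, ?_⟩
  · intro m hm
    have hm₀ : Hom.f₀ m = f ▷ X := isHomLift_proj_iff.1 hm
    let e₂ : K' ⊗ T ⟶ (K' ⊗ X) ⊗ Z :=
      lift (lift (fst K' T) (snd K' T ≫ θ.inv ≫ fst X Z)) (snd K' T ≫ θ.inv ≫ snd X Z)
    have hlift : ∀ {L : B} (a : L ⟶ K') (t : L ⟶ T), lift a t ≫ e₂ =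
        lift (lift a (t ≫ θ.inv ≫ fst X Z)) (t ≫ θ.inv ≫ snd X Z) := by
      intro L a t; ext <;> simp [e₂]
    let n₁ : K' ⊗ T ⟶ Wb := e₂ ≫ m.f₁
    have hs₀ := c.cart_isStronglyCartesian (lift (fst K' T) n₁) η
    let s₀ : (c.pull (lift (fst K' T) n₁) η).1 ⟶ (c.pull (fst K' X ▷ Wb) η).1 :=
      cartLift hη (lift (lift (fst K' T) (snd K' T ≫ θ.inv ≫ fst X Z)) n₁) (by ext <;> simp)
        (c.cart (lift (fst K' T) n₁) η) hs₀.toIsHomLift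
    have hs₀' : p.IsHomLift (lift (lift (fst K' T) (snd K' T ≫ θ.inv ≫ fst X Z)) n₁) s₀ :=
      cartLift_isHomLift ..
    let τ := act m (lift (fst K' T) (snd K' T ≫ θ.inv ≫ fst X Z)) (snd K' T ≫ θ.inv ≫ snd X Z)
      n₁ rfl s₀ hs₀' ≫ ι.hom
    have hτ : p.IsHomLift (lift (fst K' T ≫ f) (snd K' T)) τ := by
      refine isHomLift_comp (act_isHomLift m rfl _ _ rfl s₀ hs₀') hι ?_
      rw [hm₀]
      have : lift (snd K' T ≫ θ.inv ≫ fst X Z) (snd K' T ≫ θ.inv ≫ snd X Z) =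
        snd K' T ≫ θ.inv := by ext <;> simp
      ext
      · simp
      · simp [comp_lift_assoc, this]
    let n : Γ ⟶ ⟨A, T, δ⟩ := mkHom f n₁ τ hτ
    have hn : (proj c).IsHomLift f n := isHomLift_proj_iff.2 rfl
    have act_n : ∀ {L : B} (a : L ⟶ K') (t : L ⟶ T) (x : L ⟶ Wb) (hx : lift a t ≫ n₁ = x) {W : E}
        (s : W ⟶ η.1) (hs : p.IsHomLift (lift a x) s) (s' : W ⟶ (c.pull (fst K' X ▷ Wb) η).1)
        (hs' : p.IsHomLift (lift (lift a (t ≫ θ.inv ≫ fst X Z)) x) s')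
        (_ : s' ≫ c.cart (fst K' X ▷ Wb) η = s)
        (hx' : lift (lift a (t ≫ θ.inv ≫ fst X Z)) (t ≫ θ.inv ≫ snd X Z) ≫ m.f₁ = x),
        act n a t x hx s hs = act m (lift a (t ≫ θ.inv ≫ fst X Z)) (t ≫ θ.inv ≫ snd X Z) x
          hx' s' hs' ≫ ι.hom := by
      intro L a t x hx W s hs s' hs' es hx'
      have hlx : lift a t ≫ lift (fst K' T) n₁ = lift a x := by rw [comp_lift, lift_fst, hx]
      have es' : cartLift hs₀ (lift a t) hlx s hs ≫ s₀ = s' := by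
        refine cart_ext hη (lift (lift a (t ≫ θ.inv ≫ fst X Z)) x)
          (isHomLift_comp (cartLift_isHomLift ..) hs₀' ?_) hs' ?_
        · simp [comp_lift, hx]
        · rw [Category.assoc, es]
          exact (congrArg (fun t => _ ≫ t) (cartLift_fac ..)).trans (cartLift_fac ..)
      refine (act_mkHom (P := Γ) (Q := ⟨A, T, δ⟩) f n₁ τ hτ a t x hx s hs).trans ?_
      rw [← Category.assoc]
      congr 1
      subst es'
      exact (comp_act m rfl hx' (by ext <;> simp) (by simp) _ (cartLift_isHomLift ..) s₀ hs₀'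
        hs').symm
    have hkn : (proj c).IsHomLift (fst K' X ≫ f) (cartHom Γ (fst K' X) ≫ n) :=
      isHomLift_proj_iff.2 rfl
    have en := cartLift_fac hV (f ▷ X) (whiskerRight_fst f X) _ hkn
    have hn' := cartLift_isHomLift hV (f ▷ X) (whiskerRight_fst f X) _ hkn
    refine ⟨n, _, hn, hn', en, ?_⟩
    generalize cartLift hV (f ▷ X) (whiskerRight_fst f X) _ hkn = n' at en hn'
    have hn'₀ : Hom.f₀ n' = f ▷ X := isHomLift_proj_iff.1 hn'
    have hf₁ : Hom.f₁ (n' ≫ counitHom θ γ δ ι hι) = m.f₁ := by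
      rw [comp_counitHom_f₁ θ γ δ ι hι n' _ en, hn'₀, cartHom_comp_f₁]
      change lift _ _ ≫ lift (fst (K' ⊗ X) T ≫ fst K' X) (snd (K' ⊗ X) T) ≫ e₂ ≫ m.f₁ = m.f₁
      rw [← Category.assoc (lift _ _) e₂, hlift, ← Category.assoc]
      refine Eq.trans ?_ (Category.id_comp _)
      congr 1
      ext <;> simp
    refine hom_ext ?_ hf₁ ?_
    · rw [comp_f₀, hn'₀, hm₀]
      exact Category.comp_id _
    · intro L (a : L ⟶ K' ⊗ X) (y : L ⟶ Z) (x : L ⟶ Wb) h₁ h₂ W s hs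
      rw [← cancel_mono ι.hom]
      have hxX : (lift (a ≫ snd K' X) y ≫ θ.hom) ≫ θ.inv ≫ fst X Z = a ≫ snd K' X := by simp
      have hxZ : (lift (a ≫ snd K' X) y ≫ θ.hom) ≫ θ.inv ≫ snd X Z = y := by simp
      have ha : lift (a ≫ fst K' X) ((lift (a ≫ snd K' X) y ≫ θ.hom) ≫ θ.inv ≫ fst X Z) = a := by
        rw [hxX]; ext <;> simp
      have h₃ : lift (a ≫ fst K' X) (lift (a ≫ snd K' X) y ≫ θ.hom) ≫ n₁ = x := by
        rw [← h₂, ← Category.assoc, hlift, ha, hxZ]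
      have h₄ : lift a (lift (a ≫ snd K' X) y ≫ θ.hom) ≫
          Hom.f₁ (cartHom Γ (fst K' X) ≫ n) = x := by
        rw [cartHom_comp_f₁, ← h₃]
        change _ ≫ lift (fst (K' ⊗ X) T ≫ fst K' X) (snd (K' ⊗ X) T) ≫ n₁ = _
        simp [comp_lift_assoc]
      rw [act_comp_counitHom θ γ δ ι hι n' _ en a y x h₁ (lift (a ≫ snd K' X) y ≫ θ.hom)
        (by rw [hn'₀]; simp) h₄ s hs]
      rw [act_cartHom_comp Γ (fst K' X) n a _ rfl _ x h₄ h₃ s hs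
        (isHomLift_comp hs hη.toIsHomLift
          (show lift a x ≫ fst K' X ▷ Wb = lift (a ≫ fst K' X) x by ext <;> simp))]
      rw [act_n (a ≫ fst K' X) _ x h₃ _ _ s (by rw [ha]; exact hs) rfl (by rw [ha, hxZ, h₂])]
      congr 1
      exact act_congr _ _ rfl ha hxZ rfl
  · intro n₁ n₂ n₁' n₂' h₁ h₂ h₁' h₂' e₁ e₂ e
    have hn₁ : Hom.f₀ n₁ = f := isHomLift_proj_iff.1 h₁
    have hn₂ : Hom.f₀ n₂ = f := isHomLift_proj_iff.1 h₂
    have hn₁' : Hom.f₀ n₁' = f ▷ X := isHomLift_proj_iff.1 h₁'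
    have hn₂' : Hom.f₀ n₂' = f ▷ X := isHomLift_proj_iff.1 h₂'
    -- `nᵢ` is recovered from `nᵢ' ≫ ε` through the isomorphism `K × T ≅ (K × X) × Z`.
    have aux : ∀ (n : Γ ⟶ ⟨A, T, δ⟩) (n' : ⟨K' ⊗ X, Wb, c.pull (fst K' X ▷ Wb) η⟩ ⟶ weak X δ)
        (_ : Hom.f₀ n = f) (_ : Hom.f₀ n' = f ▷ X)
        (_ : n' ≫ cartHom ⟨A, T, δ⟩ (fst A X) = cartHom Γ (fst K' X) ≫ n),
        Hom.f₁ n = lift (lift (fst K' T) (snd K' T ≫ θ.inv ≫ fst X Z))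
          (snd K' T ≫ θ.inv ≫ snd X Z) ≫ Hom.f₁ (n' ≫ counitHom θ γ δ ι hι) ∧
        ∀ {L : B} (a : L ⟶ K') (t : L ⟶ T) (x : L ⟶ Wb) (hx : lift a t ≫ n.f₁ = x) {W : E}
        (s : W ⟶ (c.pull (fst K' X ▷ Wb) η).1)
        (hs : p.IsHomLift (lift (lift a (t ≫ θ.inv ≫ fst X Z)) x) s)
        (hs' : p.IsHomLift (lift a x) (s ≫ c.cart (fst K' X ▷ Wb) η))
        (hx' : lift (lift a (t ≫ θ.inv ≫ fst X Z)) (t ≫ θ.inv ≫ snd X Z) ≫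
          Hom.f₁ (n' ≫ counitHom θ γ δ ι hι) = x),
        act n a t x hx (s ≫ c.cart (fst K' X ▷ Wb) η) hs' =
          act (n' ≫ counitHom θ γ δ ι hι) (lift a (t ≫ θ.inv ≫ fst X Z))
            (t ≫ θ.inv ≫ snd X Z) x hx' s hs ≫ ι.hom := by
      intro n n' hn hn' en
      have hθ : ∀ {L : B} (t : L ⟶ T),
          lift (t ≫ θ.inv ≫ fst X Z) (t ≫ θ.inv ≫ snd X Z) ≫ θ.hom = t := by
        intro L t
        have : lift (t ≫ θ.inv ≫ fst X Z) (t ≫ θ.inv ≫ snd X Z) = t ≫ θ.inv := by ext <;> simp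
        rw [this]; simp
      constructor
      · rw [comp_counitHom_f₁ θ γ δ ι hι n' _ en, hn', cartHom_comp_f₁]
        change Hom.f₁ n = lift _ _ ≫ lift (fst (K' ⊗ X) Z) _ ≫
          lift (fst (K' ⊗ X) T ≫ fst K' X) (snd (K' ⊗ X) T) ≫ Hom.f₁ n
        rw [← Category.assoc, ← Category.assoc]
        refine (Category.id_comp _).symm.trans ?_
        congr 1
        change 𝟙 (K' ⊗ T) = _
        ext
        · simp
        · simp [comp_lift_assoc, hθ]
      · intro L a t x hx W s hs hs' hx'
        have h₄ : lift (lift a (t ≫ θ.inv ≫ fst X Z)) t ≫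
            Hom.f₁ (cartHom Γ (fst K' X) ≫ n) = x := by
          rw [cartHom_comp_f₁, ← hx]
          change _ ≫ lift (fst (K' ⊗ X) T ≫ fst K' X) (snd (K' ⊗ X) T) ≫ Hom.f₁ n = _
          rw [← Category.assoc]
          congr 1
          ext <;> simp
        rw [act_comp_counitHom θ γ δ ι hι n' _ en _ _ x hx' t (by rw [hn']; simp [hθ]) h₄ s hs,
          act_cartHom_comp Γ (fst K' X) n _ a (lift_fst _ _) t x h₄ hx s hs hs']
    obtain ⟨p₁, q₁⟩ := aux n₁ n₁' hn₁ hn₁' e₁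
    obtain ⟨p₂, q₂⟩ := aux n₂ n₂' hn₂ hn₂' e₂
    rw [← e] at p₂
    refine hom_ext (hn₁.trans hn₂.symm) (p₁.trans p₂.symm) ?_
    intro L (a : L ⟶ K') (t : L ⟶ T) (x : L ⟶ Wb) hF hG W s hs
    have hlx : lift (lift a (t ≫ θ.inv ≫ fst X Z)) x ≫ fst K' X ▷ Wb = lift a x := by
      ext <;> simp
    obtain ⟨s', hs', rfl⟩ : ∃ s' : W ⟶ (c.pull (fst K' X ▷ Wb) η).1,
        p.IsHomLift (lift (lift a (t ≫ θ.inv ≫ fst X Z)) x) s' ∧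
        s' ≫ c.cart (fst K' X ▷ Wb) η = s :=
      ⟨cartLift hη _ hlx s hs, cartLift_isHomLift .., cartLift_fac ..⟩
    have hx' : lift (lift a (t ≫ θ.inv ≫ fst X Z)) (t ≫ θ.inv ≫ snd X Z) ≫
          Hom.f₁ (n₁' ≫ counitHom θ γ δ ι hι) = x := by
      rw [← hF, p₁]
      refine Eq.trans ?_ (Category.assoc _ _ _)
      congr 1
      ext <;> simp
    rw [q₁ a t x hF s' hs' hs hx', q₂ a t x hG s' hs' hs (by rw [← e]; exact hx')]
    congr 1
    exact act_congr _ _ e rfl rfl rfl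

end Product

end ProdCompletion

namespace ProdCompletion

variable {B : Type u₁} [Category.{v₁} B] [CartesianMonoidalCategory B]
  {E : Type u₂} [Category.{v₂} E] {p : E ⥤ B} {c : SplitCleavage p}

/-! ### Quantifier-free objects of the completion -/

section Instances

variable {A X Z T : B} (θ : X ⊗ Z ≅ T) (γ : p.Fiber ((A ⊗ X) ⊗ Z)) (δ : p.Fiber (A ⊗ T))
  (ι : γ.1 ≅ δ.1)
  (hι : p.IsHomLift (lift (fst (A ⊗ X) Z ≫ fst A X)
    (lift (fst (A ⊗ X) Z ≫ snd A X) (snd (A ⊗ X) Z) ≫ θ.hom)) ι.hom)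

/-- Data `σ : P ⟶ b'` in the completion, with `b' ⟶ b` the chosen Cartesian arrow over `⟨1, g⟩`,
that presents the instance of the simple product `P` at `g`: its second component sends `(a, z)` to
`θ (g a, z)`, and it acts as the isomorphism between the underlying objects. -/
theorem inst_spec (g : A ⟶ X)
    (σ : (⟨A, T, δ⟩ : ProdCompletion c) ⟶ ⟨A, Z, c.pull (lift (𝟙 A) g ▷ Z) γ⟩)
    (hσ : σ ≫ cartHom ⟨A ⊗ X, Z, γ⟩ (lift (𝟙 A) g) =
      (isProdSpan_counitHom (c := c) θ γ δ ι hι).ev (𝟙 A) g (𝟙 _)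
        (isProdSpan_counitHom (c := c) θ γ δ ι hι).id_isHomLift) :
    σ.f₁ = lift (fst A Z ≫ g) (snd A Z) ≫ θ.hom ∧
    ∀ {L : B} (w : L ⟶ A) (z : L ⟶ Z) (t : L ⟶ T) (ht : lift w z ≫ σ.f₁ = t) {W : E}
      (r : W ⟶ δ.1) (hr : p.IsHomLift (lift w t) r),
      act σ w z t ht r hr ≫ c.cart (lift (𝟙 A) g ▷ Z) γ ≫ ι.hom = r := by
  let P : ProdCompletion c := ⟨A, T, δ⟩
  have hs := isProdSpan_counitHom (c := c) θ γ δ ι hι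
  let v : P ⟶ weak X δ := cartLift hs.cart (lift (𝟙 A) g) (lift_fst (𝟙 A) g) (𝟙 P) hs.id_isHomLift
  have hv : v ≫ cartHom P (fst A X) = 𝟙 P := cartLift_fac ..
  have hv₀ : Hom.f₀ v = lift (𝟙 A) g := isHomLift_proj_iff.1 (cartLift_isHomLift ..)
  have e : σ ≫ cartHom ⟨A ⊗ X, Z, γ⟩ (lift (𝟙 A) g) = v ≫ counitHom θ γ δ ι hι := hσ
  have eσ : σ.f₁ = Hom.f₁ (v ≫ counitHom θ γ δ ι hι) := by
    rw [← e]; exact (comp_cartHom_f₁ ⟨A ⊗ X, Z, γ⟩ (lift (𝟙 A) g) σ).symm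
  have hσ₁ : σ.f₁ = lift (fst A Z ≫ g) (snd A Z) ≫ θ.hom := by
    rw [eσ, comp_counitHom_f₁ θ γ δ ι hι v _ hv, hv₀]
    change lift (fst A Z) (lift (fst A Z ≫ lift (𝟙 A) g ≫ snd A X) (snd A Z) ≫ θ.hom) ≫ snd A T = _
    simp
  refine ⟨hσ₁, ?_⟩
  intro L w z t ht W r hr
  have ht' : lift (w ≫ g) z ≫ θ.hom = t := by
    rw [← ht, hσ₁]; simp [comp_lift_assoc]
  have h₁ := act_comp_cartHom ⟨A ⊗ X, Z, γ⟩ (lift (𝟙 A) g) σ w z t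
    (by rw [e, ← eσ, ht]) ht r hr
  have h₂ := act_comp_counitHom θ γ δ ι hι v (𝟙 P) hv w z t (by rw [← eσ, ht]) t
    (by rw [hv₀, lift_snd, ht']) (by rw [id_f₁]; exact lift_snd _ _) r hr
  rw [act_id] at h₂
  refine (Category.assoc _ _ _).symm.trans (Eq.trans ?_ h₂)
  rw [← h₁]
  congr 1
  exact act_congr _ _ e rfl rfl rfl

end Instances

section QF

variable {A X Z : B} (γ : p.Fiber ((A ⊗ X) ⊗ Z))

theorem assoc_inv_cart_isIso : IsIso (c.cart (α_ A X Z).inv γ) :=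
  have := c.cart_isStronglyCartesian (α_ A X Z).inv γ
  Functor.IsStronglyCartesian.isIso_of_base_isIso p (α_ A X Z).inv _

/-- Every object over `A × X` has a simple product along `X` in the completion. -/
theorem exists_product (c : SplitCleavage p) :
    ∃ (δ : p.Fiber (A ⊗ X ⊗ Z)) (ι : γ.1 ≅ δ.1),
      p.IsHomLift (lift (fst (A ⊗ X) Z ≫ fst A X)
        (lift (fst (A ⊗ X) Z ≫ snd A X) (snd (A ⊗ X) Z) ≫ (Iso.refl (X ⊗ Z)).hom)) ι.hom := by
  have hc := c.cart_isStronglyCartesian (α_ A X Z).inv γ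
  have := assoc_inv_cart_isIso (c := c) γ
  refine ⟨c.pull (α_ A X Z).inv γ, (asIso (c.cart (α_ A X Z).inv γ)).symm, ?_⟩
  have h : p.IsHomLift (α_ A X Z).symm.hom (asIso (c.cart (α_ A X Z).inv γ)).hom :=
    hc.toIsHomLift
  refine isHomLift_congr ?_ (IsHomLift.inv_lift_inv p (α_ A X Z).symm _)
  change (α_ A X Z).hom = _
  ext <;> simp

/-- The objects `(I, 1, α)` of the completion are quantifier-free: an arrow `∏ β ⟶ f^* α` has among
its data a witness for the quantified variable, and nothing else enters into a factorisation. -/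
theorem isQF_unit {I : B} (α : p.Fiber (I ⊗ 𝟙_ B)) : IsQF (proj c) (⟨I, 𝟙_ B, α⟩ : ProdCompletion c) := by
  intro A X V P b k ε hs J f h hh
  have hb : b.base = A ⊗ X := have := hs.vert; IsHomLift.codomain_eq (proj c) (𝟙 (A ⊗ X)) ε
  obtain ⟨b₀, Z, γ⟩ := b
  dsimp only at hb
  subst hb
  obtain rfl : I = J := IsHomLift.codomain_eq (proj c) f h
  obtain ⟨δ, ι, hι⟩ := exists_product γ c
  let θ := Iso.refl (X ⊗ Z)
  have hs₀ := isProdSpan_counitHom (c := c) θ γ δ ι hι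
  refine .of_span hs₀ hs h hh fun h hh => ?_
  have hf : Hom.f₀ h = f := isHomLift_proj_iff.1 hh
  let P : ProdCompletion c := ⟨A, X ⊗ Z, δ⟩
  let b : ProdCompletion c := ⟨A ⊗ X, Z, γ⟩
  let b' (g : A ⟶ X) : ProdCompletion c := ⟨A, Z, c.pull (lift (𝟙 A) g ▷ Z) γ⟩
  let cg (g : A ⟶ X) : b' g ⟶ b := cartHom b (lift (𝟙 A) g)
  have hcg (g : A ⟶ X) : (proj c).IsStronglyCartesian (lift (𝟙 A) g) (cg g) :=
    cartHom_isStronglyCartesian b (lift (𝟙 A) g)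
  have hcγ (g : A ⟶ X) := c.cart_isStronglyCartesian (lift (𝟙 A) g ▷ Z) γ
  have hι' : ∀ (g : A ⟶ X) {L : B} (w : L ⟶ A) (z : L ⟶ Z) {W : E}
      (r : W ⟶ (c.pull (lift (𝟙 A) g ▷ Z) γ).1) (_ : p.IsHomLift (lift w z) r),
      p.IsHomLift (lift w (lift (w ≫ g) z)) (r ≫ c.cart (lift (𝟙 A) g ▷ Z) γ ≫ ι.hom) := by
    intro g L w z W r hr
    refine isHomLift_comp hr (isHomLift_comp (hcγ g).toIsHomLift hι rfl) ?_
    ext <;> simp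
  -- What a factorisation through the instance at `g` says about the components of `h`.
  have key : ∀ (g : A ⟶ X) (h' : b' g ⟶ ⟨I, 𝟙_ B, α⟩) (σ : P ⟶ b' g) (_ : Hom.f₀ σ = 𝟙 A)
      (_ : σ ≫ cg g = hs₀.ev (𝟙 A) g (𝟙 P) hs₀.id_isHomLift) (_ : σ ≫ h' = h),
      Hom.f₁ h = lift (fst A (𝟙_ B) ≫ g) (Hom.f₁ h') ∧
      ∀ {L : B} (w : L ⟶ A) (y : L ⟶ 𝟙_ B) (z : L ⟶ Z) (hz : lift w y ≫ Hom.f₁ h' = z)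
        (hx : lift w y ≫ Hom.f₁ h = lift (w ≫ g) z) {W : E}
        (r : W ⟶ (c.pull (lift (𝟙 A) g ▷ Z) γ).1) (hr : p.IsHomLift (lift w z) r)
        (hr' : p.IsHomLift (lift w (lift (w ≫ g) z))
          (r ≫ c.cart (lift (𝟙 A) g ▷ Z) γ ≫ ι.hom)),
        act h' w y z hz r hr = act h w y (lift (w ≫ g) z) hx
          (r ≫ c.cart (lift (𝟙 A) g ▷ Z) γ ≫ ι.hom) hr' := by
    intro g h' σ hσ₀ e₁ e₂
    obtain ⟨hσ₁, hσ⟩ := inst_spec θ γ δ ι hι g σ e₁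
    constructor
    · rw [← e₂, comp_f₁, hσ₁, hσ₀]
      let z' : A ⊗ 𝟙_ B ⟶ Z := Hom.f₁ h'
      change lift (fst A (𝟙_ B)) (lift (fst A (𝟙_ B) ≫ 𝟙 A) (snd A (𝟙_ B)) ≫ z') ≫
        lift (fst A Z ≫ g) (snd A Z) ≫ 𝟙 (X ⊗ Z) = lift (fst A (𝟙_ B) ≫ g) z'
      simp [comp_lift]
    · intro L w y z hz hx W r hr hr'
      have ht : lift w z ≫ Hom.f₁ σ = lift (w ≫ g) z := by
        rw [hσ₁]
        change lift w z ≫ lift (fst A Z ≫ g) (snd A Z) ≫ 𝟙 (X ⊗ Z) = _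
        simp [comp_lift]
      have ea : w ≫ Hom.f₀ σ = w := by rw [hσ₀]; exact Category.comp_id w
      have er : act σ w z (lift (w ≫ g) z) ht _ hr' = r := by
        refine cart_ext (hcγ g) (lift w z) (act_isHomLift σ ea _ _ ht _ hr') hr ?_
        rw [← cancel_mono ι.hom, Category.assoc, Category.assoc]
        exact hσ w z _ ht _ hr'
      have := act_comp σ h' w y z (lift (w ≫ g) z) w ea hz ht (by rw [e₂]; exact hx) _ hr'
      refine (act_congr hz (by rw [er]; exact hr) rfl rfl rfl er.symm).trans (this.symm.trans ?_)
      exact act_congr _ _ e₂ rfl rfl rfl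
  have key₁ : ∀ (g : A ⟶ X) (h' : b' g ⟶ ⟨I, 𝟙_ B, α⟩),
      hs₀.FactorsAt (𝟙 A) (𝟙 P) hs₀.id_isHomLift f h g (cg g) h' →
      g = lift (𝟙 A) (toUnit A) ≫ Hom.f₁ h ≫ fst X Z ∧ Hom.f₁ h' = Hom.f₁ h ≫ snd X Z := by
    rintro g h' ⟨-, -, σ, hσ, e₁, e₂⟩
    obtain ⟨H, -⟩ := key g h' σ (isHomLift_proj_iff.1 hσ) e₁ e₂
    let z' : A ⊗ 𝟙_ B ⟶ Z := Hom.f₁ h'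
    rw [H]
    constructor
    · change g = lift (𝟙 A) (toUnit A) ≫ lift (fst A (𝟙_ B) ≫ g) z' ≫ fst X Z
      simp
    · exact (lift_snd (fst A (𝟙_ B) ≫ g) z').symm
  refine .of_chosen hs₀ _ b' cg hcg ?_ ?_ ?_
  · let g : A ⟶ X := lift (𝟙 A) (toUnit A) ≫ Hom.f₁ h ≫ fst X Z
    let z₁ : A ⊗ 𝟙_ B ⟶ Z := Hom.f₁ h ≫ snd X Z
    have hg : fst A (𝟙_ B) ≫ g = Hom.f₁ h ≫ fst X Z := by
      have : fst A (𝟙_ B) ≫ lift (𝟙 A) (toUnit A) = 𝟙 _ := by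
        ext; simp
      change fst A (𝟙_ B) ≫ lift (𝟙 A) (toUnit A) ≫ Hom.f₁ h ≫ fst X Z = _
      rw [← Category.assoc, this, Category.id_comp]
    have hh₁ : Hom.f₁ h = lift (fst A (𝟙_ B) ≫ g) z₁ := by
      rw [hg]; exact (by ext <;> simp [z₁])
    have hc₀ := c.cart_isStronglyCartesian (lift (fst A (𝟙_ B)) z₁)
      (c.pull (lift (𝟙 A) g ▷ Z) γ)
    let τ := act h (fst A (𝟙_ B)) (snd A (𝟙_ B)) (lift (fst A (𝟙_ B) ≫ g) z₁)
      (by rw [← hh₁]; exact (by simp)) _ (hι' g _ _ _ hc₀.toIsHomLift)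
    have hτ : p.IsHomLift (lift (fst A (𝟙_ B) ≫ f) (snd A (𝟙_ B))) τ :=
      act_isHomLift h (by rw [hf]) ..
    let h' : b' g ⟶ ⟨I, 𝟙_ B, α⟩ := mkHom (P := b' g) (Q := ⟨I, 𝟙_ B, α⟩) f z₁ τ hτ
    let σ : P ⟶ b' g := cartLift (hcg g) (𝟙 A) (Category.id_comp _) _
      (hs₀.ev_isHomLift (𝟙 A) g (𝟙 P) hs₀.id_isHomLift)
    have hσl := cartLift_isHomLift (hcg g) (𝟙 A) (Category.id_comp _) _
      (hs₀.ev_isHomLift (𝟙 A) g (𝟙 P) hs₀.id_isHomLift)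
    have hσ₀ : Hom.f₀ σ = 𝟙 A := isHomLift_proj_iff.1 hσl
    have e₁ : σ ≫ cg g = hs₀.ev (𝟙 A) g (𝟙 P) hs₀.id_isHomLift := cartLift_fac ..
    obtain ⟨hσ₁, hσ⟩ := inst_spec θ γ δ ι hι g σ e₁
    have e₁' : Hom.f₁ (σ ≫ h') = Hom.f₁ h := by
      rw [comp_f₁, hσ₁, hσ₀, hh₁]
      change lift (fst A (𝟙_ B)) (lift (fst A (𝟙_ B) ≫ 𝟙 A) (snd A (𝟙_ B)) ≫ z₁) ≫
        lift (fst A Z ≫ g) (snd A Z) ≫ 𝟙 (X ⊗ Z) = _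
      simp [comp_lift]
    refine ⟨g, h', hcg g, isHomLift_proj_iff.2 rfl, σ, hσl, e₁, ?_⟩
    refine hom_ext ?_ e₁' ?_
    · rw [comp_f₀, hσ₀, hf]; exact Category.id_comp f
    · intro L (w : L ⟶ A) (y : L ⟶ 𝟙_ B) (x : L ⟶ X ⊗ Z) h₁ h₂ W r hr
      have hx : lift w y ≫ lift (fst A (𝟙_ B) ≫ g) z₁ = x := by rw [← hh₁]; exact h₂
      have hxz : lift (w ≫ g) (lift w y ≫ z₁) = x := by rw [← hx]; simp [comp_lift]
      have ht : lift w (lift w y ≫ z₁) ≫ Hom.f₁ σ = x := by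
        rw [hσ₁, ← hxz]
        change _ ≫ lift (fst A Z ≫ g) (snd A Z) ≫ 𝟙 (X ⊗ Z) = _
        simp [comp_lift]
      have ea : w ≫ Hom.f₀ σ = w := by rw [hσ₀]; exact Category.comp_id w
      have k₁ := act_comp σ h' w y (lift w y ≫ z₁) x w ea rfl ht h₁ r hr
      have hr₁ := act_isHomLift σ ea _ _ ht r hr
      have k₂ := hσ w _ x ht r hr
      rw [k₁]
      refine (act_mkHom (P := b' g) (Q := ⟨I, 𝟙_ B, α⟩) f z₁ τ hτ w y _ rfl _ hr₁).trans ?_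
      have hl := cartLift_isHomLift hc₀ (lift w y) (by simp) _ hr₁
      have hl' := cartLift_fac_assoc hc₀ (lift w y) (by simp) _ hr₁
        (c.cart (lift (𝟙 A) g ▷ Z) γ ≫ ι.hom)
      rw [k₂] at hl'
      refine (comp_act h _ h₂ (lift_fst _ _) (lift_snd _ _) _ hl _ _ ?_).symm.trans ?_
      · rw [hl']; exact hr
      · exact act_congr _ _ rfl rfl rfl hl'
  · intro g₁ g₂ h₁ h₂ F₁ F₂
    rw [(key₁ g₁ h₁ F₁).1, (key₁ g₂ h₂ F₂).1]
  · intro g h₁ h₂ F₁ F₂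
    have d₁ := (key₁ g h₁ F₁).2
    have d₂ := (key₁ g h₂ F₂).2
    obtain ⟨-, l₁, σ₁, hσ₁, e₁, e₁'⟩ := F₁
    obtain ⟨-, l₂, σ₂, hσ₂, e₂, e₂'⟩ := F₂
    obtain ⟨q₁, k₁⟩ := key g h₁ σ₁ (isHomLift_proj_iff.1 hσ₁) e₁ e₁'
    obtain ⟨-, k₂⟩ := key g h₂ σ₂ (isHomLift_proj_iff.1 hσ₂) e₂ e₂'
    refine hom_ext ((isHomLift_proj_iff.1 l₁).trans (isHomLift_proj_iff.1 l₂).symm)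
      (d₁.trans d₂.symm) ?_
    intro L (w : L ⟶ A) (y : L ⟶ 𝟙_ B) (z : L ⟶ Z) m₁ m₂ W r hr
    have hx : lift w y ≫ Hom.f₁ h = lift (w ≫ g) z := by
      rw [q₁, ← m₁]
      exact (by simp [comp_lift])
    have hr' : p.IsHomLift (lift w (lift (w ≫ g) z))
        (r ≫ c.cart (lift (𝟙 A) g ▷ Z) γ ≫ ι.hom) := hι' g w z r hr
    rw [k₁ w y z m₁ hx r hr hr', k₂ w y z m₂ hx r hr hr']

end QF

/-- The completion has enough quantifier-free objects: `(I, T, δ)` is the simple product along `T`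
of `(I × T, 1, δ)`. -/
theorem hasEnoughQF_proj (c : SplitCleavage p) : HasEnoughQF (proj c) := by
  rintro ⟨I, T, δ⟩
  let e : (I ⊗ T) ⊗ 𝟙_ B ≅ I ⊗ T := ρ_ (I ⊗ T)
  have hc := c.cart_isStronglyCartesian e.hom δ
  have : IsIso (c.cart e.hom δ) := Functor.IsStronglyCartesian.isIso_of_base_isIso p e.hom _
  exact ⟨T, _, _, _, _, isProdSpan_counitHom (c := c) (ρ_ T) (c.pull e.hom δ) δ
    (asIso (c.cart e.hom δ)) (isHomLift_congr (by ext <;> simp [e, rightUnitor_hom]) hc.toIsHomLift),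
    isQF_unit _⟩

end ProdCompletion

/-! ### Invariance under fibred equivalence -/

section Transport

variable {B : Type u₁} [Category.{v₁} B] {E : Type u₂} [Category.{v₂} E]
  {D : Type u₃} [Category.{v₃} D]

/-- Every object of `D` is isomorphic, through a `q`-vertical isomorphism, to one in the image of
`F`. For fully faithful `F` this makes `F` an equivalence of categories over the base. -/
def VertEssSurj (F : E ⥤ D) (q : D ⥤ B) : Prop :=
  ∀ Y : D, ∃ (X : E) (i : F.obj X ≅ Y), q.IsHomLift (𝟙 (q.obj Y)) i.hom

theorem VertEssSurj.exists_iso {F : E ⥤ D} {q : D ⥤ B} (hF : VertEssSurj F q) {I : B} {Y : D}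
    (h : q.obj Y = I) : ∃ (X : E) (i : F.obj X ≅ Y), q.IsHomLift (𝟙 I) i.hom := by
  subst h; exact hF Y

theorem isHomLift_comp_iff {F : E ⥤ D} {q : D ⥤ B} {I J : B} {u : I ⟶ J} {X Y : E} {φ : X ⟶ Y} :
    (F ⋙ q).IsHomLift u φ ↔ q.IsHomLift u (F.map φ) := by
  constructor
  · intro h
    obtain rfl := IsHomLift.domain_eq (F ⋙ q) u φ
    obtain rfl := IsHomLift.codomain_eq (F ⋙ q) u φ
    obtain rfl := IsHomLift.eq_of_isHomLift (F ⋙ q) u φ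
    exact IsHomLift.map q (F.map φ)
  · intro h
    obtain rfl : q.obj (F.obj X) = I := IsHomLift.domain_eq q u (F.map φ)
    obtain rfl : q.obj (F.obj Y) = J := IsHomLift.codomain_eq q u (F.map φ)
    obtain rfl := IsHomLift.eq_of_isHomLift q u (F.map φ)
    exact IsHomLift.map (F ⋙ q) φ

variable {F : E ⥤ D} {q : D ⥤ B} [F.Full] [F.Faithful]

omit [F.Faithful] in
theorem isHomLift_preimage {I J : B} {u : I ⟶ J} {X Y : E} {φ : F.obj X ⟶ F.obj Y}
    (h : q.IsHomLift u φ) : (F ⋙ q).IsHomLift u (F.preimage φ) :=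
  isHomLift_comp_iff.2 (by rwa [F.map_preimage])

theorem isStronglyCartesian_of_map {I J : B} {u : I ⟶ J} {X Y : E} {φ : X ⟶ Y}
    (h : q.IsStronglyCartesian u (F.map φ)) : (F ⋙ q).IsStronglyCartesian u φ where
  toIsHomLift := isHomLift_comp_iff.2 h.toIsHomLift
  universal_property' := by
    intro W w s hs
    have hs' := isHomLift_comp_iff.1 hs
    refine ⟨F.preimage (cartLift h w rfl _ hs'), ⟨isHomLift_preimage (cartLift_isHomLift ..),
      F.map_injective ?_⟩, ?_⟩
    · rw [F.map_comp, F.map_preimage, cartLift_fac]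
    · rintro t ⟨ht, rfl⟩
      refine F.map_injective (cart_ext h w (isHomLift_comp_iff.1 ht) ?_ ?_)
      · rw [F.map_preimage]; exact cartLift_isHomLift ..
      · rw [F.map_preimage, cartLift_fac, F.map_comp]

theorem isStronglyCartesian_map (hF : VertEssSurj F q) {I J : B} {u : I ⟶ J} {X Y : E} {φ : X ⟶ Y}
    (h : (F ⋙ q).IsStronglyCartesian u φ) : q.IsStronglyCartesian u (F.map φ) where
  toIsHomLift := isHomLift_comp_iff.1 h.toIsHomLift
  universal_property' := by
    intro W w s hs
    obtain ⟨W₀, i, hi⟩ := hF W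
    have hi' := isHomLift_iso_inv i hi
    have hs' := isHomLift_preimage (F := F) (isHomLift_id_comp hi hs)
    have hl := isHomLift_comp_iff.1 (cartLift_isHomLift h w rfl _ hs')
    refine ⟨i.inv ≫ F.map (cartLift h w rfl _ hs'), ⟨isHomLift_id_comp hi' hl, ?_⟩, ?_⟩
    · rw [Category.assoc, ← F.map_comp, cartLift_fac, F.map_preimage, Iso.inv_hom_id_assoc]
    · rintro t ⟨ht, rfl⟩
      rw [Iso.eq_inv_comp, ← F.map_preimage (i.hom ≫ t)]
      congr 1
      refine cart_ext h w (isHomLift_preimage (isHomLift_id_comp hi ht))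
        (cartLift_isHomLift ..) (F.map_injective ?_)
      rw [cartLift_fac, F.map_comp, F.map_preimage, F.map_preimage, Category.assoc]

section Equivalence

variable (hF : VertEssSurj F q)

/-- The inverse over the base of a fully faithful, vertically essentially surjective functor. -/
def VertEssSurj.inverse : D ⥤ E where
  obj Y := (hF Y).choose
  map {Y Z} g := F.preimage
    ((hF Y).choose_spec.choose.hom ≫ g ≫ (hF Z).choose_spec.choose.inv)
  map_id Y := F.map_injective (by simp)
  map_comp g h := F.map_injective (by simp)

/-- The vertical isomorphism between `Y` and the image of the object chosen over it. -/
def VertEssSurj.iso (Y : D) : F.obj (hF.inverse.obj Y) ≅ Y := (hF Y).choose_spec.choose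

theorem VertEssSurj.iso_isHomLift (Y : D) : q.IsHomLift (𝟙 (q.obj Y)) (hF.iso Y).hom :=
  (hF Y).choose_spec.choose_spec

theorem VertEssSurj.map_inverse {Y Z : D} (g : Y ⟶ Z) :
    F.map (hF.inverse.map g) = (hF.iso Y).hom ≫ g ≫ (hF.iso Z).inv :=
  F.map_preimage _

theorem VertEssSurj.inverse_comp : hF.inverse ⋙ F ⋙ q = q := by
  have hi := hF.iso_isHomLift
  refine CategoryTheory.Functor.ext (fun Y => by
    exact IsHomLift.domain_eq q (𝟙 (q.obj Y)) (hF.iso Y).hom) ?_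
  intro Y Z g
  have h : q.IsHomLift (q.map g) (F.map (hF.inverse.map g)) := by
    rw [hF.map_inverse]
    exact isHomLift_id_comp (hi Y) (isHomLift_comp_id (IsHomLift.map q g)
      (isHomLift_iso_inv _ (hi Z)))
  exact IsHomLift.fac' q (q.map g) (F.map (hF.inverse.map g))

theorem VertEssSurj.inverse_cartesian {I J : B} (u : I ⟶ J) {X Y : D} (φ : X ⟶ Y)
    (h : q.IsStronglyCartesian u φ) : (F ⋙ q).IsStronglyCartesian u (hF.inverse.map φ) := by
  refine isStronglyCartesian_of_map ?_
  obtain rfl : q.obj X = I := have := h.toIsHomLift; IsHomLift.domain_eq q u φ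
  obtain rfl : q.obj Y = J := have := h.toIsHomLift; IsHomLift.codomain_eq q u φ
  rw [hF.map_inverse]
  exact isStronglyCartesian_iso_comp _ (hF.iso_isHomLift X) (isStronglyCartesian_comp_iso
    (hF.iso Y).symm (isHomLift_iso_inv _ (hF.iso_isHomLift Y)) h)

/-- A fully faithful, vertically essentially surjective functor over the base is an equivalence of
fibrations. -/
def VertEssSurj.fibredEquivalence : FibredEquivalence (F ⋙ q) q where
  functor := F
  inverse := hF.inverse
  functor_comp := rfl
  inverse_comp := hF.inverse_comp
  functor_cartesian _ _ _ _ := isStronglyCartesian_map hF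
  inverse_cartesian u _ _ φ h := hF.inverse_cartesian u φ h
  unitIso := NatIso.ofComponents (fun X => F.preimageIso (hF.iso (F.obj X)).symm)
    (by
      intro X Y f
      apply F.map_injective
      change F.map (f ≫ F.preimage (hF.iso (F.obj Y)).inv) =
        F.map (F.preimage (hF.iso (F.obj X)).inv ≫ hF.inverse.map (F.map f))
      simp [hF.map_inverse])
  counitIso := NatIso.ofComponents hF.iso (by
    intro X Y f
    change F.map (hF.inverse.map f) ≫ (hF.iso Y).hom = (hF.iso X).hom ≫ f
    simp [hF.map_inverse])
  unit_vertical X := by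
    have h := isHomLift_iso_inv _ (hF.iso_isHomLift (F.obj X))
    exact isHomLift_preimage (F := F) h
  counit_vertical Y := hF.iso_isHomLift Y

end Equivalence

variable [CartesianMonoidalCategory B]

theorem IsProdSpan.of_map {I X : B} {V P b : E} {k : V ⟶ P} {ε : V ⟶ b} (hF : VertEssSurj F q)
    (h : IsProdSpan q I X (F.map k) (F.map ε)) : IsProdSpan (F ⋙ q) I X k ε where
  cart := isStronglyCartesian_of_map h.cart
  vert := isHomLift_comp_iff.2 h.vert
  exists_transpose {K} f {Γ Γ'} k' hk' m hm := by
    obtain ⟨n, n', hn, hn', e₁, e₂⟩ := h.exists_transpose f (F.map k')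
      (isStronglyCartesian_map hF hk') (F.map m) (isHomLift_comp_iff.1 hm)
    refine ⟨F.preimage n, F.preimage n', isHomLift_preimage hn, isHomLift_preimage hn',
      F.map_injective ?_, F.map_injective ?_⟩ <;> simpa
  transpose_unique {K} f {Γ Γ'} k' hk' n₁ n₂ n₁' n₂' h₁ h₂ h₁' h₂' e₁ e₂ e := by
    refine F.map_injective (h.transpose_unique f (F.map k') (isStronglyCartesian_map hF hk') _ _
      (F.map n₁') (F.map n₂') (isHomLift_comp_iff.1 h₁) (isHomLift_comp_iff.1 h₂)
      (isHomLift_comp_iff.1 h₁') (isHomLift_comp_iff.1 h₂') ?_ ?_ ?_)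
    · rw [← F.map_comp, e₁, F.map_comp]
    · rw [← F.map_comp, e₂, F.map_comp]
    · rw [← F.map_comp, e, F.map_comp]

theorem IsProdSpan.map {I X : B} {V P b : E} {k : V ⟶ P} {ε : V ⟶ b} (hF : VertEssSurj F q)
    (h : IsProdSpan (F ⋙ q) I X k ε) : IsProdSpan q I X (F.map k) (F.map ε) where
  cart := isStronglyCartesian_map hF h.cart
  vert := isHomLift_comp_iff.1 h.vert
  exists_transpose {K} f {Γ Γ'} k' hk' m hm := by
    obtain ⟨Γ₀, i, hi⟩ := hF.exists_iso (IsHomLift.codomain_eq q (fst K X) k')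
    obtain ⟨Γ₀', i', hi'⟩ := hF.exists_iso (IsHomLift.domain_eq q (fst K X) k')
    have hj := isHomLift_iso_inv i hi
    have hj' := isHomLift_iso_inv i' hi'
    have hk₀ : (F ⋙ q).IsStronglyCartesian (fst K X) (F.preimage (i'.hom ≫ k' ≫ i.inv)) := by
      refine isStronglyCartesian_of_map ?_
      rw [F.map_preimage]
      exact isStronglyCartesian_iso_comp i' hi' (isStronglyCartesian_comp_iso i.symm hj hk')
    obtain ⟨n, n', hn, hn', e₁, e₂⟩ := h.exists_transpose f _ hk₀ (F.preimage (i'.hom ≫ m))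
      (isHomLift_preimage (isHomLift_id_comp hi' hm))
    refine ⟨i.inv ≫ F.map n, i'.inv ≫ F.map n', isHomLift_id_comp hj (isHomLift_comp_iff.1 hn),
      isHomLift_id_comp hj' (isHomLift_comp_iff.1 hn'), ?_, ?_⟩
    · rw [Category.assoc, ← F.map_comp, e₁]; simp
    · rw [Category.assoc, ← F.map_comp, e₂]; simp
  transpose_unique {K} f {Γ Γ'} k' hk' n₁ n₂ n₁' n₂' h₁ h₂ h₁' h₂' e₁ e₂ e := by
    obtain ⟨Γ₀, i, hi⟩ := hF.exists_iso (IsHomLift.codomain_eq q (fst K X) k')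
    obtain ⟨Γ₀', i', hi'⟩ := hF.exists_iso (IsHomLift.domain_eq q (fst K X) k')
    have hj := isHomLift_iso_inv i hi
    have hk₀ : (F ⋙ q).IsStronglyCartesian (fst K X) (F.preimage (i'.hom ≫ k' ≫ i.inv)) := by
      refine isStronglyCartesian_of_map ?_
      rw [F.map_preimage]
      exact isStronglyCartesian_iso_comp i' hi' (isStronglyCartesian_comp_iso i.symm hj hk')
    have key := h.transpose_unique f _ hk₀ (F.preimage (i.hom ≫ n₁)) (F.preimage (i.hom ≫ n₂))
      (F.preimage (i'.hom ≫ n₁')) (F.preimage (i'.hom ≫ n₂'))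
      (isHomLift_preimage (isHomLift_id_comp hi h₁)) (isHomLift_preimage (isHomLift_id_comp hi h₂))
      (isHomLift_preimage (isHomLift_id_comp hi' h₁'))
      (isHomLift_preimage (isHomLift_id_comp hi' h₂')) (F.map_injective (by simp [e₁]))
      (F.map_injective (by simp [e₂])) (F.map_injective (by simp [e]))
    have := congrArg F.map key
    rw [F.map_preimage, F.map_preimage] at this
    exact (cancel_epi i.hom).1 this

/-- Quantifier-freeness is preserved by equivalences over the base: a factorisation problem in `D`
is carried to one in `E`. -/
theorem IsQF.map (hF : VertEssSurj F q) {a : E} (ha : IsQF (F ⋙ q) a) : IsQF q (F.obj a) := by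
  intro A X V P b k ε hs J f h hh
  have := hs.vert
  have := hs.cart
  obtain ⟨V₀, eV, hV⟩ := hF.exists_iso (IsHomLift.domain_eq q (𝟙 (A ⊗ X)) ε)
  obtain ⟨b₀, eb, hb⟩ := hF.exists_iso (IsHomLift.codomain_eq q (𝟙 (A ⊗ X)) ε)
  obtain ⟨P₀, eP, hP⟩ := hF.exists_iso (IsHomLift.codomain_eq q (fst A X) k)
  have hV' := isHomLift_iso_inv eV hV
  have hb' := isHomLift_iso_inv eb hb
  have hP' := isHomLift_iso_inv eP hP
  obtain ⟨k₀, hk₀⟩ := F.map_surjective (eV.hom ≫ k ≫ eP.inv)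
  obtain ⟨ε₀, hε₀⟩ := F.map_surjective (eV.hom ≫ ε ≫ eb.inv)
  have hs₀ : IsProdSpan (F ⋙ q) A X k₀ ε₀ :=
    .of_map hF (hs.of_iso eV.symm eP.symm eb.symm hV' hP' hb' (by simp [hk₀]) (by simp [hε₀]))
  obtain ⟨h₀, eh₀⟩ := F.map_surjective (eP.hom ≫ h)
  have ev_eq : ∀ g : A ⟶ X, F.map (hs₀.ev (𝟙 A) g (𝟙 P₀) hs₀.id_isHomLift) ≫ eb.hom =
      eP.hom ≫ hs.ev (𝟙 A) g (𝟙 P) hs.id_isHomLift := by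
    intro g
    have hl := cartLift_isHomLift hs₀.cart _ (lift_fst (𝟙 A) g) (𝟙 P₀) hs₀.id_isHomLift
    have hl' := cartLift_fac hs₀.cart _ (lift_fst (𝟙 A) g) (𝟙 P₀) hs₀.id_isHomLift
    rw [← hs.comp_ev (Category.id_comp _) (Category.id_comp g) eP.hom hP (𝟙 P) _
      (by rwa [Category.comp_id]), hs.ev_eq _ _ _ _ (F.map (cartLift hs₀.cart _
        (lift_fst (𝟙 A) g) (𝟙 P₀) hs₀.id_isHomLift) ≫ eV.hom)
      (isHomLift_comp_id (isHomLift_comp_iff.1 hl) hV)]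
    · simp [IsProdSpan.ev, hε₀]
    · have e : eV.hom ≫ k = F.map k₀ ≫ eP.hom := by simp [hk₀]
      rw [Category.assoc, e, ← Category.assoc, ← F.map_comp, hl']
      simp
  -- Factorisations of `h` correspond to factorisations of `h₀`.
  have key : ∀ (g : A ⟶ X) {b' : D} (c : b' ⟶ b) (h' : b' ⟶ F.obj a) {b₁ : E} (i : F.obj b₁ ≅ b')
      (_ : q.IsHomLift (𝟙 A) i.hom) (c₁ : b₁ ⟶ b₀) (_ : F.map c₁ = i.hom ≫ c ≫ eb.inv)
      (h₁ : b₁ ⟶ a) (_ : F.map h₁ = i.hom ≫ h'),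
      hs.FactorsAt (𝟙 A) (𝟙 P) hs.id_isHomLift f h g c h' ↔
        hs₀.FactorsAt (𝟙 A) (𝟙 P₀) hs₀.id_isHomLift f h₀ g c₁ h₁ := by
    intro g b' c h' b₁ i hi c₁ hc₁ h₁ hh₁
    have hi' := isHomLift_iso_inv i hi
    have ec : c = i.inv ≫ F.map c₁ ≫ eb.hom := by simp [hc₁]
    have eh : h' = i.inv ≫ F.map h₁ := by simp [hh₁]
    constructor
    · rintro ⟨hc, hh', σ, hσ, e₁, e₂⟩
      refine ⟨isStronglyCartesian_of_map ?_, isHomLift_comp_iff.2 ?_,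
        F.preimage (eP.hom ≫ σ ≫ i.inv),
        isHomLift_preimage (isHomLift_id_comp hP (isHomLift_comp_id hσ hi')),
        F.map_injective ?_, F.map_injective ?_⟩
      · rw [hc₁]
        exact isStronglyCartesian_iso_comp i hi (isStronglyCartesian_comp_iso eb.symm hb' hc)
      · rw [hh₁]
        exact isHomLift_id_comp hi hh'
      · rw [← cancel_mono eb.hom, ev_eq, ← e₁]
        simp [hc₁]
      · rw [eh₀, ← e₂]
        simp [hh₁]
    · rintro ⟨hc, hh', σ, hσ, e₁, e₂⟩
      refine ⟨?_, ?_, eP.inv ≫ F.map σ ≫ i.hom,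
        isHomLift_id_comp hP' (isHomLift_comp_id (isHomLift_comp_iff.1 hσ) hi), ?_, ?_⟩
      · rw [ec]
        exact isStronglyCartesian_iso_comp i.symm hi'
          (isStronglyCartesian_comp_iso eb hb (isStronglyCartesian_map hF hc))
      · rw [eh]
        exact isHomLift_id_comp hi' (isHomLift_comp_iff.1 hh')
      · rw [ec, ← cancel_epi eP.hom, ← ev_eq, ← e₁]
        simp
      · rw [eh, ← cancel_epi eP.hom, ← eh₀, ← e₂]
        simp
  obtain ⟨⟨g, H₀⟩, H₁, H₂⟩ := ha k₀ ε₀ hs₀ f h₀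
    (isHomLift_comp_iff.2 (by rw [eh₀]; exact isHomLift_id_comp hP hh))
  -- The data of a reindexed object in `D`, carried to `E`.
  have aux : ∀ (g : A ⟶ X) {b' : D} (c : b' ⟶ b), q.IsStronglyCartesian (lift (𝟙 A) g) c →
      ∃ (b₁ : E) (i : F.obj b₁ ≅ b') (c₁ : b₁ ⟶ b₀), q.IsHomLift (𝟙 A) i.hom ∧
        F.map c₁ = i.hom ≫ c ≫ eb.inv := by
    intro g b' c hc
    obtain ⟨b₁, i, hi⟩ := hF.exists_iso (IsHomLift.domain_eq q (lift (𝟙 A) g) c)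
    exact ⟨b₁, i, F.preimage (i.hom ≫ c ≫ eb.inv), hi, F.map_preimage _⟩
  refine ⟨⟨g, fun b' c hc => ?_⟩, ?_, ?_⟩
  · obtain ⟨b₁, i, c₁, hi, hc₁⟩ := aux g c hc
    obtain ⟨h₁, F₁⟩ := H₀ b₁ c₁ (isStronglyCartesian_of_map (by
      rw [hc₁]
      exact isStronglyCartesian_iso_comp i hi (isStronglyCartesian_comp_iso eb.symm hb' hc)))
    exact ⟨i.inv ≫ F.map h₁, (key g c _ i hi c₁ hc₁ h₁ (by simp)).2 F₁⟩
  · intro g₁ g₂ b₁ b₂ c₁ c₂ h₁ h₂ F₁ F₂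
    obtain ⟨_, i₁, d₁, hi₁, hd₁⟩ := aux g₁ c₁ F₁.cart
    obtain ⟨_, i₂, d₂, hi₂, hd₂⟩ := aux g₂ c₂ F₂.cart
    exact H₁ _ _ _ _ _ _ _ _
      ((key g₁ c₁ h₁ i₁ hi₁ d₁ hd₁ (F.preimage (i₁.hom ≫ h₁)) (F.map_preimage _)).1 F₁)
      ((key g₂ c₂ h₂ i₂ hi₂ d₂ hd₂ (F.preimage (i₂.hom ≫ h₂)) (F.map_preimage _)).1 F₂)
  · intro g b' c h₁ h₂ F₁ F₂
    obtain ⟨_, i, d, hi, hd⟩ := aux g c F₁.cart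
    have e := congrArg F.map (H₂ _ _ _ _ _
      ((key g c h₁ i hi d hd (F.preimage (i.hom ≫ h₁)) (F.map_preimage _)).1 F₁)
      ((key g c h₂ i hi d hd (F.preimage (i.hom ≫ h₂)) (F.map_preimage _)).1 F₂))
    rw [F.map_preimage, F.map_preimage] at e
    exact (cancel_epi i.hom).1 e

theorem HasEnoughQF.map (hF : VertEssSurj F q) (H : HasEnoughQF (F ⋙ q)) : HasEnoughQF q := by
  intro P
  obtain ⟨P₀, i, hi⟩ := hF P
  have e : q.obj (F.obj P₀) = q.obj P := IsHomLift.domain_eq q (𝟙 (q.obj P)) i.hom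
  rw [← e] at hi ⊢
  obtain ⟨X, V, b, k, ε, hs, hb⟩ := H P₀
  have hs' := hs.map hF
  have := hs'.vert
  exact ⟨X, _, _, _, _, hs'.of_iso (Iso.refl _) i (Iso.refl _)
    (isHomLift_id (IsHomLift.domain_eq q (𝟙 _) (F.map ε))) hi
    (isHomLift_id (IsHomLift.codomain_eq q (𝟙 _) (F.map ε))) (Category.id_comp _)
    ((Category.id_comp _).trans (Category.comp_id _).symm), hb.map hF⟩

omit [F.Full] [F.Faithful] in
theorem HasEnoughQF.of_fibredEquivalence {p : E ⥤ B} (e : FibredEquivalence p q)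
    (H : HasEnoughQF p) : HasEnoughQF q := by
  obtain ⟨F, G, rfl, -, -, -, η, ε, -, hε⟩ := e
  have : F.IsEquivalence := (CategoryTheory.Equivalence.mk F G η ε).isEquivalence_functor
  exact H.map (F := F) fun Y => ⟨G.obj Y, ε.app Y, hε Y⟩

end Transport

/-! ### Interpreting the completion by simple products -/

section Lifts

variable {B : Type u₁} [Category.{v₁} B] {E : Type u₂} [Category.{v₂} E] {p : E ⥤ B}

theorem exists_isHomLift {I J : B} {X Y : E} (hX : p.obj X = I) (hY : p.obj Y = J) (φ : X ⟶ Y) :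
    ∃ f : I ⟶ J, p.IsHomLift f φ := by
  subst hX hY
  exact ⟨_, IsHomLift.map p φ⟩

theorem isHomLift_unique {I J : B} {X Y : E} {φ : X ⟶ Y} {f g : I ⟶ J} (hf : p.IsHomLift f φ)
    (hg : p.IsHomLift g φ) : f = g := by
  obtain rfl := IsHomLift.domain_eq p f φ
  obtain rfl := IsHomLift.codomain_eq p f φ
  exact (IsHomLift.eq_of_isHomLift p f φ).trans (IsHomLift.eq_of_isHomLift p g φ).symm

end Lifts

namespace ProdCompletion

variable {B : Type u₁} [Category.{v₁} B] [CartesianMonoidalCategory B]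
  {E : Type u₂} [Category.{v₂} E] {p : E ⥤ B} {c : SplitCleavage p} (S : SimpleProducts c)

/-- The simple product `∏ α` in `E` denoted by the formal product `(I, X, α)`. -/
abbrev evalObj (P : ProdCompletion c) : p.Fiber P.base := (S.prodFunctor P.base P.bound).obj P.form

theorem evalObj_span (P : ProdCompletion c) :
    IsProdSpan p P.base P.bound (c.cart (fst P.base P.bound) (evalObj S P))
      ((S.adj P.base P.bound).counit.app P.form).1 :=
  S.isProdSpan P.form

/-- The arrow `∏ α ⟶ ∏ β` denoted by `F : (I, X, α) ⟶ (J, Y, β)`: its instance at `y` is obtained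
by letting `F` act on the instance at `f₁(a, y)`. -/
theorem exists_evalMap {P Q : ProdCompletion c} (F : P ⟶ Q) :
    ∃ (m : (evalObj S P).1 ⟶ (evalObj S Q).1) (_ : p.IsHomLift F.f₀ m),
      ∀ {K : B} (a : K ⟶ P.base) {a' : K ⟶ Q.base} (_ : a ≫ F.f₀ = a') (y : K ⟶ Q.bound)
        (x : K ⟶ P.bound) (hx : lift a y ≫ F.f₁ = x) {W : E} (s : W ⟶ (evalObj S P).1)
        (hs : p.IsHomLift a s) (hsm : p.IsHomLift a' (s ≫ m)),
        (evalObj_span S Q).ev a' y (s ≫ m) hsm =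
          act F a y x hx ((evalObj_span S P).ev a x s hs)
            ((evalObj_span S P).ev_isHomLift a x s hs) := by
  have hk := c.cart_isStronglyCartesian (fst P.base Q.bound) (evalObj S P)
  have h₁ : lift (fst P.base Q.bound) (snd P.base Q.bound) ≫ F.f₁ = F.f₁ := by simp
  obtain ⟨m, hm, H⟩ := (evalObj_span S Q).exists_of_generic F.f₀ hk
    (act F (fst _ _) (snd _ _) F.f₁ h₁
      ((evalObj_span S P).ev (fst P.base Q.bound) F.f₁ _ hk.toIsHomLift)
      ((evalObj_span S P).ev_isHomLift (fst P.base Q.bound) F.f₁ _ hk.toIsHomLift))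
    (isHomLift_congr (by ext <;> simp) (act_isHomLift F rfl ..))
  refine ⟨m, hm, ?_⟩
  intro K a a' ea y x hx W s hs hsm
  have hl := cartLift_isHomLift hk (lift a y) (lift_fst a y) s hs
  have hl' := cartLift_fac hk (lift a y) (lift_fst a y) s hs
  have e := (evalObj_span S P).comp_ev (lift_fst a y) hx _ hl _ hk.toIsHomLift
    (by rw [hl']; exact hs)
  rw [H a ea y s hs hsm, ← comp_act F h₁ hx (lift_fst a y) (lift_snd a y) _ hl]
  · exact act_congr _ _ rfl rfl rfl (e.symm.trans ((evalObj_span S P).ev_congr _ _ rfl rfl hl'))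
  · exact isHomLift_comp hl ((evalObj_span S P).ev_isHomLift ..) (by rw [comp_lift, lift_fst, hx])

/-- The arrow of `exists_evalMap`. -/
def evalMap {P Q : ProdCompletion c} (F : P ⟶ Q) : (evalObj S P).1 ⟶ (evalObj S Q).1 :=
  (exists_evalMap S F).choose

theorem evalMap_isHomLift {P Q : ProdCompletion c} (F : P ⟶ Q) :
    p.IsHomLift F.f₀ (evalMap S F) :=
  (exists_evalMap S F).choose_spec.choose

theorem ev_evalMap {P Q : ProdCompletion c} (F : P ⟶ Q) {K : B} (a : K ⟶ P.base) {a' : K ⟶ Q.base}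
    (ea : a ≫ F.f₀ = a') (y : K ⟶ Q.bound) (x : K ⟶ P.bound) (hx : lift a y ≫ F.f₁ = x) {W : E}
    (s : W ⟶ (evalObj S P).1) (hs : p.IsHomLift a s) (hsm : p.IsHomLift a' (s ≫ evalMap S F)) :
    (evalObj_span S Q).ev a' y (s ≫ evalMap S F) hsm =
      act F a y x hx ((evalObj_span S P).ev a x s hs)
        ((evalObj_span S P).ev_isHomLift a x s hs) :=
  (exists_evalMap S F).choose_spec.choose_spec a ea y x hx s hs hsm

/-- An arrow with the instances prescribed by `F` is the one denoted by `F`. -/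
theorem eq_evalMap {P Q : ProdCompletion c} (F : P ⟶ Q) {m : (evalObj S P).1 ⟶ (evalObj S Q).1}
    (hm : p.IsHomLift F.f₀ m)
    (H : ∀ {K : B} (a : K ⟶ P.base) (y : K ⟶ Q.bound) (x : K ⟶ P.bound)
      (hx : lift a y ≫ F.f₁ = x) {W : E} (s : W ⟶ (evalObj S P).1) (hs : p.IsHomLift a s)
      (hsm : p.IsHomLift (a ≫ F.f₀) (s ≫ m)),
      (evalObj_span S Q).ev (a ≫ F.f₀) y (s ≫ m) hsm =
        act F a y x hx ((evalObj_span S P).ev a x s hs)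
          ((evalObj_span S P).ev_isHomLift a x s hs)) : m = evalMap S F := by
  have hk := c.cart_isStronglyCartesian (fst P.base Q.bound) (evalObj S P)
  refine (evalObj_span S Q).hom_ext hk hm (evalMap_isHomLift S F) ?_
  rw [H _ _ _ rfl _ hk.toIsHomLift, ev_evalMap S F _ rfl _ _ rfl _ hk.toIsHomLift]

/-- The functor from the completion to `E` sending `(I, X, α)` to the simple product `∏ α`. -/
def eval : ProdCompletion c ⥤ E where
  obj P := (evalObj S P).1
  map F := evalMap S F
  map_id P := by
    refine (eq_evalMap S (𝟙 P) (isHomLift_id (evalObj S P).2) ?_).symm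
    intro K a y x hx W s hs hsm
    obtain rfl : y = x := by rw [← hx]; exact (lift_snd a y).symm
    rw [act_id]
    exact (evalObj_span S P).ev_congr _ _ (Category.comp_id a) rfl (Category.comp_id s)
  map_comp {P Q R} F G := by
    refine (eq_evalMap S (F ≫ G) (isHomLift_comp (evalMap_isHomLift S F)
      (evalMap_isHomLift S G) rfl) ?_).symm
    intro K a z x hx W s hs hsm
    have hF := isHomLift_comp hs (evalMap_isHomLift S F) rfl
    have hx' : lift a (lift (a ≫ F.f₀) z ≫ G.f₁) ≫ F.f₁ = x := by
      rw [← hx, comp_f₁]; simp [comp_lift_assoc]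
    have e₁ := ev_evalMap S G (a ≫ F.f₀) rfl z _ rfl (s ≫ evalMap S F) hF
      (isHomLift_comp hF (evalMap_isHomLift S G) rfl)
    have e₂ := ev_evalMap S F a rfl (lift (a ≫ F.f₀) z ≫ G.f₁) x hx' s hs hF
    refine ((evalObj_span S R).ev_congr hsm (isHomLift_comp hF (evalMap_isHomLift S G) rfl)
      (Category.assoc _ _ _).symm rfl (Category.assoc _ _ _).symm).trans (e₁.trans ?_)
    rw [act_comp F G a z (lift (a ≫ F.f₀) z ≫ G.f₁) x _ rfl rfl hx' hx]
    exact act_congr _ _ rfl rfl rfl e₂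

theorem eval_map_isHomLift {P Q : ProdCompletion c} (F : P ⟶ Q) :
    p.IsHomLift F.f₀ ((eval S).map F) :=
  evalMap_isHomLift S F

theorem eval_comp : eval S ⋙ p = proj c :=
  CategoryTheory.Functor.ext (fun P => (evalObj S P).2) fun _ _ F =>
    have := eval_map_isHomLift S F
    IsHomLift.fac' p F.f₀ ((eval S).map F)

/-- The components of `F` present the generic instance of the arrow denoted by `F` as an
instantiation followed by an arrow of the completion. -/
theorem factorsAt_eval {P Q : ProdCompletion c} (F : P ⟶ Q)
    (hk : p.IsHomLift (fst P.base Q.bound) (c.cart (fst P.base Q.bound) (evalObj S P)))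
    (h : p.IsHomLift (fst P.base Q.bound ≫ F.f₀)
      (c.cart (fst P.base Q.bound) (evalObj S P) ≫ (eval S).map F)) :
    (evalObj_span S P).FactorsAt (fst P.base Q.bound) _ hk
      (lift (fst P.base Q.bound ≫ F.f₀) (snd P.base Q.bound))
      ((evalObj_span S Q).ev (fst P.base Q.bound ≫ F.f₀) (snd P.base Q.bound) _ h) F.f₁
      (c.cart (lift (fst P.base Q.bound) F.f₁) P.form) (tot F) := by
  refine ⟨c.cart_isStronglyCartesian _ _, tot_isHomLift F, _, ?_, ?_,
    (ev_evalMap S F (fst P.base Q.bound) rfl (snd P.base Q.bound) F.f₁ (by simp) _ hk h).symm⟩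
  · exact isHomLift_congr (by simp) (cartLift_isHomLift ..)
  · exact cartLift_fac ..

/-- Into quantifier-free forms, arrows of the completion are the same as arrows between the simple
products they denote. -/
theorem eval_map_bijective {P Q : ProdCompletion c} (hQ : IsQF p Q.form.1) :
    Function.Bijective ((eval S).map : (P ⟶ Q) → _) := by
  have hk := c.cart_isStronglyCartesian (fst P.base Q.bound) (evalObj S P)
  constructor
  · intro F G e
    have hF := eval_map_isHomLift S F
    have hG := eval_map_isHomLift S G
    have h₀ : F.f₀ = G.f₀ := isHomLift_unique hF (e ▸ hG)
    have H := hQ.hasUniqueFactor c (evalObj_span S P) hk ((evalObj_span S Q).ev_isHomLift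
      (fst P.base Q.bound ≫ F.f₀) (snd P.base Q.bound) _ (isHomLift_comp hk.toIsHomLift hF rfl))
    have f₁ := factorsAt_eval S F hk.toIsHomLift (isHomLift_comp hk.toIsHomLift hF rfl)
    have f₂ := factorsAt_eval S G hk.toIsHomLift (isHomLift_comp hk.toIsHomLift hG rfl)
    obtain ⟨a₀, a₁, φ⟩ := F
    obtain ⟨b₀, b₁, ψ⟩ := G
    dsimp only at h₀
    subst h₀
    simp only [← e] at f₂
    obtain rfl : a₁ = b₁ := H.unique_term _ _ _ _ _ _ _ _ f₁ f₂
    have := c.vertical_ext _ _ (H.unique_arrow _ _ _ _ _ f₁ f₂)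
    dsimp only at this
    rw [this]
  · intro m
    obtain ⟨f₀, hm⟩ := exists_isHomLift (evalObj S P).2 (evalObj S Q).2 m
    have hkm := isHomLift_comp hk.toIsHomLift hm rfl
    obtain ⟨⟨g, H⟩, -, -⟩ := hQ.hasUniqueFactor c (evalObj_span S P) hk
      ((evalObj_span S Q).ev_isHomLift (fst P.base Q.bound ≫ f₀) (snd P.base Q.bound) _ hkm)
    obtain ⟨h', hc, hh', σ, hσ, e₁, e₂⟩ := H _ (c.cart (lift (fst P.base Q.bound) g) P.form)
      (c.cart_isStronglyCartesian _ _)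
    let F : P ⟶ Q := mkHom f₀ g h' hh'
    refine ⟨F, (evalObj_span S Q).hom_ext hk (eval_map_isHomLift S F) hm ?_⟩
    have hF := isHomLift_comp hk.toIsHomLift (eval_map_isHomLift S F) rfl
    have hg : lift (fst P.base Q.bound) (snd P.base Q.bound) ≫ g = g := by simp
    refine (ev_evalMap S F (fst P.base Q.bound) rfl (snd P.base Q.bound) g hg _
      hk.toIsHomLift hF).trans ((act_mkHom f₀ g h' hh' _ _ _ hg _ _).trans (Eq.trans ?_ e₂))
    congr 1
    refine cart_ext hc (𝟙 _) (isHomLift_congr (by simp) (cartLift_isHomLift ..)) hσ ?_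
    rw [cartLift_fac, e₁]

end ProdCompletion

/-! ### The fibration of quantifier-free objects -/

section Restriction

variable {B : Type u₁} [Category.{v₁} B] {E : Type u₂} [Category.{v₂} E] {p : E ⥤ B}

section Cleavage

variable (c : SplitCleavage p) (Φ : ObjectProperty E)

/-- An object of a fibre of the full subcategory `Φ`, as an object of the fibre of `p`. -/
abbrev fiberForget {Φ : ObjectProperty E} {I : B} (Y : (Φ.ι ⋙ p).Fiber I) : p.Fiber I :=
  ⟨Y.1.obj, Y.2⟩

theorem fiberForget_injective {Φ : ObjectProperty E} {I : B} {X Y : (Φ.ι ⋙ p).Fiber I}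
    (h : fiberForget X = fiberForget Y) : X = Y :=
  Subtype.ext (ObjectProperty.FullSubcategory.ext (congrArg Subtype.val h))

theorem hom_eqToHom {Φ : ObjectProperty E} {X Y : Φ.FullSubcategory} (h : X = Y) :
    (eqToHom h).hom = eqToHom (congrArg ObjectProperty.FullSubcategory.obj h) := by
  subst h; rfl

section

variable (hΦ : ∀ {I J : B} (u : I ⟶ J) (Y : p.Fiber J), Φ Y.1 → Φ (c.pull u Y).1)

/-- Reindexing in a full subcategory closed under reindexing. -/
def SplitCleavage.restrictPull {I J : B} (u : I ⟶ J) (Y : (Φ.ι ⋙ p).Fiber J) :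
    (Φ.ι ⋙ p).Fiber I :=
  ⟨⟨(c.pull u (fiberForget Y)).1, hΦ u (fiberForget Y) Y.1.property⟩,
    (c.pull u (fiberForget Y)).2⟩

theorem SplitCleavage.restrictPull_comp {I J K : B} (u : I ⟶ J) (v : J ⟶ K)
    (Y : (Φ.ι ⋙ p).Fiber K) :
    c.restrictPull Φ hΦ (u ≫ v) Y = c.restrictPull Φ hΦ u (c.restrictPull Φ hΦ v Y) :=
  fiberForget_injective (c.pull_comp u v (fiberForget Y))

theorem SplitCleavage.restrictPull_id {J : B} (Y : (Φ.ι ⋙ p).Fiber J) :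
    c.restrictPull Φ hΦ (𝟙 J) Y = Y :=
  fiberForget_injective (c.pull_id (fiberForget Y))

/-- A split cleavage restricts to a full subcategory closed under reindexing. -/
def SplitCleavage.restrict : SplitCleavage (Φ.ι ⋙ p) where
  pull u Y := c.restrictPull Φ hΦ u Y
  cart u Y := ObjectProperty.homMk (c.cart u (fiberForget Y))
  cart_isStronglyCartesian u Y :=
    isStronglyCartesian_of_map (F := Φ.ι) (c.cart_isStronglyCartesian u (fiberForget Y))
  pull_id Y := c.restrictPull_id Φ hΦ Y
  pull_comp u v Y := c.restrictPull_comp Φ hΦ u v Y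
  cart_id Y := ObjectProperty.hom_ext _
    ((c.cart_id (fiberForget Y)).trans
      (hom_eqToHom (congrArg Subtype.val (c.restrictPull_id Φ hΦ Y))).symm)
  cart_comp u v Y := ObjectProperty.hom_ext _ ((c.cart_comp u v (fiberForget Y)).trans
    (congrArg (fun t => t ≫ c.cart u (c.pull v (fiberForget Y)) ≫ c.cart v (fiberForget Y))
      (hom_eqToHom (congrArg Subtype.val (c.restrictPull_comp Φ hΦ u v Y))).symm))

variable {Φ} in
/-- A vertical arrow of the full subcategory `Φ`, as a vertical arrow of `p`. -/
abbrev fiberForgetHom {I : B} {X Y : (Φ.ι ⋙ p).Fiber I} (φ : X ⟶ Y) :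
    fiberForget X ⟶ fiberForget Y :=
  ⟨φ.1.hom, isHomLift_comp_iff.1 φ.2⟩

variable {Φ} in
theorem fiberForgetHom_eqToHom {I : B} {X Y : (Φ.ι ⋙ p).Fiber I} (h : X = Y) :
    fiberForgetHom (eqToHom h) = eqToHom (congrArg fiberForget h) := by
  subst h; rfl

theorem SplitCleavage.restrict_sub {I J K L : B} (w : I ⟶ J) {u : J ⟶ K} {v : J ⟶ L} {u' : I ⟶ K}
    {v' : I ⟶ L} (hu : w ≫ u = u') (hv : w ≫ v = v') {X : (Φ.ι ⋙ p).Fiber K}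
    {Y : (Φ.ι ⋙ p).Fiber L}
    (φ : (c.restrict Φ hΦ).pull u X ⟶ (c.restrict Φ hΦ).pull v Y) :
    fiberForgetHom ((c.restrict Φ hΦ).sub w hu hv φ) =
      c.sub w hu hv (X := fiberForget X) (Y := fiberForget Y) (fiberForgetHom φ) := by
  apply c.vertical_ext
  refine Eq.trans ?_ (c.sub_cart w hu hv (X := fiberForget X) (Y := fiberForget Y)
    (fiberForgetHom φ)).symm
  refine (congrArg InducedCategory.Hom.hom ((c.restrict Φ hΦ).sub_cart w hu hv φ)).trans ?_
  exact congrArg (fun t => t ≫ c.cart w (c.pull u (fiberForget X)) ≫ φ.1.hom ≫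
    c.cart v (fiberForget Y)) (hom_eqToHom
      (congrArg Subtype.val ((c.restrict Φ hΦ).pull_of_comp_eq hu X)))

end

end Cleavage

variable [CartesianMonoidalCategory B]

namespace ProdCompletion

variable {c : SplitCleavage p} {Φ : ObjectProperty E}
  (hΦ : ∀ {I J : B} (u : I ⟶ J) (Y : p.Fiber J), Φ Y.1 → Φ (c.pull u Y).1)

/-- The completion of a full subcategory, as a full subcategory of the completion. -/
def incl : ProdCompletion (c.restrict Φ hΦ) ⥤ ProdCompletion c where
  obj P := ⟨P.base, P.bound, fiberForget P.form⟩
  map F := ⟨F.f₀, F.f₁, fiberForgetHom F.φ⟩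
  map_id P := by
    have h : lift (fst P.base P.bound) (snd P.base P.bound) =
      lift (fst P.base P.bound ≫ 𝟙 P.base) (snd P.base P.bound) := by simp
    exact congrArg (Hom.mk _ _)
      (fiberForgetHom_eqToHom (congrArg (fun t => (c.restrict Φ hΦ).pull t P.form) h))
  map_comp F G := congrArg (Hom.mk _ _) (congrArg₂ (fun s t => s ≫ t)
    (c.restrict_sub Φ hΦ _ _ _ F.φ) (c.restrict_sub Φ hΦ _ _ _ G.φ))

theorem incl_map_bijective {P Q : ProdCompletion (c.restrict Φ hΦ)} :
    Function.Bijective ((incl hΦ).map : (P ⟶ Q) → _) := by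
  constructor
  · rintro ⟨f₀, f₁, φ⟩ ⟨g₀, g₁, ψ⟩ e
    injection e with e₀ e₁ e₂
    subst e₀ e₁
    have e₂ := congrArg Subtype.val (eq_of_heq e₂)
    have : φ = ψ := Subtype.ext (ObjectProperty.hom_ext _ e₂)
    rw [this]
  · rintro ⟨f₀, f₁, φ⟩
    exact ⟨⟨f₀, f₁, ⟨ObjectProperty.homMk φ.1, isHomLift_comp_iff.2 φ.2⟩⟩, rfl⟩

end ProdCompletion

/-- Quantifier-free objects are closed under reindexing. -/
theorem IsQF.of_cart {I J : B} {u : I ⟶ J} {a a' : E} {φ : a' ⟶ a}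
    (hφ : p.IsStronglyCartesian u φ) (ha : IsQF p a) : IsQF p a' := by
  intro A X V P b k ε hs I' f h hh
  obtain rfl : I' = I := (IsHomLift.codomain_eq p f h).symm.trans
    (have := hφ.toIsHomLift; IsHomLift.domain_eq p u φ)
  have key : ∀ (g : A ⟶ X) {b' : E} (c : b' ⟶ b) (h' : b' ⟶ a'), p.IsHomLift f h' →
      (hs.FactorsAt (𝟙 A) (𝟙 P) hs.id_isHomLift f h g c h' ↔
        hs.FactorsAt (𝟙 A) (𝟙 P) hs.id_isHomLift (f ≫ u) (h ≫ φ) g c (h' ≫ φ)) := by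
    intro g b' c h' hh'
    constructor
    · rintro ⟨hc, -, σ, hσ, e₁, e₂⟩
      exact ⟨hc, isHomLift_comp hh' hφ.toIsHomLift rfl, σ, hσ, e₁, by rw [← Category.assoc, e₂]⟩
    · rintro ⟨hc, -, σ, hσ, e₁, e₂⟩
      refine ⟨hc, hh', σ, hσ, e₁, cart_ext hφ f (isHomLift_id_comp hσ hh') hh ?_⟩
      rw [Category.assoc, e₂]
  obtain ⟨⟨g, H₀⟩, H₁, H₂⟩ := ha k ε hs (f ≫ u) (h ≫ φ) (isHomLift_comp hh hφ.toIsHomLift rfl)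
  refine ⟨⟨g, fun b' c hc => ?_⟩, ?_, ?_⟩
  · obtain ⟨h', F⟩ := H₀ b' c hc
    have e := cartLift_fac hφ f rfl h' F.isHomLift
    exact ⟨_, (key g c _ (cartLift_isHomLift hφ f rfl h' F.isHomLift)).2 (e.symm ▸ F)⟩
  · intro g₁ g₂ b₁ b₂ c₁ c₂ h₁ h₂ F₁ F₂
    exact H₁ _ _ _ _ _ _ _ _ ((key _ _ _ F₁.isHomLift).1 F₁) ((key _ _ _ F₂.isHomLift).1 F₂)
  · intro g b' c h₁ h₂ F₁ F₂
    exact cart_ext hφ f F₁.isHomLift F₂.isHomLift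
      (H₂ _ _ _ _ _ ((key _ _ _ F₁.isHomLift).1 F₁) ((key _ _ _ F₂.isHomLift).1 F₂))

/-- If `p` has enough quantifier-free objects, then it is the simple product completion of its
fibration of quantifier-free objects. -/
theorem exists_fibredEquivalence_of_hasEnoughQF {c : SplitCleavage p} (S : SimpleProducts c)
    (H : HasEnoughQF p) :
    ∃ (E' : Type u₂) (_ : Category.{v₂} E') (q : E' ⥤ B) (d : SplitCleavage q),
      Nonempty (FibredEquivalence (ProdCompletion.proj d) p) := by
  let Φ : ObjectProperty E := IsQF p
  have hΦ : ∀ {I J : B} (u : I ⟶ J) (Y : p.Fiber J), Φ Y.1 → Φ (c.pull u Y).1 :=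
    fun u Y hY => IsQF.of_cart (c.cart_isStronglyCartesian u Y) hY
  refine ⟨Φ.FullSubcategory, inferInstance, Φ.ι ⋙ p, c.restrict Φ hΦ, ?_⟩
  let F : ProdCompletion (c.restrict Φ hΦ) ⥤ E :=
    ProdCompletion.incl hΦ ⋙ ProdCompletion.eval S
  have hF : ∀ {P Q : ProdCompletion (c.restrict Φ hΦ)},
      Function.Bijective (F.map : (P ⟶ Q) → _) := fun {P Q} =>
    (ProdCompletion.eval_map_bijective S (P := (ProdCompletion.incl hΦ).obj P)
      (Q := (ProdCompletion.incl hΦ).obj Q) Q.form.1.property).comp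
      (ProdCompletion.incl_map_bijective hΦ)
  have : F.Full := ⟨hF.2⟩
  have : F.Faithful := ⟨fun h => hF.1 h⟩
  have hp : F ⋙ p = ProdCompletion.proj (c.restrict Φ hΦ) :=
    congrArg (fun G => ProdCompletion.incl hΦ ⋙ G) (ProdCompletion.eval_comp S)
  have surj : VertEssSurj F p := by
    intro P
    obtain ⟨X, V, b, k, ε, hs, hb⟩ := H P
    have := hs.vert
    let β : p.Fiber (p.obj P ⊗ X) := ⟨b, IsHomLift.codomain_eq p (𝟙 (p.obj P ⊗ X)) ε⟩
    obtain ⟨ψ, hψ, -⟩ := (S.isProdSpan β).exists_iso hs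
    exact ⟨⟨p.obj P, X, ⟨⟨b, hb⟩, β.2⟩⟩, ψ, hψ⟩
  exact hp ▸ ⟨surj.fibredEquivalence⟩

end Restriction

end SplitFib

end

open SplitFib in
theorem mainTheorem3 {B : Type u₁} [Category.{v₁} B] [CartesianMonoidalCategory B]
    {E : Type u₂} [Category.{v₂} E] (p : E ⥤ B)
    (c : SplitFib.SplitCleavage p) (S : SplitFib.SimpleProducts c) :
    (∃ (E' : Type u₂) (_ : Category.{v₂} E') (q : E' ⥤ B) (d : SplitFib.SplitCleavage q),
        Nonempty (SplitFib.FibredEquivalence (SplitFib.ProdCompletion.proj d) p)) ↔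
      S.HasEnoughQuantifierFree := by
  rw [S.hasEnoughQuantifierFree_iff]
  constructor
  · rintro ⟨E', _, q, d, ⟨e⟩⟩
    exact (ProdCompletion.hasEnoughQF_proj d).of_fibredEquivalence e
  · exact exists_fibredEquivalence_of_hasEnoughQF S
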